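/- Let $T^2_1=\mathbb{C}/(\sqrt2\pi\mathbb{Z}+\sqrt2\pi i\,\mathbb{Z})$ and let $f^1:T^2_1\to S^3\subset\mathbb{C}^2$, $f^1(x,y)=\tfrac1{\sqrt2}\big(e^{i\sqrt2x},e^{i\sqrt2y}\big)$, be the Clifford torus, with unit normal $\vec n$ in $S^3$. For a smooth immersion $f:T^2_1\to S^3$ let $\mathcal W(f)=\int_{T_1^2}(H^2+1)\,dA$ be its Willmore energy, where $H=\tfrac12\operatorname{tr}\mathrm{II}$ is the mean curvature in $S^3$, and let $\Pi(f)=(\Pi^1(f),\Pi^2(f))\in\mathbb{H}^2$ be its point in Teichmüller space: the unique $\tau=\Pi^1(f)+i\,\Pi^2(f)$ with $\operatorname{Im}\tau>0$ for which there is an orientation preserving conformal diffeomorphism from $(T^2_1,f^*g_{S^3})$ to $\mathbb{C}/(\mathbb{Z}+\tau\mathbb{Z})$ sending the periods $\sqrt2\pi,\ \sqrt2\pi i$ to $1,\ \tau$; thus $\Pi(f^1)=(0,1)$. Put $\mathcal W_\alpha=\mathcal W-\alpha\,\Pi^1$. For smooth functions $\Phi,\Psi$ on $T^2_1$ let $$\delta^2\mathcal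 W_\alpha(f^1)(\Phi\vec n,\Psi\vec n)=\partial_s\partial_t\big|_{s=t=0}\,\mathcal W_\alpha\big(\exp_{f^1}((s\Phi+t\Psi)\vec n)\big)$$ be the second variation in normal directions, where $\exp$ is the exponential map of $S^3$, and write $\delta^2\mathcal W_\alpha(f^1)\ge0$ if $\delta^2\mathcal W_\alpha(f^1)(\Phi\vec n,\Phi\vec n)\ge0$ for all smooth $\Phi$. Then, for all smooth $\Phi,\Psi$ on $T^2_1$ and for $(s,t)$ near $0$, the map $\exp_{f^1}((s\Phi+t\Psi)\vec n)$ is a smooth immersion with a unique point in Teichmüller space, and its $\mathcal W$ and $\Pi^1$ are $C^2$ functions of $(s,t)$ at $0$. Moreover $$\alpha^1:=\max\{\alpha>0\ :\ \delta^2\mathcal W_\alpha(f^1)\ge0\}=10\pi^2 .$$ The kernel of $\delta^2\mathcal W_{10\pi^2}(f^1)$, that is, the set of smooth $\Phi$ with $\delta^2\mathcal W_{10\pi^2}(f^1)(\Phi\vec n,\Psi\vec n)=0$ for all smooth $\Psi$, is the direct sum of the space of normal components $\langle X\circ f^1,\vec n\rangle$ of infinitesimal Möbius transformations $X$ of $S^3$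 and the $4$-dimensional space spanned by $$\sin\big(\sqrt2(x+2y)\big),\quad \cos\big(\sqrt2(x+2y)\big),\quad \sin\big(\sqrt2(2x+y)\big),\quad \cos\big(\sqrt2(2x+y)\big).$$ -/

import Mathlib

open Real MeasureTheory Filter Topology
open scoped ContDiff

noncomputable section

/-- The ambient space `ℝ⁴ = ℂ²` of the round unit sphere `S³`. -/
abbrev E4 : Type := EuclideanSpace ℝ (Fin 4)

/-- The side length of the square torus `T² = ℂ / (√2 π ℤ + √2 π i ℤ)`; a point `x + i y` of `ℂ` is
written `(x, y) : ℝ × ℝ`, and maps on the torus are maps on the plane with these two periods. -/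
def side : ℝ := √2 * π

/-- Invariance under the lattice `√2 π ℤ + √2 π i ℤ`. -/
def IsDoublyPeriodic {X : Type*} (u : ℝ × ℝ → X) : Prop :=
  ∀ p : ℝ × ℝ, u (p + (side, 0)) = u p ∧ u (p + (0, side)) = u p

/-- Smooth real functions on the torus. -/
def IsTorusFunction (Φ : ℝ × ℝ → ℝ) : Prop :=
  ContDiff ℝ ∞ Φ ∧ IsDoublyPeriodic Φ

/-- Smooth immersions of the torus into `S³`. -/
structure IsTorusImmersion (f : ℝ × ℝ → E4) : Prop where
  smooth : ContDiff ℝ ∞ f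
  periodic : IsDoublyPeriodic f
  mem_sphere : ∀ p, ‖f p‖ = 1
  immersive : ∀ p, Function.Injective (fderiv ℝ f p)

/-- The coordinate derivative `∂ₓ`. -/
def dx (f : ℝ × ℝ → E4) (p : ℝ × ℝ) : E4 := fderiv ℝ f p (1, 0)

/-- The coordinate derivative `∂_y`. -/
def dy (f : ℝ × ℝ → E4) (p : ℝ × ℝ) : E4 := fderiv ℝ f p (0, 1)

/-- The triple cross product in `ℝ⁴`: `⟪e, cross a b c⟫ = det (e, a, b, c)`. -/
def cross (a b c : E4) : E4 :=
  WithLp.toLp 2 fun i => Matrix.det ![Pi.single i (1 : ℝ), a.ofLp, b.ofLp, c.ofLp]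

/-- The unit normal field, tangent to `S³`, of an immersion into `S³`. -/
def unitNormal (f : ℝ × ℝ → E4) (p : ℝ × ℝ) : E4 :=
  ‖cross (f p) (dx f p) (dy f p)‖⁻¹ • cross (f p) (dx f p) (dy f p)

/-- The determinant `EG - F²` of the first fundamental form `f^* g_{S³}`. -/
def gramDet (f : ℝ × ℝ → E4) (p : ℝ × ℝ) : ℝ :=
  inner ℝ (dx f p) (dx f p) * inner ℝ (dy f p) (dy f p) - inner ℝ (dx f p) (dy f p) ^ 2

/-- The mean curvature `H = ½ tr_g II` in `S³`. -/
def meanCurvature (f : ℝ × ℝ → E4) (p : ℝ × ℝ) : ℝ :=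
  (inner ℝ (dy f p) (dy f p) * inner ℝ (dx (dx f) p) (unitNormal f p)
    - 2 * inner ℝ (dx f p) (dy f p) * inner ℝ (dx (dy f) p) (unitNormal f p)
    + inner ℝ (dx f p) (dx f p) * inner ℝ (dy (dy f) p) (unitNormal f p)) / (2 * gramDet f p)

/-- The Willmore energy `W(f) = ∫ (H² + 1) dA` of an immersed torus in `S³`. -/
def willmore (f : ℝ × ℝ → E4) : ℝ :=
  ∫ p in Set.Icc (0 : ℝ) side ×ˢ Set.Icc (0 : ℝ) side,
    (meanCurvature f p ^ 2 + 1) * √(gramDet f p)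

/-- `τ` is the point of Teichmüller space of the metric `f^* g_{S³}`: there is an orientation
preserving conformal diffeomorphism onto `ℂ / (ℤ + τ ℤ)` that maps the generators of the period
lattice to `1` and `τ`. (Conformal `C¹` diffeomorphisms are biholomorphic, so they are smooth.) -/
def IsTeichmuellerClass (f : ℝ × ℝ → E4) (τ : UpperHalfPlane) : Prop :=
  ∃ w : ℝ × ℝ → ℂ, ContDiff ℝ 1 w ∧ Function.Bijective w ∧
    (∀ p, w (p + (side, 0)) = w p + 1 ∧ w (p + (0, side)) = w p + (τ : ℂ)) ∧
    (∀ p, ∃ ρ : ℝ, 0 < ρ ∧ ∀ v, ‖fderiv ℝ w p v‖ = ρ * ‖fderiv ℝ f p v‖) ∧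
    ∀ p, 0 < (starRingEnd ℂ (fderiv ℝ w p (1, 0)) * fderiv ℝ w p (0, 1)).im

/-- The projection `Π` to Teichmüller space, modelled by the upper half plane. -/
def teichmueller (f : ℝ × ℝ → E4) : UpperHalfPlane :=
  Classical.epsilon (IsTeichmuellerClass f)

/-- The first coordinate `Π¹` of `Π = (Π¹, Π²)`. -/
def teichmuellerOne (f : ℝ × ℝ → E4) : ℝ := (teichmueller f).re

/-- The penalized Willmore energy `W_α = W - α Π¹`. -/
def penalizedWillmore (α : ℝ) (f : ℝ × ℝ → E4) : ℝ := willmore f - α * teichmuellerOne f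

/-- The Clifford torus `f¹(x, y) = (e^{i√2x}, e^{i√2y}) / √2`. -/
def cliffordTorus (p : ℝ × ℝ) : E4 :=
  (√2)⁻¹ • !₂[cos (√2 * p.1), sin (√2 * p.1), cos (√2 * p.2), sin (√2 * p.2)]

/-- The normal variation `exp_f (Φ n)`, with `exp` the exponential map of `S³`. -/
def normalVariation (f : ℝ × ℝ → E4) (Φ : ℝ × ℝ → ℝ) (p : ℝ × ℝ) : E4 :=
  cos (Φ p) • f p + sin (Φ p) • unitNormal f p

/-- The second variation `δ²E(f)(Φ n, Ψ n)` of a functional `E` in normal directions. -/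
def secondVariation (E : (ℝ × ℝ → E4) → ℝ) (f : ℝ × ℝ → E4) (Φ Ψ : ℝ × ℝ → ℝ) : ℝ :=
  deriv (fun s : ℝ => deriv (fun t : ℝ => E (normalVariation f (s • Φ + t • Ψ))) 0) 0

/-- The action of a Lorentz matrix on `S³`, viewed as the projectivized light cone: the Möbius
transformation `q ↦ y / y₀`, where `(y, y₀) = Λ (q, 1)`. -/
def moebius (Λ : Matrix (Fin 4 ⊕ Fin 1) (Fin 4 ⊕ Fin 1) ℝ) (q : E4) : E4 :=
  WithLp.toLp 2 fun i =>
    (Λ.mulVec (Sum.elim q.ofLp 1)) (Sum.inl i) / (Λ.mulVec (Sum.elim q.ofLp 1)) (Sum.inr 0)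

/-- `Φ` is the normal component of an infinitesimal Möbius transformation of `S³` along `f`: of the
initial velocity of `exp (t B) ∘ f` for some `B` in the Lie algebra `so(4, 1)`. -/
def IsMoebiusVariation (f : ℝ × ℝ → E4) (Φ : ℝ × ℝ → ℝ) : Prop :=
  ∃ B ∈ LieAlgebra.Orthogonal.so' (Fin 4) (Fin 1) ℝ, ∀ p,
    Φ p = inner ℝ (deriv (fun t : ℝ => moebius (NormedSpace.exp (t • B)) (f p)) 0) (unitNormal f p)

/-- The functions `sin √2(x+2y)`, `cos √2(x+2y)`, `sin √2(2x+y)`, `cos √2(2x+y)`. -/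
def kernelMode : Fin 4 → ℝ × ℝ → ℝ :=
  ![fun p => sin (√2 * (p.1 + 2 * p.2)), fun p => cos (√2 * (p.1 + 2 * p.2)),
    fun p => sin (√2 * (2 * p.1 + p.2)), fun p => cos (√2 * (2 * p.1 + p.2))]

end

/-!
The proof follows the energies of graphs over the Clifford torus as smooth functions of the `2`-jet
of the height function, with values computed in the Wiener algebra `Wiener` of absolutely convergent
Fourier series on the torus. This algebra is a commutative Banach algebra (`Wiener.ev_mul`), it
contains all smooth functions (`IsTorusFunction.toWiener`), and the Beurling transform acts on it as
the contractive Fourier multiplier `κ̄ / κ`, `κ = k₁ + i k₂` (`beurling`). All nonlinear problems are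
therefore solved by the implicit function theorem in `Wiener`, without elliptic regularity theory.

*Willmore energy.* For the graph of `v` the integrand is `N² / (4 D^(5/2)) + D^(1/2)`, where `N` and
`D` are polynomials in `sin 2v`, `cos 2v` and the derivatives of `v`. The factor `D^(-1/2)` is a
smooth function of the jet by `exists_invSqrt`, and integration reads off the coefficient of index
`0` (`IsTorusFunction.willmore_cliffordGraph`).

*Teichmüller class.* A conformal coordinate `w` with `w_z̄ = b` and `w_z = 1 + S b`, `S` the Beurling
transform, exists when the null condition `G w_x² - 2 F w_x w_y + E w_y² = 0` holds. This is an
equation for `b` in `Wiener`, solved in `exists_beltrami`; small `b` gives a diffeomorphism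
(`exists_isTeichmuellerClass`) whose class is `τ = i (1 - b₀) / (1 + b₀)`, where `b₀` is the
coefficient of index `0`. The class is unique by Liouville's theorem
(`isTeichmuellerClass_unique`), so `Π¹` is a smooth function of the jet.

*Second variation.* Along rays `r ↦ r Φ` both energies have no linear term and explicit quadratic
terms `quadWillmore`, `quadTeichmueller`. With `n = k₁² + k₂²` and `φ_k` the coefficients of `Φ`
they are `2π² ∑ (n - 1)(n - 2) |φ_k|²` and `∑ 2 k₁ k₂ (n - 2) / n |φ_k|²`. Hence
`δ²W_α` is diagonal in Fourier modes, with `eigenvalue α k` given by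
`2π² (n - 1)(n - 2) - 2 α k₁ k₂ (n - 2) / n` (`IsTorusFunction.hasSum_secondVariation`). For
`α = 10π²` and `n > 2` this has the sign of `n (n - 1) - 10 k₁ k₂`, which is nonnegative and vanishes
exactly for `±(1, 2)` and `±(2, 1)`; the mode `(1, 2)` becomes negative for larger `α`. The other
zeros are the modes with `n = 1` and `n = 2`. These eight dimensions are the normal components of the
infinitesimal Möbius transformations: those with `n = 1` come from the Lorentz boosts and those with
`n = 2` from the rotations which mix the two circle factors (`isMoebiusVariation_iff_wave`).
-/


noncomputable section

/-! ### Characters of the torus -/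

/-- The character `e_k(x, y) = exp (i √2 (k₁ x + k₂ y))` of the torus. -/
def chr (k : ℤ × ℤ) (p : ℝ × ℝ) : ℂ :=
  Complex.exp (((√2 * (k.1 * p.1 + k.2 * p.2) : ℝ) : ℂ) * Complex.I)

/-- The closed fundamental square. -/
def cell : Set (ℝ × ℝ) := Set.Icc (0 : ℝ) side ×ˢ Set.Icc (0 : ℝ) side

lemma side_pos : 0 < side := by unfold side; positivity

lemma sqrt_two_mul_side : √2 * side = 2 * π := by
  unfold side; rw [← mul_assoc, Real.mul_self_sqrt (by norm_num)]

lemma side_mul_side : side * side = 2 * π ^ 2 := by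
  unfold side
  linear_combination π ^ 2 * Real.mul_self_sqrt (show (0 : ℝ) ≤ 2 by norm_num)

lemma norm_chr (k : ℤ × ℤ) (p : ℝ × ℝ) : ‖chr k p‖ = 1 := Complex.norm_exp_ofReal_mul_I _

lemma chr_add (j k : ℤ × ℤ) (p : ℝ × ℝ) : chr (j + k) p = chr j p * chr k p := by
  unfold chr; rw [← Complex.exp_add]; congr 1; push_cast [Prod.fst_add, Prod.snd_add]; ring

@[simp] lemma chr_zero (p : ℝ × ℝ) : chr 0 p = 1 := by simp [chr]

lemma chr_neg (k : ℤ × ℤ) (p : ℝ × ℝ) : chr (-k) p = starRingEnd ℂ (chr k p) := by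
  unfold chr; rw [← Complex.exp_conj]; congr 1; simp; ring

lemma continuous_chr (k : ℤ × ℤ) : Continuous (chr k) := by
  unfold chr; fun_prop

lemma chr_periodic (k : ℤ × ℤ) : IsDoublyPeriodic (chr k) := by
  have h1 (m : ℤ) (a : ℂ) : Complex.exp (a + (m : ℂ) * (2 * π * Complex.I)) = Complex.exp a := by
    rw [Complex.exp_add, Complex.exp_int_mul_two_pi_mul_I, mul_one]
  have hs : (√2 : ℂ) * side = 2 * π := by exact_mod_cast sqrt_two_mul_side
  intro p
  constructor
  · refine (congrArg Complex.exp ?_).trans (h1 k.1 _); push_cast [Prod.fst_add, Prod.snd_add]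
    linear_combination (k.1 : ℂ) * Complex.I * hs
  · refine (congrArg Complex.exp ?_).trans (h1 k.2 _); push_cast [Prod.fst_add, Prod.snd_add]
    linear_combination (k.2 : ℂ) * Complex.I * hs

lemma integral_character_side (m : ℤ) :
    ∫ x in Set.Icc (0 : ℝ) side, Complex.exp (((√2 * (m * x) : ℝ) : ℂ) * Complex.I)
      = if m = 0 then (side : ℂ) else 0 := by
  rw [integral_Icc_eq_integral_Ioc, ← intervalIntegral.integral_of_le side_pos.le]
  split_ifs with h
  · simp [h]
  · have h2 : (√2 * m * Complex.I : ℂ) ≠ 0 := by simp [h]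
    have := integral_exp_mul_complex (a := 0) (b := side) h2
    have h3 : (√2 * m * Complex.I : ℂ) * side = (m : ℂ) * (2 * π * Complex.I) := by
      have hs : (√2 : ℂ) * side = 2 * π := by exact_mod_cast sqrt_two_mul_side
      linear_combination (m : ℂ) * Complex.I * hs
    rw [h3, Complex.exp_int_mul_two_pi_mul_I] at this
    simp only [Complex.ofReal_zero, mul_zero, Complex.exp_zero, sub_self, zero_div] at this
    rw [← this]
    congr 1; ext x; congr 1; push_cast; ring

lemma integral_chr (k : ℤ × ℤ) :
    ∫ p in cell, chr k p = if k = 0 then (2 * π ^ 2 : ℂ) else 0 := by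
  have h (p : ℝ × ℝ) : chr k p = Complex.exp (((√2 * (k.1 * p.1) : ℝ) : ℂ) * Complex.I)
      * Complex.exp (((√2 * (k.2 * p.2) : ℝ) : ℂ) * Complex.I) := by
    rw [chr, ← Complex.exp_add]; congr 1; push_cast; ring
  simp_rw [h]
  rw [cell, Measure.volume_eq_prod, setIntegral_prod_mul
    (fun x : ℝ => Complex.exp (((√2 * (k.1 * x) : ℝ) : ℂ) * Complex.I))
    (fun x : ℝ => Complex.exp (((√2 * (k.2 * x) : ℝ) : ℂ) * Complex.I)),
    integral_character_side, integral_character_side]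
  have hs : (side : ℂ) * side = 2 * π ^ 2 := by exact_mod_cast side_mul_side
  by_cases h1 : k.1 = 0 <;> by_cases h2 : k.2 = 0 <;> simp [h1, h2, Prod.ext_iff, hs]

lemma isCompact_cell : IsCompact cell := isCompact_Icc.prod isCompact_Icc

/-! ### The Wiener algebra -/

/-- The Wiener algebra of the torus: absolutely summable families of Fourier coefficients. -/
def Wiener : Type := lp (fun _ : ℤ × ℤ => ℂ) 1

namespace Wiener

instance : NormedAddCommGroup Wiener :=
  inferInstanceAs (NormedAddCommGroup (lp (fun _ : ℤ × ℤ => ℂ) 1))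

instance : NormedSpace ℂ Wiener :=
  inferInstanceAs (NormedSpace ℂ (lp (fun _ : ℤ × ℤ => ℂ) 1))

instance : CompleteSpace Wiener :=
  inferInstanceAs (CompleteSpace (lp (fun _ : ℤ × ℤ => ℂ) 1))

/-- The Fourier coefficient of index `k`. -/
def coeff (a : Wiener) (k : ℤ × ℤ) : ℂ := (show lp (fun _ : ℤ × ℤ => ℂ) 1 from a) k

@[ext] lemma ext {a b : Wiener} (h : ∀ k, a.coeff k = b.coeff k) : a = b :=
  lp.ext (funext h)

@[simp] lemma coeff_add (a b : Wiener) (k : ℤ × ℤ) : (a + b).coeff k = a.coeff k + b.coeff k := rfl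
@[simp] lemma coeff_sub (a b : Wiener) (k : ℤ × ℤ) : (a - b).coeff k = a.coeff k - b.coeff k := rfl
@[simp] lemma coeff_zero (k : ℤ × ℤ) : (0 : Wiener).coeff k = 0 := rfl
@[simp] lemma coeff_smul (c : ℂ) (a : Wiener) (k : ℤ × ℤ) : (c • a).coeff k = c * a.coeff k := rfl
@[simp] lemma coeff_real_smul (c : ℝ) (a : Wiener) (k : ℤ × ℤ) :
    (c • a).coeff k = c * a.coeff k := rfl

lemma summable_norm (a : Wiener) : Summable fun k => ‖a.coeff k‖ := by
  have h := (lp.memℓp (show lp (fun _ : ℤ × ℤ => ℂ) 1 from a)).summable (by simp)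
  simp only [ENNReal.toReal_one, Real.rpow_one] at h
  exact h

lemma norm_eq (a : Wiener) : ‖a‖ = ∑' k, ‖a.coeff k‖ := by
  have h := lp.norm_eq_tsum_rpow (p := 1) (by simp) (show lp (fun _ : ℤ × ℤ => ℂ) 1 from a)
  simp only [ENNReal.toReal_one, Real.rpow_one, div_one] at h
  exact h

lemma norm_coeff_le (a : Wiener) (k : ℤ × ℤ) : ‖a.coeff k‖ ≤ ‖a‖ := by
  rw [norm_eq]; exact a.summable_norm.le_tsum k fun _ _ => norm_nonneg _

/-- The element of the Wiener algebra with given absolutely summable coefficients. -/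
def ofCoeff (c : ℤ × ℤ → ℂ) (hc : Summable fun k => ‖c k‖) : Wiener :=
  (⟨c, memℓp_gen (by simpa using hc)⟩ : lp (fun _ : ℤ × ℤ => ℂ) 1)

@[simp] lemma coeff_ofCoeff (c : ℤ × ℤ → ℂ) (hc : Summable fun k => ‖c k‖) (k : ℤ × ℤ) :
    (ofCoeff c hc).coeff k = c k := rfl

/-- The Fourier coefficient as a continuous linear functional. -/
def coeffL (k : ℤ × ℤ) : Wiener →L[ℂ] ℂ :=
  LinearMap.mkContinuous ⟨⟨fun a => a.coeff k, fun _ _ => rfl⟩, fun _ _ => rfl⟩ 1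
    fun a => by rw [one_mul]; exact a.norm_coeff_le k

lemma norm_term (a : Wiener) (p : ℝ × ℝ) (k : ℤ × ℤ) : ‖a.coeff k * chr k p‖ = ‖a.coeff k‖ := by
  rw [norm_mul, norm_chr, mul_one]

lemma summable_term (a : Wiener) (p : ℝ × ℝ) : Summable fun k => a.coeff k * chr k p :=
  Summable.of_norm (by simpa only [norm_term] using a.summable_norm)

/-- The sum of the Fourier series at `p`, as a continuous linear functional. -/
def evL (p : ℝ × ℝ) : Wiener →L[ℂ] ℂ :=
  LinearMap.mkContinuous
    ⟨⟨fun a => ∑' k, a.coeff k * chr k p, fun a b => by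
      simp only [coeff_add, add_mul]
      exact (a.summable_term p).tsum_add (b.summable_term p)⟩, fun c a => by
      simp only [coeff_smul, mul_assoc, tsum_mul_left, RingHom.id_apply, smul_eq_mul]⟩ 1
    fun a => by
      rw [one_mul, norm_eq]
      refine (norm_tsum_le_tsum_norm ?_).trans_eq ?_
      · simpa only [norm_term] using a.summable_norm
      · simp only [norm_term]

/-- The function on the plane with the given Fourier coefficients. -/
def ev (a : Wiener) (p : ℝ × ℝ) : ℂ := evL p a

lemma ev_def (a : Wiener) (p : ℝ × ℝ) : a.ev p = ∑' k, a.coeff k * chr k p := rfl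

lemma norm_ev_le (a : Wiener) (p : ℝ × ℝ) : ‖a.ev p‖ ≤ ‖a‖ := by
  rw [ev_def, norm_eq]
  refine (norm_tsum_le_tsum_norm ?_).trans_eq ?_
  · simpa only [norm_term] using a.summable_norm
  · simp only [norm_term]

@[simp] lemma ev_add (a b : Wiener) (p : ℝ × ℝ) : (a + b).ev p = a.ev p + b.ev p := map_add (evL p) a b
@[simp] lemma ev_sub (a b : Wiener) (p : ℝ × ℝ) : (a - b).ev p = a.ev p - b.ev p := map_sub (evL p) a b
@[simp] lemma ev_neg (a : Wiener) (p : ℝ × ℝ) : (-a).ev p = -a.ev p := map_neg (evL p) a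
@[simp] lemma ev_zero (p : ℝ × ℝ) : (0 : Wiener).ev p = 0 := map_zero (evL p)
@[simp] lemma ev_smul (c : ℂ) (a : Wiener) (p : ℝ × ℝ) : (c • a).ev p = c * a.ev p :=
  map_smul (evL p) c a
@[simp] lemma ev_real_smul (c : ℝ) (a : Wiener) (p : ℝ × ℝ) : (c • a).ev p = c * a.ev p :=
  map_smul (evL p) (c : ℂ) a

lemma continuous_ev (a : Wiener) : Continuous a.ev := by
  refine continuous_tsum (fun k => continuous_const.mul (continuous_chr k)) a.summable_norm ?_
  intro k p; rw [norm_term]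

lemma ev_periodic (a : Wiener) : IsDoublyPeriodic a.ev := fun p => by
  simp only [ev_def, (chr_periodic _ p).1, (chr_periodic _ p).2, and_self]

lemma integrableOn_cell {g : ℝ × ℝ → ℂ} (hg : Continuous g) : IntegrableOn g cell :=
  hg.continuousOn.integrableOn_compact isCompact_cell

/-- The coefficients are the Fourier coefficients of the sum. -/
lemma integral_ev_mul_chr (a : Wiener) (k : ℤ × ℤ) :
    ∫ p in cell, a.ev p * chr (-k) p = 2 * π ^ 2 * a.coeff k := by
  have h1 (p : ℝ × ℝ) : a.ev p * chr (-k) p = ∑' j, a.coeff j * chr (j - k) p := by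
    rw [ev_def, ← tsum_mul_right]
    refine tsum_congr fun j => ?_
    rw [sub_eq_add_neg, chr_add, mul_assoc]
  simp_rw [h1]
  have h2 : HasSum (fun j => ∫ p in cell, a.coeff j * chr (j - k) p)
      (∫ p in cell, ∑' j, a.coeff j * chr (j - k) p) := by
    refine hasSum_integral_of_summable_integral_norm
      (fun j => integrableOn_cell (continuous_const.mul (continuous_chr _))) ?_
    simp only [norm_mul, norm_chr, mul_one, integral_const, smul_eq_mul]
    exact a.summable_norm.mul_left _
  rw [← h2.tsum_eq, tsum_eq_single k]
  · rw [integral_const_mul, integral_chr]; simp [mul_comm]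
  · intro j hj
    rw [integral_const_mul, integral_chr, if_neg (sub_ne_zero.mpr hj), mul_zero]

lemma integral_ev (a : Wiener) : ∫ p in cell, a.ev p = 2 * π ^ 2 * a.coeff 0 := by
  simpa using a.integral_ev_mul_chr 0

lemma two_pi_sq_ne_zero : (2 * π ^ 2 : ℂ) ≠ 0 := by
  have := Real.pi_ne_zero
  simp [this]

lemma ev_injective : Function.Injective ev := by
  intro a b h
  ext k
  have := a.integral_ev_mul_chr k
  rw [h, integral_ev_mul_chr] at this
  exact (mul_left_cancel₀ two_pi_sq_ne_zero this).symm

lemma eq_of_ev_eq {a b : Wiener} (h : ∀ p, a.ev p = b.ev p) : a = b := ev_injective (funext h)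

/-- The bijection `(n, k) ↦ (k, n - k)` behind the Cauchy product. -/
def cauchyEquiv : (ℤ × ℤ) × (ℤ × ℤ) ≃ (ℤ × ℤ) × (ℤ × ℤ) where
  toFun x := (x.2, x.1 - x.2)
  invFun x := (x.1 + x.2, x.1)
  left_inv x := by simp
  right_inv x := by simp

lemma summable_norm_cauchy (a b : Wiener) :
    Summable fun x : (ℤ × ℤ) × (ℤ × ℤ) => ‖a.coeff x.2‖ * ‖b.coeff (x.1 - x.2)‖ := by
  have h : Summable fun x : (ℤ × ℤ) × (ℤ × ℤ) => ‖a.coeff x.1‖ * ‖b.coeff x.2‖ :=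
    a.summable_norm.mul_of_nonneg b.summable_norm (fun _ => norm_nonneg _) fun _ => norm_nonneg _
  exact (cauchyEquiv.summable_iff).mpr h

lemma tsum_norm_cauchy (a b : Wiener) :
    ∑' n, ∑' k, ‖a.coeff k‖ * ‖b.coeff (n - k)‖ = ‖a‖ * ‖b‖ := by
  have h1 := (summable_norm_cauchy a b).tsum_prod
  rw [← h1, norm_eq, norm_eq, tsum_mul_tsum_of_summable_norm a.summable_norm.norm
    b.summable_norm.norm]
  exact cauchyEquiv.tsum_eq (fun x : (ℤ × ℤ) × (ℤ × ℤ) => ‖a.coeff x.1‖ * ‖b.coeff x.2‖)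

lemma summable_cauchy_fiber (a b : Wiener) (n : ℤ × ℤ) :
    Summable fun k => ‖a.coeff k * b.coeff (n - k)‖ := by
  simpa only [norm_mul] using (summable_norm_cauchy a b).prod_factor n

lemma norm_cauchy_le (a b : Wiener) (n : ℤ × ℤ) :
    ‖∑' k, a.coeff k * b.coeff (n - k)‖ ≤ ∑' k, ‖a.coeff k‖ * ‖b.coeff (n - k)‖ := by
  simpa only [norm_mul] using norm_tsum_le_tsum_norm (summable_cauchy_fiber a b n)

lemma summable_norm_cauchy_outer (a b : Wiener) :
    Summable fun n => ∑' k, ‖a.coeff k‖ * ‖b.coeff (n - k)‖ :=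
  (summable_norm_cauchy a b).prod

instance : Mul Wiener where
  mul a b := ofCoeff (fun n => ∑' k, a.coeff k * b.coeff (n - k))
    (Summable.of_nonneg_of_le (fun _ => norm_nonneg _) (norm_cauchy_le a b)
      (summable_norm_cauchy_outer a b))

lemma coeff_mul (a b : Wiener) (n : ℤ × ℤ) :
    (a * b).coeff n = ∑' k, a.coeff k * b.coeff (n - k) := rfl

lemma norm_mul_le' (a b : Wiener) : ‖a * b‖ ≤ ‖a‖ * ‖b‖ := by
  rw [norm_eq (a * b), ← tsum_norm_cauchy]
  exact (a * b).summable_norm.tsum_le_tsum (norm_cauchy_le a b) (summable_norm_cauchy_outer a b)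

@[simp] lemma ev_mul (a b : Wiener) (p : ℝ × ℝ) : (a * b).ev p = a.ev p * b.ev p := by
  have hs : Summable fun x : (ℤ × ℤ) × (ℤ × ℤ) =>
      (a.coeff x.2 * chr x.2 p) * (b.coeff (x.1 - x.2) * chr (x.1 - x.2) p) := by
    refine Summable.of_norm ?_
    simpa only [norm_mul, norm_chr, mul_one] using summable_norm_cauchy a b
  rw [ev_def a, ev_def b, tsum_mul_tsum_of_summable_norm
    (by simpa only [norm_term] using a.summable_norm)
    (by simpa only [norm_term] using b.summable_norm), ev_def,
    ← cauchyEquiv.tsum_eq (fun x : (ℤ × ℤ) × (ℤ × ℤ) =>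
      (a.coeff x.1 * chr x.1 p) * (b.coeff x.2 * chr x.2 p))]
  refine Eq.trans ?_ hs.tsum_prod.symm
  refine tsum_congr fun n => ?_
  rw [coeff_mul, ← tsum_mul_right]
  refine tsum_congr fun k => ?_
  have : chr n p = chr k p * chr (n - k) p := by rw [← chr_add]; simp
  rw [this]; ring

/-- The element of the Wiener algebra with a single nonzero coefficient. -/
def single (k : ℤ × ℤ) (c : ℂ) : Wiener :=
  ofCoeff (Pi.single k c) (by
    refine summable_of_ne_finset_zero (s := {k}) fun j hj => ?_
    simp only [Finset.mem_singleton] at hj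
    simp [Pi.single_eq_of_ne hj])

lemma coeff_single (k j : ℤ × ℤ) (c : ℂ) : (single k c).coeff j = if j = k then c else 0 := by
  rw [single, coeff_ofCoeff, Pi.single_apply]

@[simp] lemma ev_single (k : ℤ × ℤ) (c : ℂ) (p : ℝ × ℝ) : (single k c).ev p = c * chr k p := by
  rw [ev_def, tsum_eq_single k]
  · simp [coeff_single]
  · intro j hj; simp [coeff_single, hj]

instance : One Wiener := ⟨single 0 1⟩

@[simp] lemma ev_one (p : ℝ × ℝ) : (1 : Wiener).ev p = 1 := by
  change (single 0 1).ev p = 1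
  simp

lemma coeff_one (k : ℤ × ℤ) : (1 : Wiener).coeff k = if k = 0 then 1 else 0 :=
  coeff_single 0 k 1

instance : NormedCommRing Wiener where
  mul_assoc a b c := eq_of_ev_eq fun p => by simp [mul_assoc]
  mul_comm a b := eq_of_ev_eq fun p => by simp [mul_comm]
  one_mul a := eq_of_ev_eq fun p => by simp
  mul_one a := eq_of_ev_eq fun p => by simp
  zero_mul a := eq_of_ev_eq fun p => by simp
  mul_zero a := eq_of_ev_eq fun p => by simp
  left_distrib a b c := eq_of_ev_eq fun p => by simp [mul_add]
  right_distrib a b c := eq_of_ev_eq fun p => by simp [add_mul]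
  norm_mul_le := norm_mul_le'
  dist_eq := dist_eq_norm_neg_add

instance : NormedAlgebra ℂ Wiener where
  toAlgebra := Algebra.ofModule
    (fun c a b => eq_of_ev_eq fun p => by simp [mul_assoc])
    (fun c a b => eq_of_ev_eq fun p => by simp [mul_left_comm])
  norm_smul_le c a := (norm_smul c a).le

end Wiener
end


noncomputable section

/-! ### Fourier series of smooth functions on the torus -/

/-- The character `x ↦ exp (i √2 m x)` of the circle of length `√2 π`. -/
def chrOne (m : ℤ) (x : ℝ) : ℂ := Complex.exp (((√2 * (m * x) : ℝ) : ℂ) * Complex.I)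

lemma continuous_chrOne (m : ℤ) : Continuous (chrOne m) := by unfold chrOne; fun_prop

lemma chr_eq_mul (k : ℤ × ℤ) (p : ℝ × ℝ) : chr k p = chrOne k.1 p.1 * chrOne k.2 p.2 := by
  rw [chr, chrOne, chrOne, ← Complex.exp_add]; congr 1; push_cast; ring

/-- A continuous function on the circle whose Fourier coefficients vanish is zero. -/
lemma eq_zero_of_integral_chrOne_eq_zero {g : ℝ → ℂ} (hg : Continuous g)
    (hp : ∀ x, g (x + side) = g x)
    (h : ∀ m : ℤ, ∫ x in Set.Icc (0 : ℝ) side, g x * chrOne (-m) x = 0) : g = 0 := by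
  have : Fact (0 < side) := ⟨side_pos⟩
  have hper : Function.Periodic g side := hp
  let f : C(AddCircle side, ℂ) := ⟨hper.lift, continuous_coinduced_dom.mpr hg⟩
  have hf (x : ℝ) : f (x : AddCircle side) = g x := rfl
  have hc (n : ℤ) : fourierCoeff f n = 0 := by
    rw [fourierCoeff_eq_intervalIntegral f n 0, zero_add,
      intervalIntegral.integral_of_le side_pos.le, ← integral_Icc_eq_integral_Ioc]
    have : (∫ x in Set.Icc (0 : ℝ) side, fourier (-n) (x : AddCircle side) • f x)
        = ∫ x in Set.Icc (0 : ℝ) side, g x * chrOne (-n) x := by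
      congr 1; ext x
      rw [hf, smul_eq_mul, mul_comm, fourier_coe_apply, chrOne]
      congr 2
      have hs : (√2 : ℂ) * side = 2 * π := by exact_mod_cast sqrt_two_mul_side
      have hs0 : (side : ℂ) ≠ 0 := by exact_mod_cast side_pos.ne'
      rw [← hs]; push_cast; field_simp
    rw [this, h, smul_zero]
  ext x
  have h0 : fourierCoeff f = 0 := funext hc
  have hsum := has_pointwise_sum_fourier_series_of_summable (f := f)
    (by rw [h0]; exact summable_zero) (x : AddCircle side)
  simp only [hc, zero_smul] at hsum
  exact (hsum.unique hasSum_zero)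

/-- A continuous function on the torus whose Fourier coefficients vanish is zero. -/
lemma eq_zero_of_integral_chr_eq_zero {g : ℝ × ℝ → ℂ} (hg : Continuous g)
    (hp : IsDoublyPeriodic g)
    (h : ∀ k : ℤ × ℤ, ∫ p in cell, g p * chr (-k) p = 0) : g = 0 := by
  have h1 (n : ℤ) : (fun x : ℝ => ∫ y in Set.Icc (0 : ℝ) side, g (x, y) * chrOne (-n) y) = 0 := by
    refine eq_zero_of_integral_chrOne_eq_zero ?_ ?_ ?_
    · refine continuous_parametric_integral_of_continuous ?_ isCompact_Icc
      exact (hg.mul ((continuous_chrOne _).comp continuous_snd))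
    · intro x
      have (y : ℝ) : g (x + side, y) = g (x, y) := by simpa using (hp (x, y)).1
      simp only [this]
    · intro m
      rw [← h (m, n), cell, Measure.volume_eq_prod, setIntegral_prod]
      · congr 1; ext x
        rw [← integral_mul_const]
        congr 1; ext y
        rw [chr_eq_mul]; simp only [Prod.fst_neg, Prod.snd_neg]; ring
      · rw [← Measure.volume_eq_prod]
        exact Wiener.integrableOn_cell (hg.mul (continuous_chr _))
  ext ⟨x, y⟩
  have h2 := eq_zero_of_integral_chrOne_eq_zero (g := fun y => g (x, y)) (by fun_prop)
    (fun y => by simpa using (hp (x, y)).2) (fun n => congrFun (h1 n) x)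
  exact congrFun h2 y

/-- The partial derivative `∂ₓ` of a real function. -/
def pdx (Φ : ℝ × ℝ → ℝ) (p : ℝ × ℝ) : ℝ := fderiv ℝ Φ p (1, 0)

/-- The partial derivative `∂_y` of a real function. -/
def pdy (Φ : ℝ × ℝ → ℝ) (p : ℝ × ℝ) : ℝ := fderiv ℝ Φ p (0, 1)

lemma IsDoublyPeriodic.fderiv {X : Type*} [NormedAddCommGroup X] [NormedSpace ℝ X]
    {Φ : ℝ × ℝ → X} (h : IsDoublyPeriodic Φ) : IsDoublyPeriodic (fderiv ℝ Φ) := by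
  intro p
  constructor
  · rw [← fderiv_comp_add_right]; congr 1; ext q; exact (h q).1
  · rw [← fderiv_comp_add_right]; congr 1; ext q; exact (h q).2

namespace IsTorusFunction

variable {Φ Ψ : ℝ × ℝ → ℝ}

lemma differentiable (h : IsTorusFunction Φ) : Differentiable ℝ Φ :=
  h.1.differentiable (by simp)

lemma pdx (h : IsTorusFunction Φ) : IsTorusFunction (pdx Φ) :=
  ⟨(h.1.fderiv_right (by simp)).clm_apply contDiff_const, fun p => by
    simp only [_root_.pdx, (h.2.fderiv p).1, (h.2.fderiv p).2, and_self]⟩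

lemma pdy (h : IsTorusFunction Φ) : IsTorusFunction (pdy Φ) :=
  ⟨(h.1.fderiv_right (by simp)).clm_apply contDiff_const, fun p => by
    simp only [_root_.pdy, (h.2.fderiv p).1, (h.2.fderiv p).2, and_self]⟩

lemma add (h : IsTorusFunction Φ) (h' : IsTorusFunction Ψ) : IsTorusFunction (Φ + Ψ) :=
  ⟨h.1.add h'.1, fun p => by simp [(h.2 p).1, (h.2 p).2, (h'.2 p).1, (h'.2 p).2]⟩

lemma smul (h : IsTorusFunction Φ) (c : ℝ) : IsTorusFunction (c • Φ) :=
  ⟨h.1.const_smul c, fun p => by simp [(h.2 p).1, (h.2 p).2]⟩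

end IsTorusFunction

/-- The Fourier coefficients of a real function on the torus. -/
def torusCoeff (Φ : ℝ × ℝ → ℝ) (k : ℤ × ℤ) : ℂ :=
  (2 * π ^ 2 : ℂ)⁻¹ * ∫ p in cell, (Φ p : ℂ) * chr (-k) p

/-- The integral over a fundamental square of a partial derivative of a periodic function is
zero. -/
lemma integral_fderiv_eq_zero {g : ℝ × ℝ → ℂ} (hg : ContDiff ℝ 1 g) (hp : IsDoublyPeriodic g) :
    ∫ p in cell, fderiv ℝ g p (1, 0) = 0 ∧ ∫ p in cell, fderiv ℝ g p (0, 1) = 0 := by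
  have hcell : cell = Set.Icc ((0 : ℝ), (0 : ℝ)) (side, side) := by
    rw [cell, Set.Icc_prod_eq]
  have hd := hg.differentiable one_ne_zero
  have hcx : Continuous fun p => fderiv ℝ g p (1, 0) :=
    (hg.continuous_fderiv one_ne_zero).clm_apply continuous_const
  have hcy : Continuous fun p => fderiv ℝ g p (0, 1) :=
    (hg.continuous_fderiv one_ne_zero).clm_apply continuous_const
  have hx (y : ℝ) : g (side, y) = g (0, y) := by simpa using (hp (0, y)).1
  have hy (x : ℝ) : g (x, side) = g (x, 0) := by simpa using (hp (x, 0)).2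
  have key := integral_divergence_prod_Icc_of_hasFDerivAt_of_le (E := ℂ)
  constructor
  · have := key g 0 (fderiv ℝ g) 0 (0, 0) (side, side) ⟨side_pos.le, side_pos.le⟩
      hg.continuous.continuousOn continuousOn_const (fun p _ => (hd p).hasFDerivAt)
      (fun p _ => hasFDerivAt_const _ _)
      (by rw [← hcell]; simpa using Wiener.integrableOn_cell hcx)
    simpa [hcell, hx] using this
  · have := key 0 g 0 (fderiv ℝ g) (0, 0) (side, side) ⟨side_pos.le, side_pos.le⟩
      continuousOn_const hg.continuous.continuousOn
      (fun p _ => hasFDerivAt_const _ _) (fun p _ => (hd p).hasFDerivAt)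
      (by rw [← hcell]; simpa using Wiener.integrableOn_cell hcy)
    simpa [hcell, hy] using this

/-- The linear form `i √2 (k₁ dx + k₂ dy)`, the logarithmic derivative of the character `e_k`. -/
def chrForm (k : ℤ × ℤ) : ℝ × ℝ →L[ℝ] ℂ :=
  (Complex.I * √2) • ((k.1 : ℂ) • (Complex.ofRealCLM.comp (ContinuousLinearMap.fst ℝ ℝ ℝ))
    + (k.2 : ℂ) • (Complex.ofRealCLM.comp (ContinuousLinearMap.snd ℝ ℝ ℝ)))

lemma chrForm_apply (k : ℤ × ℤ) (v : ℝ × ℝ) :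
    chrForm k v = Complex.I * √2 * (k.1 * v.1 + k.2 * v.2) := by
  simp [chrForm]; ring

lemma hasFDerivAt_chr (k : ℤ × ℤ) (p : ℝ × ℝ) :
    HasFDerivAt (chr k) (chr k p • chrForm k) p := by
  have h : chr k = fun q => Complex.exp (chrForm k q) := by
    ext q; rw [chr, chrForm_apply]; congr 1; push_cast; ring
  rw [h]
  exact (chrForm k).hasFDerivAt.cexp

lemma contDiff_chr (k : ℤ × ℤ) : ContDiff ℝ ∞ (chr k) := by
  have h : chr k = fun q => Complex.exp (chrForm k q) := by
    ext q; rw [chr, chrForm_apply]; congr 1; push_cast; ring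
  rw [h]
  exact (chrForm k).contDiff.cexp

namespace IsTorusFunction

variable {Φ Ψ : ℝ × ℝ → ℝ}

lemma continuous (h : IsTorusFunction Φ) : Continuous Φ := h.1.continuous

lemma integral_fderiv_mul_chr (h : IsTorusFunction Φ) (k : ℤ × ℤ) (v : ℝ × ℝ)
    (hv : v = (1, 0) ∨ v = (0, 1)) :
    ∫ p in cell, (fderiv ℝ Φ p v : ℂ) * chr (-k) p
      = Complex.I * √2 * (k.1 * v.1 + k.2 * v.2) * ∫ p in cell, (Φ p : ℂ) * chr (-k) p := by
  have hd (p : ℝ × ℝ) : HasFDerivAt (fun q => (Φ q : ℂ) * chr (-k) q)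
      ((Φ p : ℂ) • (chr (-k) p • chrForm (-k))
        + chr (-k) p • (Complex.ofRealCLM.comp (fderiv ℝ Φ p))) p :=
    (Complex.ofRealCLM.hasFDerivAt.comp p (h.differentiable p).hasFDerivAt).mul
      (hasFDerivAt_chr (-k) p)
  have hsm : ContDiff ℝ 1 (fun q => (Φ q : ℂ) * chr (-k) q) :=
    ((Complex.ofRealCLM.contDiff.comp h.1).mul (contDiff_chr _)).of_le (by simp)
  have hper : IsDoublyPeriodic (fun q => (Φ q : ℂ) * chr (-k) q) := fun p => by
    simp only [(h.2 p).1, (h.2 p).2, (chr_periodic (-k) p).1, (chr_periodic (-k) p).2, and_self]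
  have h0 : ∫ p in cell, fderiv ℝ (fun q => (Φ q : ℂ) * chr (-k) q) p v = 0 := by
    rcases hv with rfl | rfl
    exacts [(integral_fderiv_eq_zero hsm hper).1, (integral_fderiv_eq_zero hsm hper).2]
  have h1 (p : ℝ × ℝ) : fderiv ℝ (fun q => (Φ q : ℂ) * chr (-k) q) p v
      = (fderiv ℝ Φ p v : ℂ) * chr (-k) p
        - Complex.I * √2 * (k.1 * v.1 + k.2 * v.2) * ((Φ p : ℂ) * chr (-k) p) := by
    rw [(hd p).fderiv]
    simp [chrForm_apply]
    ring
  have hc0 : Continuous fun p => Complex.I * √2 * (k.1 * v.1 + k.2 * v.2)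
      * ((Φ p : ℂ) * chr (-k) p) :=
    continuous_const.mul ((Complex.continuous_ofReal.comp h.continuous).mul (continuous_chr _))
  have hc1 : Continuous fun p => (fderiv ℝ Φ p v : ℂ) * chr (-k) p :=
    (Complex.continuous_ofReal.comp (((h.1.of_le (by simp : (1 : WithTop ℕ∞) ≤ ∞)).continuous_fderiv
      one_ne_zero).clm_apply continuous_const)).mul (continuous_chr _)
  simp_rw [h1] at h0
  rw [integral_sub (Wiener.integrableOn_cell hc1) (Wiener.integrableOn_cell hc0),
    integral_const_mul, sub_eq_zero] at h0
  exact h0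

lemma torusCoeff_pdx (h : IsTorusFunction Φ) (k : ℤ × ℤ) :
    torusCoeff (_root_.pdx Φ) k = Complex.I * √2 * k.1 * torusCoeff Φ k := by
  have := h.integral_fderiv_mul_chr k (1, 0) (Or.inl rfl)
  simp only [Complex.ofReal_one, Complex.ofReal_zero, mul_one, mul_zero, add_zero] at this
  simp only [torusCoeff, _root_.pdx, this]; ring

lemma torusCoeff_pdy (h : IsTorusFunction Φ) (k : ℤ × ℤ) :
    torusCoeff (_root_.pdy Φ) k = Complex.I * √2 * k.2 * torusCoeff Φ k := by
  have := h.integral_fderiv_mul_chr k (0, 1) (Or.inr rfl)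
  simp only [Complex.ofReal_one, Complex.ofReal_zero, mul_one, mul_zero, zero_add] at this
  simp only [torusCoeff, _root_.pdy, this]; ring

lemma norm_torusCoeff_le (k : ℤ × ℤ) :
    ‖torusCoeff Φ k‖ ≤ ‖(2 * π ^ 2 : ℂ)⁻¹‖ * ∫ p in cell, ‖Φ p‖ := by
  rw [torusCoeff, norm_mul]
  gcongr
  refine (norm_integral_le_integral_norm _).trans_eq ?_
  simp [norm_chr]

/-- Fourier coefficients of smooth functions decay faster than `(k₁ k₂)⁻²`. -/
lemma summable_norm_torusCoeff (h : IsTorusFunction Φ) :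
    Summable fun k => ‖torusCoeff Φ k‖ := by
  have s1 : Summable fun m : ℤ => (1 : ℝ) / (m : ℝ) ^ 2 :=
    Real.summable_one_div_int_pow.mpr (by norm_num)
  have s2 : Summable fun m : ℤ => (if m = 0 then 1 else (1 : ℝ) / (m : ℝ) ^ 2) := by
    refine s1.congr_cofinite ?_
    filter_upwards [(Set.finite_singleton (0 : ℤ)).compl_mem_cofinite] with m hm
    simp only [Set.mem_compl_iff, Set.mem_singleton_iff] at hm
    simp [hm]
  have s3 := s2.mul_of_nonneg s2 (fun m => by positivity) (fun m => by positivity)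
  have hs : (Complex.I * (√2 : ℂ)) ^ 2 = -2 := by
    rw [mul_pow, Complex.I_sq, ← Complex.ofReal_pow, Real.sq_sqrt (by norm_num)]; norm_num
  let M (Ψ : ℝ × ℝ → ℝ) : ℝ := ‖(2 * π ^ 2 : ℂ)⁻¹‖ * ∫ p in cell, ‖Ψ p‖
  have hM (Ψ : ℝ × ℝ → ℝ) : 0 ≤ M Ψ :=
    mul_nonneg (norm_nonneg _) (integral_nonneg fun _ => norm_nonneg _)
  have hx (Ψ : ℝ × ℝ → ℝ) (hΨ : IsTorusFunction Ψ) (k : ℤ × ℤ) :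
      ‖torusCoeff (_root_.pdx (_root_.pdx Ψ)) k‖ = 2 * (k.1 : ℝ) ^ 2 * ‖torusCoeff Ψ k‖ := by
    rw [hΨ.pdx.torusCoeff_pdx, hΨ.torusCoeff_pdx,
      show ∀ a : ℂ, Complex.I * √2 * k.1 * (Complex.I * √2 * k.1 * a)
        = (Complex.I * (√2 : ℂ)) ^ 2 * (k.1 : ℂ) ^ 2 * a by intro a; ring, hs]
    simp
  have hy (Ψ : ℝ × ℝ → ℝ) (hΨ : IsTorusFunction Ψ) (k : ℤ × ℤ) :
      ‖torusCoeff (_root_.pdy (_root_.pdy Ψ)) k‖ = 2 * (k.2 : ℝ) ^ 2 * ‖torusCoeff Ψ k‖ := by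
    rw [hΨ.pdy.torusCoeff_pdy, hΨ.torusCoeff_pdy,
      show ∀ a : ℂ, Complex.I * √2 * k.2 * (Complex.I * √2 * k.2 * a)
        = (Complex.I * (√2 : ℂ)) ^ 2 * (k.2 : ℂ) ^ 2 * a by intro a; ring, hs]
    simp
  let C : ℝ := M Φ + M (_root_.pdx (_root_.pdx Φ)) + M (_root_.pdy (_root_.pdy Φ))
    + M (_root_.pdy (_root_.pdy (_root_.pdx (_root_.pdx Φ))))
  refine Summable.of_nonneg_of_le (fun _ => norm_nonneg _) (fun k => ?_) (s3.mul_left C)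
  have b0 := norm_torusCoeff_le (Φ := Φ) k
  have b1 := norm_torusCoeff_le (Φ := _root_.pdx (_root_.pdx Φ)) k
  have b2 := norm_torusCoeff_le (Φ := _root_.pdy (_root_.pdy Φ)) k
  have b3 := norm_torusCoeff_le (Φ := _root_.pdy (_root_.pdy (_root_.pdx (_root_.pdx Φ)))) k
  rw [hy _ h.pdx.pdx, hx _ h] at b3
  rw [hx _ h] at b1
  rw [hy _ h] at b2
  change _ ≤ M _ at b0 b1 b2 b3
  have c0 := hM Φ
  have c1 := hM (_root_.pdx (_root_.pdx Φ))
  have c2 := hM (_root_.pdy (_root_.pdy Φ))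
  have c3 := hM (_root_.pdy (_root_.pdy (_root_.pdx (_root_.pdx Φ))))
  have n0 := norm_nonneg (torusCoeff Φ k)
  by_cases h1 : k.1 = 0 <;> by_cases h2 : k.2 = 0
  · simp only [h1, h2, if_true, mul_one]; simp only [C]; linarith
  · have p2 : (0 : ℝ) < (k.2 : ℝ) ^ 2 := by positivity
    simp only [h1, h2, if_true, if_false, mul_one_div]
    rw [le_div_iff₀ p2]; simp only [C]; nlinarith
  · have p1 : (0 : ℝ) < (k.1 : ℝ) ^ 2 := by positivity
    simp only [h1, h2, if_true, if_false, mul_one, mul_one_div]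
    rw [le_div_iff₀ p1]; simp only [C]; nlinarith
  · have p1 : (0 : ℝ) < (k.1 : ℝ) ^ 2 := by positivity
    have p2 : (0 : ℝ) < (k.2 : ℝ) ^ 2 := by positivity
    simp only [h1, h2, if_false]
    rw [one_div_mul_one_div, mul_one_div]
    rw [le_div_iff₀ (mul_pos p1 p2)]; simp only [C]
    have : 0 ≤ (k.1 : ℝ) ^ 2 * (k.2 : ℝ) ^ 2 * ‖torusCoeff Φ k‖ := by positivity
    nlinarith

/-- The element of the Wiener algebra defined by a smooth function on the torus. -/
def toWiener (h : IsTorusFunction Φ) : Wiener :=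
  Wiener.ofCoeff (torusCoeff Φ) h.summable_norm_torusCoeff

lemma coeff_toWiener (h : IsTorusFunction Φ) (k : ℤ × ℤ) :
    h.toWiener.coeff k = torusCoeff Φ k := rfl

/-- Fourier inversion. -/
@[simp] lemma ev_toWiener (h : IsTorusFunction Φ) (p : ℝ × ℝ) : h.toWiener.ev p = Φ p := by
  have hc : Continuous fun p => (Φ p : ℂ) := Complex.continuous_ofReal.comp h.continuous
  have h0 := eq_zero_of_integral_chr_eq_zero (g := fun p => h.toWiener.ev p - Φ p)
    (h.toWiener.continuous_ev.sub hc)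
    (fun p => by
      simp only [(h.toWiener.ev_periodic p).1, (h.toWiener.ev_periodic p).2, (h.2 p).1, (h.2 p).2,
        and_self])
    (fun k => by
      have c1 : Continuous fun p => h.toWiener.ev p * chr (-k) p :=
        h.toWiener.continuous_ev.mul (continuous_chr _)
      have c2 : Continuous fun p => (Φ p : ℂ) * chr (-k) p := hc.mul (continuous_chr _)
      simp only [sub_mul]
      rw [integral_sub (Wiener.integrableOn_cell c1) (Wiener.integrableOn_cell c2),
        Wiener.integral_ev_mul_chr,
        coeff_toWiener, torusCoeff, mul_inv_cancel_left₀ Wiener.two_pi_sq_ne_zero, sub_self])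
  exact sub_eq_zero.mp (congrFun h0 p)

lemma toWiener_add (h : IsTorusFunction Φ) (h' : IsTorusFunction Ψ) :
    (h.add h').toWiener = h.toWiener + h'.toWiener :=
  Wiener.eq_of_ev_eq fun p => by simp

lemma toWiener_smul (h : IsTorusFunction Φ) (c : ℝ) :
    (h.smul c).toWiener = c • h.toWiener :=
  Wiener.eq_of_ev_eq fun p => by simp

lemma coeff_neg_toWiener (h : IsTorusFunction Φ) (k : ℤ × ℤ) :
    h.toWiener.coeff (-k) = starRingEnd ℂ (h.toWiener.coeff k) := by
  simp only [coeff_toWiener, torusCoeff, map_mul, map_inv₀, map_pow, Complex.conj_ofReal,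
    ← integral_conj, ← chr_neg, neg_neg, map_ofNat]

end IsTorusFunction
end


noncomputable section

/-! ### Fourier multipliers and the Beltrami equation -/

namespace Wiener

/-- The Fourier multiplier with a bounded symbol. -/
def multiplier (m : ℤ × ℤ → ℂ) (C : ℝ) (hm : ∀ k, ‖m k‖ ≤ C) : Wiener →L[ℂ] Wiener :=
  have hs (a : Wiener) : Summable fun k => ‖m k * a.coeff k‖ :=
    Summable.of_nonneg_of_le (fun _ => norm_nonneg _)
      (fun k => by rw [norm_mul]; exact mul_le_mul_of_nonneg_right (hm k) (norm_nonneg _))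
      (a.summable_norm.mul_left C)
  LinearMap.mkContinuous
    ⟨⟨fun a => ofCoeff (fun k => m k * a.coeff k) (hs a),
      fun a b => by ext k; simp [mul_add]⟩, fun c a => by ext k; simp [mul_left_comm]⟩ C
    fun a => by
      rw [norm_eq, norm_eq, ← tsum_mul_left]
      refine (hs a).tsum_le_tsum (fun k => ?_) (a.summable_norm.mul_left C)
      change ‖m k * a.coeff k‖ ≤ _
      rw [norm_mul]; exact mul_le_mul_of_nonneg_right (hm k) (norm_nonneg _)

@[simp] lemma coeff_multiplier (m : ℤ × ℤ → ℂ) (C : ℝ) (hm : ∀ k, ‖m k‖ ≤ C) (a : Wiener)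
    (k : ℤ × ℤ) : (multiplier m C hm a).coeff k = m k * a.coeff k := rfl

lemma norm_multiplier_le (m : ℤ × ℤ → ℂ) (C : ℝ) (hm : ∀ k, ‖m k‖ ≤ C) (a : Wiener) :
    ‖multiplier m C hm a‖ ≤ C * ‖a‖ := by
  rw [norm_eq, norm_eq, ← tsum_mul_left]
  refine (multiplier m C hm a).summable_norm.tsum_le_tsum (fun k => ?_)
    (a.summable_norm.mul_left C)
  rw [coeff_multiplier, norm_mul]; exact mul_le_mul_of_nonneg_right (hm k) (norm_nonneg _)

/-- The Gaussian integer `κ = k₁ + i k₂`; up to a constant, the symbol of `∂/∂z̄`. -/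
def kappa (k : ℤ × ℤ) : ℂ := k.1 + k.2 * Complex.I

lemma kappa_ne_zero {k : ℤ × ℤ} (hk : k ≠ 0) : kappa k ≠ 0 := by
  intro h
  apply hk
  have h1 := congrArg Complex.re h
  have h2 := congrArg Complex.im h
  simp [kappa] at h1 h2
  exact Prod.ext h1 h2

lemma kappa_zero : kappa 0 = 0 := by simp [kappa]

lemma conj_kappa (k : ℤ × ℤ) : starRingEnd ℂ (kappa k) = k.1 - k.2 * Complex.I := by
  simp [kappa, sub_eq_add_neg]

lemma normSq_kappa (k : ℤ × ℤ) : Complex.normSq (kappa k) = (k.1 : ℝ) ^ 2 + (k.2 : ℝ) ^ 2 := by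
  simp [kappa, Complex.normSq_apply, sq]

lemma one_le_norm_kappa {k : ℤ × ℤ} (hk : k ≠ 0) : 1 ≤ ‖kappa k‖ := by
  have h : 0 < k.1 ^ 2 + k.2 ^ 2 := by
    rcases Classical.em (k.1 = 0) with h1 | h1
    · have : k.2 ≠ 0 := fun h2 => hk (Prod.ext h1 h2)
      positivity
    · positivity
  have h2 : (1 : ℝ) ≤ (k.1 : ℝ) ^ 2 + (k.2 : ℝ) ^ 2 := by exact_mod_cast h
  rw [← normSq_kappa, Complex.normSq_eq_norm_sq] at h2
  nlinarith [norm_nonneg (kappa k)]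

/-- The symbol `κ̄ / κ` of the Beurling transform, which is `0` at `k = 0`. -/
def beurlingSymbol (k : ℤ × ℤ) : ℂ := starRingEnd ℂ (kappa k) / kappa k

/-- The Beurling transform of the torus, the operator `∂/∂z ∘ (∂/∂z̄)⁻¹`. -/
def beurling : Wiener →L[ℂ] Wiener :=
  multiplier beurlingSymbol 1 fun k => by
    rw [beurlingSymbol, norm_div, Complex.norm_conj]; exact div_self_le_one _

lemma norm_beurling_le (a : Wiener) : ‖beurling a‖ ≤ ‖a‖ := by
  exact (norm_multiplier_le _ _ _ a).trans_eq (one_mul _)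

lemma coeff_beurling (a : Wiener) (k : ℤ × ℤ) :
    (beurling a).coeff k = beurlingSymbol k * a.coeff k := rfl

/-- The inverse of `∂/∂z̄` on functions of mean zero; it annihilates constants. -/
def primitive : Wiener →L[ℂ] Wiener :=
  multiplier (fun k => 2 / (Complex.I * √2 * kappa k)) 2 fun k => by
    rcases eq_or_ne k 0 with rfl | hk
    · simp [kappa_zero]
    · have h1 := one_le_norm_kappa hk
      have h2 : 1 ≤ √2 := Real.one_le_sqrt.mpr (by norm_num)
      rw [norm_div, norm_mul, norm_mul, Complex.norm_I, Complex.norm_real, Real.norm_eq_abs,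
        abs_of_nonneg (Real.sqrt_nonneg 2)]
      rw [div_le_iff₀ (by positivity), Complex.norm_ofNat]
      nlinarith

lemma coeff_primitive (a : Wiener) (k : ℤ × ℤ) :
    (primitive a).coeff k = 2 / (Complex.I * √2 * kappa k) * a.coeff k := rfl

end Wiener

/-- The real-linear form `a dx + b dy` with complex coefficients. -/
def planeForm (a b : ℂ) : ℝ × ℝ →L[ℝ] ℂ :=
  a • (Complex.ofRealCLM.comp (ContinuousLinearMap.fst ℝ ℝ ℝ))
    + b • (Complex.ofRealCLM.comp (ContinuousLinearMap.snd ℝ ℝ ℝ))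

@[simp] lemma planeForm_apply (a b : ℂ) (v : ℝ × ℝ) : planeForm a b v = a * v.1 + b * v.2 := by
  simp [planeForm]

lemma norm_planeForm_le (a b : ℂ) : ‖planeForm a b‖ ≤ ‖a‖ + ‖b‖ := by
  refine ContinuousLinearMap.opNorm_le_bound _ (by positivity) fun v => ?_
  rw [planeForm_apply, add_mul]
  refine (norm_add_le _ _).trans ?_
  rw [norm_mul, norm_mul, Complex.norm_real, Complex.norm_real]
  gcongr
  exacts [norm_fst_le v, norm_snd_le v]

lemma planeForm_sub (a b c d : ℂ) :
    planeForm a b - planeForm c d = planeForm (a - c) (b - d) := by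
  ext <;> simp

lemma eq_planeForm (L : ℝ × ℝ →L[ℝ] ℂ) : L = planeForm (L (1, 0)) (L (0, 1)) := by
  ext <;> simp

namespace Wiener

/-- Termwise differentiation of a Fourier series. -/
lemma hasFDerivAt_ev {a ax ay : Wiener}
    (hx : ∀ k, ax.coeff k = Complex.I * √2 * k.1 * a.coeff k)
    (hy : ∀ k, ay.coeff k = Complex.I * √2 * k.2 * a.coeff k) (p : ℝ × ℝ) :
    HasFDerivAt a.ev (planeForm (ax.ev p) (ay.ev p)) p := by
  have hterm (k : ℤ × ℤ) (q : ℝ × ℝ) : a.coeff k • (chr k q • chrForm k)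
      = planeForm (ax.coeff k * chr k q) (ay.coeff k * chr k q) := by
    ext <;> simp [chrForm_apply, hx, hy] <;> ring
  have h := hasFDerivAt_tsum (𝕜 := ℝ) (f := fun k q => a.coeff k * chr k q)
    (f' := fun k q => a.coeff k • (chr k q • chrForm k)) (x₀ := p)
    (u := fun k => ‖ax.coeff k‖ + ‖ay.coeff k‖) (ax.summable_norm.add ay.summable_norm)
    (fun k q => (hasFDerivAt_chr k q).const_mul (a.coeff k))
    (fun k q => by
      rw [hterm]
      refine (norm_planeForm_le _ _).trans_eq ?_
      rw [norm_term, norm_term])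
    (a.summable_term p) p
  refine h.congr_fderiv ?_
  simp only [hterm, planeForm]
  exact (((ax.summable_term p).hasSum.smul_const _).add
    ((ay.summable_term p).hasSum.smul_const _)).tsum_eq

/-- The derivative `∂w/∂x` of the quasiconformal map with `∂w/∂z̄ = h`. -/
def mapX (h : Wiener) : Wiener := 1 + beurling h + h

/-- The derivative `∂w/∂y` of the quasiconformal map with `∂w/∂z̄ = h`. -/
def mapY (h : Wiener) : Wiener := Complex.I • (1 + beurling h - h)

/-- The map `w` with `∂w/∂z̄ = h` and `∂w/∂z = 1 + S h`, where `S` is the Beurling transform. -/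
def qcMap (h : Wiener) (p : ℝ × ℝ) : ℂ :=
  planeForm (1 + h.coeff 0) (Complex.I * (1 - h.coeff 0)) p + (primitive h).ev p

lemma hasFDerivAt_qcMap (h : Wiener) (p : ℝ × ℝ) :
    HasFDerivAt (qcMap h) (planeForm (h.mapX.ev p) (h.mapY.ev p)) p := by
  have hi : (√2 : ℂ) ≠ 0 := by simp
  have h1 := hasFDerivAt_ev (a := primitive h) (ax := h.mapX - single 0 (1 + h.coeff 0))
    (ay := h.mapY - single 0 (Complex.I * (1 - h.coeff 0))) (fun k => by
      rcases eq_or_ne k 0 with rfl | hk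
      · simp [mapX, coeff_one, coeff_beurling, coeff_primitive, beurlingSymbol, kappa_zero,
          coeff_single]
      · have := kappa_ne_zero hk
        simp only [coeff_sub, mapX, coeff_add, coeff_one, if_neg hk, coeff_beurling,
          beurlingSymbol, coeff_single, coeff_primitive, conj_kappa]
        field_simp
        simp only [kappa]; ring) (fun k => by
      rcases eq_or_ne k 0 with rfl | hk
      · simp [mapY, coeff_one, coeff_beurling, coeff_primitive, beurlingSymbol, kappa_zero,
          coeff_single]
      · have := kappa_ne_zero hk
        simp only [coeff_sub, mapY, coeff_smul, coeff_add, coeff_one, if_neg hk, coeff_beurling,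
          beurlingSymbol, coeff_single, coeff_primitive, conj_kappa]
        field_simp
        simp only [kappa]; linear_combination (-2 * (k.2 : ℂ) * h.coeff k) * Complex.I_sq) p
  refine ((planeForm (1 + h.coeff 0) (Complex.I * (1 - h.coeff 0))).hasFDerivAt.add h1).congr_fderiv
    ?_
  ext <;> simp

lemma norm_mapX_sub_one (h : Wiener) (p : ℝ × ℝ) : ‖h.mapX.ev p - 1‖ ≤ 2 * ‖h‖ := by
  have h1 : h.mapX.ev p - 1 = (beurling h + h).ev p := by simp [mapX]; ring
  rw [h1]
  refine (norm_ev_le _ _).trans ((norm_add_le _ _).trans ?_)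
  linarith [norm_beurling_le h]

lemma norm_mapY_sub_I (h : Wiener) (p : ℝ × ℝ) : ‖h.mapY.ev p - Complex.I‖ ≤ 2 * ‖h‖ := by
  have h1 : h.mapY.ev p - Complex.I = Complex.I * (beurling h - h).ev p := by
    simp [mapY]; ring
  rw [h1, norm_mul, Complex.norm_I, one_mul]
  refine (norm_ev_le _ _).trans ((norm_sub_le _ _).trans ?_)
  linarith [norm_beurling_le h]

/-- For small `h` the map `w` is a Lipschitz perturbation of the identity, hence bijective. -/
lemma bijective_qcMap {h : Wiener} (hh : ‖h‖ ≤ 1 / 8) : Function.Bijective h.qcMap := by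
  let L : (ℝ × ℝ) ≃L[ℝ] ℂ := Complex.equivRealProdCLM.symm
  have hL : (L : ℝ × ℝ →L[ℝ] ℂ) = planeForm 1 Complex.I := by
    ext
    · change Complex.equivRealProd.symm (1, 0) = _
      simp [Complex.equivRealProd_symm_apply]
    · change Complex.equivRealProd.symm (0, 1) = _
      simp [Complex.equivRealProd_symm_apply]
  -- the derivative differs from the identity by at most `4 ‖h‖ ≤ 1 / 2`
  have hlip : ApproximatesLinearOn h.qcMap (L : ℝ × ℝ →L[ℝ] ℂ) Set.univ (1 / 2 : NNReal) := by
    rw [ApproximatesLinearOn]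
    intro x _ y _
    have := convex_univ.norm_image_sub_le_of_norm_hasFDerivWithin_le'
      (𝕜 := ℝ) (φ := (L : ℝ × ℝ →L[ℝ] ℂ)) (C := 1 / 2)
      (fun p _ => (hasFDerivAt_qcMap h p).hasFDerivWithinAt) (fun p _ => by
        rw [hL, planeForm_sub]
        refine (norm_planeForm_le _ _).trans ?_
        linarith [norm_mapX_sub_one h p, norm_mapY_sub_I h p]) (Set.mem_univ y) (Set.mem_univ x)
    simpa using this
  have hN : ‖(L.symm : ℂ →L[ℝ] ℝ × ℝ)‖₊ ≤ 1 := by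
    rw [← NNReal.coe_le_coe, coe_nnnorm, NNReal.coe_one]
    refine ContinuousLinearMap.opNorm_le_bound _ zero_le_one fun z => ?_
    rw [one_mul]
    change ‖(z.re, z.im)‖ ≤ ‖z‖
    rw [Prod.norm_def]
    exact max_le (Complex.abs_re_le_norm z) (Complex.abs_im_le_norm z)
  have hN0 : 0 < ‖(L.symm : ℂ →L[ℝ] ℝ × ℝ)‖₊ := by
    rw [nnnorm_pos]
    intro h0
    have : L.symm 1 = 0 := by
      change (L.symm : ℂ →L[ℝ] ℝ × ℝ) 1 = 0
      rw [h0]; rfl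
    simp at this
  have hc : (1 / 2 : NNReal) < ‖(L.symm : ℂ →L[ℝ] ℝ × ℝ)‖₊⁻¹ := by
    refine lt_of_lt_of_le ?_ ((one_le_inv₀ hN0).mpr hN)
    rw [← NNReal.coe_lt_coe]; norm_num
  exact (hlip.toHomeomorph _ (Or.inr hc)).bijective

end Wiener

/-- A null vector of the complexified cometric, with independent real and imaginary parts, defines
a conformal linear map. -/
lemma normSq_eq_of_null {E F G : ℝ} {a b : ℂ} (hE : 0 < E)
    (hY : 0 < (starRingEnd ℂ a * b).im)
    (h : (G : ℂ) * a ^ 2 - 2 * F * a * b + E * b ^ 2 = 0) (s t : ℝ) :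
    Complex.normSq (a * s + b * t)
      = Complex.normSq a / E * (E * s ^ 2 + 2 * F * s * t + G * t ^ 2) := by
  -- multiplied by `ā²` the null equation becomes quadratic in `ā b = X + i Y`; its imaginary part
  -- gives `E X = F P`, its real part then `E R = G P`
  set P := Complex.normSq a with hP
  set R := Complex.normSq b with hR
  set X := (starRingEnd ℂ a * b).re with hX
  set Y := (starRingEnd ℂ a * b).im with hYd
  have hz : starRingEnd ℂ a * b = X + Y * Complex.I := (Complex.re_add_im _).symm
  have hPa : starRingEnd ℂ a * a = (P : ℂ) := by rw [mul_comm, Complex.mul_conj]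
  have hnull : (G : ℂ) * P ^ 2 - 2 * F * P * (X + Y * Complex.I) + E * (X + Y * Complex.I) ^ 2
      = 0 := by
    rw [← hz, ← hPa]; linear_combination (starRingEnd ℂ a) ^ 2 * h
  have hre := congrArg Complex.re hnull
  have him := congrArg Complex.im hnull
  simp [pow_two] at hre him
  have hPR : P * R = X ^ 2 + Y ^ 2 := by
    have h1 : Complex.normSq (starRingEnd ℂ a * b) = P * R := by
      rw [Complex.normSq_mul, Complex.normSq_conj]
    rw [← h1, Complex.normSq_apply]; ring
  have h1 : E * X = F * P := by
    have : Y * (E * X - F * P) = 0 := by linarith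
    rcases mul_eq_zero.mp this with h | h
    · exact absurd h hY.ne'
    · linarith
  have hP0 : P ≠ 0 := by
    intro h0
    rw [h0, zero_mul] at hPR
    have : 0 < Y ^ 2 := by positivity
    nlinarith [sq_nonneg X]
  have h2 : E * R = G * P := by
    have : P * (E * R - G * P) = 0 := by linear_combination E * hPR - hre + 2 * X * h1
    rcases mul_eq_zero.mp this with h | h
    · exact absurd h hP0
    · linarith
  have h3 : Complex.normSq (a * s + b * t) = P * s ^ 2 + 2 * X * s * t + R * t ^ 2 := by
    rw [hP, hR, hX]
    simp [Complex.normSq_apply]; ring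
  rw [h3, div_mul_eq_mul_div, eq_div_iff hE.ne']
  linear_combination 2 * s * t * h1 + t ^ 2 * h2

/-- A small solution `h` of the Beltrami equation, in the polynomial form
`G w_x² - 2 F w_x w_y + E w_y² = 0`, determines the point in Teichmüller space. -/
lemma exists_isTeichmuellerClass {f : ℝ × ℝ → E4} {E F G : ℝ × ℝ → ℝ} {h : Wiener}
    (hf : ∀ p v, ‖fderiv ℝ f p v‖ ^ 2 = E p * v.1 ^ 2 + 2 * F p * v.1 * v.2 + G p * v.2 ^ 2)
    (hE : ∀ p, 0 < E p) (hh : ‖h‖ ≤ 1 / 8)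
    (hnull : ∀ p, (G p : ℂ) * h.mapX.ev p ^ 2 - 2 * F p * h.mapX.ev p * h.mapY.ev p
      + E p * h.mapY.ev p ^ 2 = 0) :
    ∃ τ, IsTeichmuellerClass f τ ∧
      τ.re = 2 * (h.coeff 0).im / Complex.normSq (1 + h.coeff 0) := by
  have h0 : ‖h.coeff 0‖ ≤ 1 / 8 := (h.norm_coeff_le 0).trans hh
  have hs0 : (side : ℂ) ≠ 0 := by exact_mod_cast side_pos.ne'
  have h1 : 1 + h.coeff 0 ≠ 0 := by
    intro hc
    have : h.coeff 0 = -1 := by linear_combination hc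
    rw [this] at h0; norm_num at h0
  have hn1 : 0 < Complex.normSq (1 + h.coeff 0) := Complex.normSq_pos.mpr h1
  -- the map has the periods `side * (1 + h₀)` and `side * i (1 - h₀)`; `c` normalizes the first
  let c : ℂ := (side * (1 + h.coeff 0))⁻¹
  have hc : c ≠ 0 := inv_ne_zero (mul_ne_zero hs0 h1)
  have hsq : (h.coeff 0).re ^ 2 + (h.coeff 0).im ^ 2 < 1 := by
    have : Complex.normSq (h.coeff 0) = (h.coeff 0).re ^ 2 + (h.coeff 0).im ^ 2 := by
      rw [Complex.normSq_apply]; ring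
    rw [← this, Complex.normSq_eq_norm_sq]
    nlinarith [norm_nonneg (h.coeff 0)]
  have hτ : 0 < (Complex.I * (1 - h.coeff 0) / (1 + h.coeff 0)).im := by
    rw [Complex.div_im]
    simp only [Complex.mul_re, Complex.mul_im, Complex.I_re, Complex.I_im, Complex.sub_re,
      Complex.sub_im, Complex.one_re, Complex.one_im, Complex.add_re, Complex.add_im]
    rw [← sub_div]
    refine div_pos ?_ hn1
    nlinarith
  refine ⟨⟨Complex.I * (1 - h.coeff 0) / (1 + h.coeff 0), hτ⟩, ?_, ?_⟩
  · have hd (p : ℝ × ℝ) : HasFDerivAt (fun q => c * h.qcMap q)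
        (c • planeForm (h.mapX.ev p) (h.mapY.ev p)) p := (h.hasFDerivAt_qcMap p).const_mul c
    have hY (p : ℝ × ℝ) : 0 < (starRingEnd ℂ (h.mapX.ev p) * h.mapY.ev p).im := by
      have e1 : (starRingEnd ℂ (h.mapX.ev p) * h.mapY.ev p).im
          = Complex.normSq (1 + (Wiener.beurling h).ev p) - Complex.normSq (h.ev p) := by
        simp [Wiener.mapX, Wiener.mapY, Complex.normSq_apply]; ring
      have e2 : ‖h.ev p‖ ≤ 1 / 8 := (h.norm_ev_le p).trans hh
      have e3 : ‖(Wiener.beurling h).ev p‖ ≤ 1 / 8 :=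
        (Wiener.norm_ev_le _ p).trans ((Wiener.norm_beurling_le h).trans hh)
      have e4 : 7 / 8 ≤ ‖1 + (Wiener.beurling h).ev p‖ := by
        have := norm_sub_norm_le (1 : ℂ) (-(Wiener.beurling h).ev p)
        rw [norm_neg, norm_one, sub_neg_eq_add] at this
        linarith
      rw [e1, Complex.normSq_eq_norm_sq, Complex.normSq_eq_norm_sq]
      nlinarith [norm_nonneg (h.ev p)]
    refine ⟨fun q => c * h.qcMap q, ?_, ?_, ?_, ?_, ?_⟩
    · rw [contDiff_one_iff_fderiv]
      refine ⟨fun p => (hd p).differentiableAt, ?_⟩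
      have : fderiv ℝ (fun q => c * h.qcMap q)
          = fun p => c • planeForm (h.mapX.ev p) (h.mapY.ev p) := funext fun p => (hd p).fderiv
      rw [this]
      have c1 := h.mapX.continuous_ev
      have c2 := h.mapY.continuous_ev
      unfold planeForm
      fun_prop
    · exact (mulLeft_bijective₀ c hc).comp (Wiener.bijective_qcMap hh)
    · intro p
      have e1 := (Wiener.ev_periodic (Wiener.primitive h) p).1
      have e2 := (Wiener.ev_periodic (Wiener.primitive h) p).2
      constructor
      · simp only [Wiener.qcMap, e1, planeForm_apply, Prod.fst_add, Prod.snd_add, c]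
        push_cast
        field_simp
        ring
      · simp only [Wiener.qcMap, e2, planeForm_apply, Prod.fst_add, Prod.snd_add, c]
        push_cast
        field_simp
        ring
    · intro p
      have hP : 0 < Complex.normSq (h.mapX.ev p) := by
        refine Complex.normSq_pos.mpr fun h0 => ?_
        have := hY p
        simp [h0] at this
      refine ⟨√(Complex.normSq c * (Complex.normSq (h.mapX.ev p) / E p)),
        Real.sqrt_pos.mpr (mul_pos (Complex.normSq_pos.mpr hc) (div_pos hP (hE p))), fun v => ?_⟩
      rw [(hd p).fderiv, ← Real.sqrt_sq (norm_nonneg (fderiv ℝ f p v)), hf, ← Real.sqrt_mul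
        (mul_nonneg (Complex.normSq_nonneg _) (div_nonneg hP.le (hE p).le)), mul_assoc,
        ← normSq_eq_of_null (hE p) (hY p) (hnull p), ← Complex.normSq_mul,
        Complex.normSq_eq_norm_sq, Real.sqrt_sq (norm_nonneg _)]
      simp
    · intro p
      rw [(hd p).fderiv]
      have : starRingEnd ℂ ((c • planeForm (h.mapX.ev p) (h.mapY.ev p)) (1, 0))
          * (c • planeForm (h.mapX.ev p) (h.mapY.ev p)) (0, 1)
          = (Complex.normSq c : ℂ) * (starRingEnd ℂ (h.mapX.ev p) * h.mapY.ev p) := by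
        rw [← Complex.mul_conj]; simp; ring
      rw [this, Complex.im_ofReal_mul]
      exact mul_pos (Complex.normSq_pos.mpr hc) (hY p)
  · change (Complex.I * (1 - h.coeff 0) / (1 + h.coeff 0)).re = _
    rw [Complex.div_re]
    simp only [Complex.mul_re, Complex.mul_im, Complex.I_re, Complex.I_im, Complex.sub_re,
      Complex.sub_im, Complex.one_re, Complex.one_im, Complex.add_re, Complex.add_im]
    rw [← add_div]
    congr 1; ring
end


noncomputable section

/-! ### Uniqueness of the point in Teichmüller space -/

/-- A continuous function on the torus is bounded. -/
lemma IsDoublyPeriodic.isBounded_range {g : ℝ × ℝ → ℂ} (hp : IsDoublyPeriodic g)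
    (hg : Continuous g) : Bornology.IsBounded (Set.range g) := by
  refine (isCompact_cell.image hg).isBounded.subset ?_
  rintro _ ⟨⟨x, y⟩, rfl⟩
  have h1 : Function.Periodic (fun x => g (x, y)) side := fun x => by simpa using (hp (x, y)).1
  obtain ⟨x', hx', e1⟩ := h1.exists_mem_Ico₀ side_pos x
  have h2 : Function.Periodic (fun y => g (x', y)) side := fun y => by simpa using (hp (x', y)).2
  obtain ⟨y', hy', e2⟩ := h2.exists_mem_Ico₀ side_pos y
  exact ⟨(x', y'), ⟨Set.Ico_subset_Icc_self hx', Set.Ico_subset_Icc_self hy'⟩, (e1.trans e2).symm⟩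

/-- Two orientation preserving real-linear maps from the plane to `ℂ` that induce proportional
metrics differ by a complex factor. -/
lemma exists_eq_mul_of_norm_eq {a b a' b' : ℂ} {c : ℝ} (hc : 0 < c)
    (h : ∀ s t : ℝ, ‖a' * s + b' * t‖ = c * ‖a * s + b * t‖)
    (hY : 0 < (starRingEnd ℂ a * b).im) (hY' : 0 < (starRingEnd ℂ a' * b').im) :
    ∃ l : ℂ, a' = l * a ∧ b' = l * b := by
  have hsq (s t : ℝ) : Complex.normSq (a' * s + b' * t)
      = c ^ 2 * Complex.normSq (a * s + b * t) := by
    rw [Complex.normSq_eq_norm_sq, Complex.normSq_eq_norm_sq, h]; ring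
  have h1 : Complex.normSq a' = c ^ 2 * Complex.normSq a := by simpa using hsq 1 0
  have h2 : Complex.normSq b' = c ^ 2 * Complex.normSq b := by simpa using hsq 0 1
  have hpol (z w : ℂ) : Complex.normSq (z * (1 : ℝ) + w * (1 : ℝ))
      = Complex.normSq z + Complex.normSq w + 2 * (starRingEnd ℂ z * w).re := by
    simp [Complex.normSq_apply]; ring
  have h3 : (starRingEnd ℂ a' * b').re = c ^ 2 * (starRingEnd ℂ a * b).re := by
    have := hsq 1 1
    rw [hpol, hpol, h1, h2] at this
    linarith
  have hn (z w : ℂ) : (starRingEnd ℂ z * w).re ^ 2 + (starRingEnd ℂ z * w).im ^ 2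
      = Complex.normSq z * Complex.normSq w := by
    rw [← Complex.normSq_conj z, ← Complex.normSq_mul, Complex.normSq_apply]; ring
  have h4 : (starRingEnd ℂ a' * b').im = c ^ 2 * (starRingEnd ℂ a * b).im := by
    have e1 := hn a' b'
    rw [h1, h2, h3] at e1
    have e2 := hn a b
    have e3 : (starRingEnd ℂ a' * b').im ^ 2 = (c ^ 2 * (starRingEnd ℂ a * b).im) ^ 2 := by
      linear_combination e1 - c ^ 4 * e2
    exact (sq_eq_sq₀ hY'.le (by positivity)).mp e3
  have h5 : starRingEnd ℂ a' * b' = (c ^ 2 : ℝ) * (starRingEnd ℂ a * b) := by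
    apply Complex.ext
    · rw [h3, Complex.re_ofReal_mul]
    · rw [h4, Complex.im_ofReal_mul]
  have ha : a ≠ 0 := by rintro rfl; simp at hY
  have ha' : a' ≠ 0 := by rintro rfl; simp at hY'
  have hca' : starRingEnd ℂ a' ≠ 0 := (map_ne_zero _).mpr ha'
  refine ⟨a' / a, by field_simp, ?_⟩
  have h6 : starRingEnd ℂ a' * a' = (c ^ 2 : ℝ) * (starRingEnd ℂ a * a) := by
    rw [mul_comm, Complex.mul_conj, mul_comm _ a, Complex.mul_conj, h1]; push_cast; ring
  apply mul_left_cancel₀ hca'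
  rw [h5, div_mul_eq_mul_div, mul_div_assoc', eq_div_iff ha]
  linear_combination -b * h6

lemma injective_of_im_pos {L : ℝ × ℝ →L[ℝ] ℂ}
    (hL : 0 < (starRingEnd ℂ (L (1, 0)) * L (0, 1)).im) : Function.Injective L := by
  rw [injective_iff_map_eq_zero]
  intro v hv
  rw [eq_planeForm L, planeForm_apply] at hv
  have key (z w : ℂ) (s t : ℝ) (h : z * s + w * t = 0) :
      (starRingEnd ℂ z * w).im * t = 0 ∧ (starRingEnd ℂ z * w).im * s = 0 := by
    have hre := congrArg Complex.re h
    have him := congrArg Complex.im h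
    simp at hre him
    simp only [Complex.mul_im, Complex.conj_re, Complex.conj_im]
    constructor
    · linear_combination z.re * him - z.im * hre
    · linear_combination -w.re * him + w.im * hre
  obtain ⟨h1, h2⟩ := key _ _ _ _ hv
  ext
  · exact (mul_eq_zero.mp h2).resolve_left hL.ne'
  · exact (mul_eq_zero.mp h1).resolve_left hL.ne'

/-- The transition map between two conformal markings is entire and its derivative is doubly
periodic, hence constant by Liouville's theorem; the markings then agree. -/
lemma isTeichmuellerClass_unique {f : ℝ × ℝ → E4} {τ τ' : UpperHalfPlane}
    (h : IsTeichmuellerClass f τ) (h' : IsTeichmuellerClass f τ') : τ' = τ := by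
  obtain ⟨w, hw, hbij, hper, hconf, hor⟩ := h
  obtain ⟨u, hu, -, hper', hconf', hor'⟩ := h'
  have hinj (p : ℝ × ℝ) : Function.Injective (fderiv ℝ w p) := injective_of_im_pos (hor p)
  let L (p : ℝ × ℝ) : (ℝ × ℝ) ≃L[ℝ] ℂ :=
    (LinearMap.linearEquivOfInjective (fderiv ℝ w p : ℝ × ℝ →ₗ[ℝ] ℂ) (hinj p)
      (by simp)).toContinuousLinearEquiv
  have hLv (p v : ℝ × ℝ) : L p v = fderiv ℝ w p v := rfl
  have hL (p : ℝ × ℝ) : (L p : ℝ × ℝ →L[ℝ] ℂ) = fderiv ℝ w p := ContinuousLinearMap.ext (hLv p)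
  have hstrict (p : ℝ × ℝ) : HasStrictFDerivAt w (L p : ℝ × ℝ →L[ℝ] ℂ) p := by
    rw [hL]; exact hw.contDiffAt.hasStrictFDerivAt one_ne_zero
  have hopen : IsOpenMap w :=
    isOpenMap_iff_nhds_le.mpr fun p => (hstrict p).map_nhds_eq_of_equiv.ge
  let e : (ℝ × ℝ) ≃ₜ ℂ :=
    (Equiv.ofBijective w hbij).toHomeomorphOfContinuousOpen hw.continuous hopen
  have he (p : ℝ × ℝ) : e p = w p := rfl
  have hes (p : ℝ × ℝ) : e.symm (w p) = p := e.symm_apply_apply p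
  have hsymm (z : ℂ) : HasFDerivAt e.symm ((L (e.symm z)).symm : ℂ →L[ℝ] ℝ × ℝ) z :=
    HasFDerivAt.of_local_left_inverse e.symm.continuous.continuousAt
      (hstrict _).hasFDerivAt (Eventually.of_forall fun y => e.apply_symm_apply y)
  -- the transition map between the two markings
  let F : ℂ → ℂ := fun z => u (e.symm z)
  have hF : Differentiable ℂ F := by
    intro z
    set p := e.symm z with hp
    obtain ⟨r, hr, hr2⟩ := hconf p
    obtain ⟨r', hr', hr2'⟩ := hconf' p
    obtain ⟨l, hl1, hl2⟩ := exists_eq_mul_of_norm_eq (a := fderiv ℝ w p (1, 0))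
      (b := fderiv ℝ w p (0, 1)) (a' := fderiv ℝ u p (1, 0)) (b' := fderiv ℝ u p (0, 1))
      (c := r' / r) (div_pos hr' hr) (fun s t => by
        have e1 := hr2 (s, t)
        have e2 := hr2' (s, t)
        rw [eq_planeForm (fderiv ℝ w p), planeForm_apply] at e1
        rw [eq_planeForm (fderiv ℝ u p), planeForm_apply] at e2
        simp only at e1 e2
        rw [e1, e2]
        field_simp) (hor p) (hor' p)
    have hd : HasFDerivAt F ((fderiv ℝ u p).comp ((L p).symm : ℂ →L[ℝ] ℝ × ℝ)) z :=
      ((hu.differentiable one_ne_zero p).hasFDerivAt).comp z (hsymm z)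
    refine (hasFDerivAt_of_restrictScalars ℝ (f' := l • ContinuousLinearMap.id ℂ ℂ) hd
      ?_).differentiableAt
    refine ContinuousLinearMap.ext fun y => ?_
    obtain ⟨v, rfl⟩ := (L p).surjective y
    have : ((fderiv ℝ u p).comp ((L p).symm : ℂ →L[ℝ] ℝ × ℝ)) (L p v) = fderiv ℝ u p v := by
      simp
    rw [this, hLv, eq_planeForm (fderiv ℝ u p), planeForm_apply, hl1, hl2]
    conv_lhs => rw [eq_planeForm (fderiv ℝ w p)]
    simp
    ring
  have hF1 (z : ℂ) : F (z + 1) = F z + 1 := by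
    obtain ⟨p, rfl⟩ := hbij.surjective z
    rw [← (hper p).1]; simp only [F, hes]; exact (hper' p).1
  have hFτ (z : ℂ) : F (z + τ) = F z + τ' := by
    obtain ⟨p, rfl⟩ := hbij.surjective z
    rw [← (hper p).2]; simp only [F, hes]; exact (hper' p).2
  have hd1 (z : ℂ) : deriv F (z + 1) = deriv F z := by
    rw [← deriv_comp_add_const]; simp only [hF1, deriv_add_const]
  have hdτ (z : ℂ) : deriv F (z + τ) = deriv F z := by
    rw [← deriv_comp_add_const]; simp only [hFτ, deriv_add_const]
  have hdF : Differentiable ℂ (deriv F) := hF.deriv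
  have hbd : Bornology.IsBounded (Set.range (deriv F)) := by
    have h1 : IsDoublyPeriodic (fun p => deriv F (w p)) := fun p => by
      simp only [(hper p).1, (hper p).2, hd1, hdτ, and_self]
    have h2 := h1.isBounded_range (hdF.continuous.comp hw.continuous)
    rwa [show (fun p => deriv F (w p)) = deriv F ∘ w from rfl, hbij.surjective.range_comp] at h2
  have hconst (z : ℂ) : deriv F z = deriv F 0 := hdF.apply_eq_apply_of_bounded hbd z 0
  have haff (z : ℂ) : F z - deriv F 0 * z = F 0 := by
    have := is_const_of_deriv_eq_zero (f := fun z => F z - deriv F 0 * z)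
      (hF.sub (differentiable_id.const_mul _)) (fun x => by
        have h1 := (hF x).hasDerivAt.sub ((hasDerivAt_id x).const_mul (deriv F 0))
        rw [hconst x, mul_one, sub_self] at h1
        exact h1.deriv) z 0
    simpa using this
  have e1 := haff 1
  have e2 := haff τ
  have e3 := hF1 0
  have e4 := hFτ 0
  rw [zero_add] at e3 e4
  -- the transition map is affine; the period `1` fixes its slope, and then `τ` goes to `τ'`
  have hc : deriv F 0 = 1 := by linear_combination -e1 + e3
  rw [hc] at e2
  have : (τ' : ℂ) = τ := by linear_combination e2 - e4
  exact UpperHalfPlane.ext this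
end


noncomputable section

/-! ### Geometry of normal graphs over the Clifford torus -/

/-- The vector with coordinates `a, b, c, d` in the orthonormal frame of `ℝ⁴ = ℂ²` consisting of
`e^{i√2x}` and `i e^{i√2x}` in the first and `e^{i√2y}` and `i e^{i√2y}` in the second factor. -/
def torusFrame (a b c d : ℝ) (p : ℝ × ℝ) : E4 :=
  !₂[a * cos (√2 * p.1) - b * sin (√2 * p.1), a * sin (√2 * p.1) + b * cos (√2 * p.1),
    c * cos (√2 * p.2) - d * sin (√2 * p.2), c * sin (√2 * p.2) + d * cos (√2 * p.2)]

lemma torusFrame_add (a b c d a' b' c' d' : ℝ) (p : ℝ × ℝ) :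
    torusFrame a b c d p + torusFrame a' b' c' d' p
      = torusFrame (a + a') (b + b') (c + c') (d + d') p := by
  ext i; fin_cases i <;> simp [torusFrame] <;> ring

lemma torusFrame_smul (r a b c d : ℝ) (p : ℝ × ℝ) :
    r • torusFrame a b c d p = torusFrame (r * a) (r * b) (r * c) (r * d) p := by
  ext i; fin_cases i <;> simp [torusFrame] <;> ring

lemma inner_torusFrame (a b c d a' b' c' d' : ℝ) (p : ℝ × ℝ) :
    inner ℝ (torusFrame a b c d p) (torusFrame a' b' c' d' p)
      = a * a' + b * b' + c * c' + d * d' := by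
  simp only [torusFrame, PiLp.inner_apply, Fin.sum_univ_four]
  simp
  linear_combination (a * a' + b * b') * Real.sin_sq_add_cos_sq (√2 * p.1)
    + (c * c' + d * d') * Real.sin_sq_add_cos_sq (√2 * p.2)

lemma norm_sq_torusFrame (a b c d : ℝ) (p : ℝ × ℝ) :
    ‖torusFrame a b c d p‖ ^ 2 = a ^ 2 + b ^ 2 + c ^ 2 + d ^ 2 := by
  rw [← real_inner_self_eq_norm_sq, inner_torusFrame]; ring

lemma cross_eq (a b c : E4) : cross a b c = !₂[
    a 1 * (b 2 * c 3 - b 3 * c 2) - b 1 * (a 2 * c 3 - a 3 * c 2) + c 1 * (a 2 * b 3 - a 3 * b 2),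
    -(a 0 * (b 2 * c 3 - b 3 * c 2) - b 0 * (a 2 * c 3 - a 3 * c 2) + c 0 * (a 2 * b 3 - a 3 * b 2)),
    a 3 * (b 0 * c 1 - b 1 * c 0) - b 3 * (a 0 * c 1 - a 1 * c 0) + c 3 * (a 0 * b 1 - a 1 * b 0),
    -(a 2 * (b 0 * c 1 - b 1 * c 0) - b 2 * (a 0 * c 1 - a 1 * c 0)
      + c 2 * (a 0 * b 1 - a 1 * b 0))] := by
  have hdet (M : Matrix (Fin 4) (Fin 4) ℝ) : M.det =
      M 0 0 * (M 1 1 * (M 2 2 * M 3 3 - M 2 3 * M 3 2) - M 2 1 * (M 1 2 * M 3 3 - M 1 3 * M 3 2)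
        + M 3 1 * (M 1 2 * M 2 3 - M 1 3 * M 2 2))
      - M 0 1 * (M 1 0 * (M 2 2 * M 3 3 - M 2 3 * M 3 2) - M 2 0 * (M 1 2 * M 3 3 - M 1 3 * M 3 2)
        + M 3 0 * (M 1 2 * M 2 3 - M 1 3 * M 2 2))
      + M 0 2 * (M 1 3 * (M 2 0 * M 3 1 - M 2 1 * M 3 0) - M 2 3 * (M 1 0 * M 3 1 - M 1 1 * M 3 0)
        + M 3 3 * (M 1 0 * M 2 1 - M 1 1 * M 2 0))
      - M 0 3 * (M 1 2 * (M 2 0 * M 3 1 - M 2 1 * M 3 0) - M 2 2 * (M 1 0 * M 3 1 - M 1 1 * M 3 0)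
        + M 3 2 * (M 1 0 * M 2 1 - M 1 1 * M 2 0)) := by
    simp [Matrix.det_succ_row_zero, Fin.sum_univ_succ, Fin.succAbove]
    ring
  ext i
  fin_cases i <;>
  · refine (hdet _).trans ?_
    simp

/-- The frame is orthonormal and positively oriented, so the triple product has the same expression
in frame coordinates. -/
lemma cross_torusFrame (u₁ u₂ u₃ u₄ v₁ v₂ v₃ v₄ w₁ w₂ w₃ w₄ : ℝ) (p : ℝ × ℝ) :
    cross (torusFrame u₁ u₂ u₃ u₄ p) (torusFrame v₁ v₂ v₃ v₄ p) (torusFrame w₁ w₂ w₃ w₄ p)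
      = torusFrame
        (u₂ * (v₃ * w₄ - v₄ * w₃) - v₂ * (u₃ * w₄ - u₄ * w₃) + w₂ * (u₃ * v₄ - u₄ * v₃))
        (-(u₁ * (v₃ * w₄ - v₄ * w₃) - v₁ * (u₃ * w₄ - u₄ * w₃) + w₁ * (u₃ * v₄ - u₄ * v₃)))
        (u₄ * (v₁ * w₂ - v₂ * w₁) - v₄ * (u₁ * w₂ - u₂ * w₁) + w₄ * (u₁ * v₂ - u₂ * v₁))
        (-(u₃ * (v₁ * w₂ - v₂ * w₁) - v₃ * (u₁ * w₂ - u₂ * w₁) + w₃ * (u₁ * v₂ - u₂ * v₁))) p := by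
  rw [cross_eq]
  have hx := Real.sin_sq_add_cos_sq (√2 * p.1)
  have hy := Real.sin_sq_add_cos_sq (√2 * p.2)
  set X := cos (√2 * p.1)
  set X' := sin (√2 * p.1)
  set Y := cos (√2 * p.2)
  set Y' := sin (√2 * p.2)
  ext i
  fin_cases i
  · simp [torusFrame]
    linear_combination ((u₁ * X' + u₂ * X) * (v₃ * w₄ - v₄ * w₃)
      - (v₁ * X' + v₂ * X) * (u₃ * w₄ - u₄ * w₃) + (w₁ * X' + w₂ * X) * (u₃ * v₄ - u₄ * v₃)) * hy
  · simp [torusFrame]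
    linear_combination -((u₁ * X - u₂ * X') * (v₃ * w₄ - v₄ * w₃)
      - (v₁ * X - v₂ * X') * (u₃ * w₄ - u₄ * w₃) + (w₁ * X - w₂ * X') * (u₃ * v₄ - u₄ * v₃)) * hy
  · simp [torusFrame]
    linear_combination ((u₃ * Y' + u₄ * Y) * (v₁ * w₂ - v₂ * w₁)
      - (v₃ * Y' + v₄ * Y) * (u₁ * w₂ - u₂ * w₁) + (w₃ * Y' + w₄ * Y) * (u₁ * v₂ - u₂ * v₁)) * hx
  · simp [torusFrame]
    linear_combination -((u₃ * Y - u₄ * Y') * (v₁ * w₂ - v₂ * w₁)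
      - (v₃ * Y - v₄ * Y') * (u₁ * w₂ - u₂ * w₁) + (w₃ * Y - w₄ * Y') * (u₁ * v₂ - u₂ * v₁)) * hx

/-- Differentiation of a vector field given in the moving frame. -/
lemma hasFDerivAt_torusFrame {a b c d : ℝ × ℝ → ℝ} {p : ℝ × ℝ} (ha : DifferentiableAt ℝ a p)
    (hb : DifferentiableAt ℝ b p) (hc : DifferentiableAt ℝ c p) (hd : DifferentiableAt ℝ d p) :
    DifferentiableAt ℝ (fun q => torusFrame (a q) (b q) (c q) (d q) q) p ∧
    ∀ v, fderiv ℝ (fun q => torusFrame (a q) (b q) (c q) (d q) q) p v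
      = torusFrame (fderiv ℝ a p v - √2 * v.1 * b p) (fderiv ℝ b p v + √2 * v.1 * a p)
        (fderiv ℝ c p v - √2 * v.2 * d p) (fderiv ℝ d p v + √2 * v.2 * c p) p := by
  have hX : HasFDerivAt (fun q : ℝ × ℝ => √2 * q.1) (√2 • ContinuousLinearMap.fst ℝ ℝ ℝ) p :=
    hasFDerivAt_fst.const_mul _
  have hY : HasFDerivAt (fun q : ℝ × ℝ => √2 * q.2) (√2 • ContinuousLinearMap.snd ℝ ℝ ℝ) p :=
    hasFDerivAt_snd.const_mul _
  have h0 := (ha.hasFDerivAt.mul hX.cos).sub (hb.hasFDerivAt.mul hX.sin)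
  have h1 := (ha.hasFDerivAt.mul hX.sin).add (hb.hasFDerivAt.mul hX.cos)
  have h2 := (hc.hasFDerivAt.mul hY.cos).sub (hd.hasFDerivAt.mul hY.sin)
  have h3 := (hc.hasFDerivAt.mul hY.sin).add (hd.hasFDerivAt.mul hY.cos)
  have hdiff : DifferentiableAt ℝ (fun q => torusFrame (a q) (b q) (c q) (d q) q) p := by
    rw [differentiableAt_euclidean]
    intro i
    fin_cases i
    exacts [h0.differentiableAt, h1.differentiableAt, h2.differentiableAt, h3.differentiableAt]
  refine ⟨hdiff, fun v => ?_⟩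
  have hi (i : Fin 4) : HasFDerivAt (fun q => torusFrame (a q) (b q) (c q) (d q) q i)
      ((EuclideanSpace.proj i).comp
        (fderiv ℝ (fun q => torusFrame (a q) (b q) (c q) (d q) q) p)) p :=
    (EuclideanSpace.proj (𝕜 := ℝ) i).hasFDerivAt.comp p hdiff.hasFDerivAt
  ext i
  have e (L : ℝ × ℝ →L[ℝ] ℝ) (hL : HasFDerivAt
      (fun q => torusFrame (a q) (b q) (c q) (d q) q i) L p) :
      (fderiv ℝ (fun q => torusFrame (a q) (b q) (c q) (d q) q) p v) i = L v := by
    rw [← (hi i).unique hL]; rfl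
  fin_cases i
  · rw [e _ h0]; simp [torusFrame]; ring
  · rw [e _ h1]; simp [torusFrame]; ring
  · rw [e _ h2]; simp [torusFrame]; ring
  · rw [e _ h3]; simp [torusFrame]; ring

lemma dx_torusFrame {a b c d : ℝ × ℝ → ℝ} {p : ℝ × ℝ} (ha : DifferentiableAt ℝ a p)
    (hb : DifferentiableAt ℝ b p) (hc : DifferentiableAt ℝ c p) (hd : DifferentiableAt ℝ d p) :
    dx (fun q => torusFrame (a q) (b q) (c q) (d q) q) p
      = torusFrame (pdx a p - √2 * b p) (pdx b p + √2 * a p) (pdx c p) (pdx d p) p := by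
  rw [dx, (hasFDerivAt_torusFrame ha hb hc hd).2]; simp [pdx]

lemma dy_torusFrame {a b c d : ℝ × ℝ → ℝ} {p : ℝ × ℝ} (ha : DifferentiableAt ℝ a p)
    (hb : DifferentiableAt ℝ b p) (hc : DifferentiableAt ℝ c p) (hd : DifferentiableAt ℝ d p) :
    dy (fun q => torusFrame (a q) (b q) (c q) (d q) q) p
      = torusFrame (pdy a p) (pdy b p) (pdy c p - √2 * d p) (pdy d p + √2 * c p) p := by
  rw [dy, (hasFDerivAt_torusFrame ha hb hc hd).2]; simp [pdy]

lemma cliffordTorus_eq :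
    cliffordTorus = fun p => torusFrame (√2)⁻¹ 0 (√2)⁻¹ 0 p := by
  ext p i; fin_cases i <;> simp [cliffordTorus, torusFrame]

/-- The normal graph of `v` over the Clifford torus, `(cos (π/4 + v) e^{i√2x}, sin (π/4 + v)
e^{i√2y})`. -/
def cliffordGraph (v : ℝ × ℝ → ℝ) (p : ℝ × ℝ) : E4 :=
  torusFrame (cos (π / 4 + v p)) 0 (sin (π / 4 + v p)) 0 p

lemma inv_sqrt_two : (√2)⁻¹ = √2 / 2 := by
  rw [inv_eq_one_div, div_eq_div_iff (by positivity) two_ne_zero]; simp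

lemma unitNormal_cliffordTorus (p : ℝ × ℝ) :
    unitNormal cliffordTorus p = torusFrame (-(√2)⁻¹) 0 (√2)⁻¹ 0 p := by
  have hx : dx cliffordTorus p = torusFrame 0 1 0 0 p := by
    rw [cliffordTorus_eq, dx_torusFrame (by fun_prop) (by fun_prop) (by fun_prop) (by fun_prop)]
    simp [pdx]
  have hy : dy cliffordTorus p = torusFrame 0 0 0 1 p := by
    rw [cliffordTorus_eq, dy_torusFrame (by fun_prop) (by fun_prop) (by fun_prop) (by fun_prop)]
    simp [pdy]
  have hc : cross (cliffordTorus p) (dx cliffordTorus p) (dy cliffordTorus p)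
      = torusFrame (-(√2)⁻¹) 0 (√2)⁻¹ 0 p := by
    rw [hx, hy, cliffordTorus_eq, cross_torusFrame]; simp
  have hn : ‖torusFrame (-(√2)⁻¹) 0 (√2)⁻¹ 0 p‖ = 1 := by
    have h2 := norm_sq_torusFrame (-(√2)⁻¹) 0 (√2)⁻¹ 0 p
    have h3 : ((√2)⁻¹ : ℝ) ^ 2 = 1 / 2 := by rw [inv_pow, Real.sq_sqrt (by norm_num)]; norm_num
    rw [neg_sq, h3] at h2
    norm_num at h2
    exact h2.resolve_right (by linarith [norm_nonneg (torusFrame (-(√2)⁻¹) 0 (√2)⁻¹ 0 p)])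
  rw [unitNormal, hc, hn, inv_one, one_smul]

lemma normalVariation_cliffordTorus (v : ℝ × ℝ → ℝ) :
    normalVariation cliffordTorus v = cliffordGraph v := by
  ext1 p
  rw [normalVariation, unitNormal_cliffordTorus, cliffordTorus_eq, cliffordGraph,
    torusFrame_smul, torusFrame_smul, torusFrame_add, Real.cos_add, Real.sin_add,
    Real.cos_pi_div_four, Real.sin_pi_div_four, inv_sqrt_two]
  congr 1 <;> ring

section Polynomials

variable {R : Type*} [CommRing R]

/-- The coefficient `E` of the first fundamental form of a graph, where `s = sin 2v`. -/
def fundE (s vx : R) : R := 1 - s + vx ^ 2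

/-- The coefficient `F` of the first fundamental form of a graph. -/
def fundF (vx vy : R) : R := vx * vy

/-- The coefficient `G` of the first fundamental form of a graph, where `s = sin 2v`. -/
def fundG (s vy : R) : R := 1 + s + vy ^ 2

/-- The determinant `EG - F²` of the first fundamental form of a graph, where `s = sin 2v`. -/
def fundDet (s vx vy : R) : R := 1 - s ^ 2 + (1 + s) * vx ^ 2 + (1 - s) * vy ^ 2

/-- The numerator `G L - 2 F M + E N` of the mean curvature of a graph, the second fundamental form
being taken with respect to the normal of length `√(EG - F²)`; here `s = sin 2v`, `c = cos 2v`. -/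
def curvNum (s c vx vy vxx vxy vyy : R) : R :=
  fundG s vy * ((vxx + c) * c + 2 * (1 + s) * vx ^ 2)
    - 2 * fundF vx vy * (c * vxy + 2 * s * vx * vy)
    + fundE s vx * ((vyy - c) * c - 2 * (1 - s) * vy ^ 2)

end Polynomials

lemma pdx_cos {v : ℝ × ℝ → ℝ} {p : ℝ × ℝ} (hv : DifferentiableAt ℝ v p) :
    pdx (fun q => cos (π / 4 + v q)) p = -(sin (π / 4 + v p) * pdx v p) := by
  rw [pdx, (hv.hasFDerivAt.const_add (π / 4)).cos.fderiv]; simp [pdx]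

lemma pdy_cos {v : ℝ × ℝ → ℝ} {p : ℝ × ℝ} (hv : DifferentiableAt ℝ v p) :
    pdy (fun q => cos (π / 4 + v q)) p = -(sin (π / 4 + v p) * pdy v p) := by
  rw [pdy, (hv.hasFDerivAt.const_add (π / 4)).cos.fderiv]; simp [pdy]

lemma pdx_sin {v : ℝ × ℝ → ℝ} {p : ℝ × ℝ} (hv : DifferentiableAt ℝ v p) :
    pdx (fun q => sin (π / 4 + v q)) p = cos (π / 4 + v p) * pdx v p := by
  rw [pdx, (hv.hasFDerivAt.const_add (π / 4)).sin.fderiv]; simp [pdx]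

lemma pdy_sin {v : ℝ × ℝ → ℝ} {p : ℝ × ℝ} (hv : DifferentiableAt ℝ v p) :
    pdy (fun q => sin (π / 4 + v q)) p = cos (π / 4 + v p) * pdy v p := by
  rw [pdy, (hv.hasFDerivAt.const_add (π / 4)).sin.fderiv]; simp [pdy]

lemma pdx_mul {a b : ℝ × ℝ → ℝ} {p : ℝ × ℝ} (ha : DifferentiableAt ℝ a p)
    (hb : DifferentiableAt ℝ b p) :
    pdx (fun q => a q * b q) p = a p * pdx b p + pdx a p * b p := by
  rw [pdx, fderiv_fun_mul ha hb]; simp [pdx, mul_comm]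

lemma pdy_mul {a b : ℝ × ℝ → ℝ} {p : ℝ × ℝ} (ha : DifferentiableAt ℝ a p)
    (hb : DifferentiableAt ℝ b p) :
    pdy (fun q => a q * b q) p = a p * pdy b p + pdy a p * b p := by
  rw [pdy, fderiv_fun_mul ha hb]; simp [pdy, mul_comm]

lemma pdx_neg {a : ℝ × ℝ → ℝ} {p : ℝ × ℝ} : pdx (fun q => -a q) p = -pdx a p := by
  rw [pdx, fderiv_fun_neg]; simp [pdx]

lemma pdy_neg {a : ℝ × ℝ → ℝ} {p : ℝ × ℝ} : pdy (fun q => -a q) p = -pdy a p := by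
  rw [pdy, fderiv_fun_neg]; simp [pdy]

lemma pdx_const (c : ℝ) (p : ℝ × ℝ) : pdx (fun _ => c) p = 0 := by simp [pdx]

lemma pdy_const (c : ℝ) (p : ℝ × ℝ) : pdy (fun _ => c) p = 0 := by simp [pdy]

namespace IsTorusFunction

variable {v : ℝ × ℝ → ℝ}

lemma dx_cliffordGraph (h : IsTorusFunction v) : dx (cliffordGraph v) = fun p =>
    torusFrame (-(sin (π / 4 + v p) * _root_.pdx v p)) (√2 * cos (π / 4 + v p))
      (cos (π / 4 + v p) * _root_.pdx v p) 0 p := by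
  ext1 p
  have hd := h.differentiable p
  refine (dx_torusFrame (by fun_prop) (by fun_prop) (by fun_prop) (by fun_prop)).trans ?_
  rw [pdx_cos hd, pdx_sin hd, pdx_const]; simp

lemma dy_cliffordGraph (h : IsTorusFunction v) : dy (cliffordGraph v) = fun p =>
    torusFrame (-(sin (π / 4 + v p) * _root_.pdy v p)) 0
      (cos (π / 4 + v p) * _root_.pdy v p) (√2 * sin (π / 4 + v p)) p := by
  ext1 p
  have hd := h.differentiable p
  refine (dy_torusFrame (by fun_prop) (by fun_prop) (by fun_prop) (by fun_prop)).trans ?_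
  rw [pdy_cos hd, pdy_sin hd, pdy_const]; simp

lemma dx_dx_cliffordGraph (h : IsTorusFunction v) (p : ℝ × ℝ) :
    dx (dx (cliffordGraph v)) p = torusFrame
      (-(cos (π / 4 + v p) * (_root_.pdx v p ^ 2 + 2)
        + sin (π / 4 + v p) * _root_.pdx (_root_.pdx v) p))
      (-(2 * √2 * sin (π / 4 + v p) * _root_.pdx v p))
      (cos (π / 4 + v p) * _root_.pdx (_root_.pdx v) p - sin (π / 4 + v p) * _root_.pdx v p ^ 2)
      0 p := by
  have hd := h.differentiable p
  have hdx := h.pdx.differentiable p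
  rw [h.dx_cliffordGraph]
  refine (dx_torusFrame (by fun_prop) (by fun_prop) (by fun_prop) (by fun_prop)).trans ?_
  rw [pdx_neg, pdx_mul (by fun_prop) hdx, pdx_mul (by fun_prop) hdx, pdx_mul (by fun_prop)
    (by fun_prop), pdx_cos hd, pdx_sin hd, pdx_const, pdx_const]
  have h2 : √2 * √2 = 2 := Real.mul_self_sqrt (by norm_num)
  congr 1
  · linear_combination -cos (π / 4 + v p) * h2
  · ring
  · ring

lemma dx_dy_cliffordGraph (h : IsTorusFunction v) (p : ℝ × ℝ) :
    dx (dy (cliffordGraph v)) p = torusFrame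
      (-(cos (π / 4 + v p) * _root_.pdx v p * _root_.pdy v p
        + sin (π / 4 + v p) * _root_.pdx (_root_.pdy v) p))
      (-(√2 * sin (π / 4 + v p) * _root_.pdy v p))
      (cos (π / 4 + v p) * _root_.pdx (_root_.pdy v) p
        - sin (π / 4 + v p) * _root_.pdx v p * _root_.pdy v p)
      (√2 * cos (π / 4 + v p) * _root_.pdx v p) p := by
  have hd := h.differentiable p
  have hdy := h.pdy.differentiable p
  rw [h.dy_cliffordGraph]
  refine (dx_torusFrame (by fun_prop) (by fun_prop) (by fun_prop) (by fun_prop)).trans ?_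
  rw [pdx_neg, pdx_mul (by fun_prop) hdy, pdx_mul (by fun_prop) hdy, pdx_mul (by fun_prop)
    (by fun_prop), pdx_cos hd, pdx_sin hd, pdx_const, pdx_const]
  congr 1 <;> ring

lemma dy_dy_cliffordGraph (h : IsTorusFunction v) (p : ℝ × ℝ) :
    dy (dy (cliffordGraph v)) p = torusFrame
      (-(cos (π / 4 + v p) * _root_.pdy v p ^ 2
        + sin (π / 4 + v p) * _root_.pdy (_root_.pdy v) p))
      0
      (cos (π / 4 + v p) * _root_.pdy (_root_.pdy v) p
        - sin (π / 4 + v p) * (_root_.pdy v p ^ 2 + 2))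
      (2 * √2 * cos (π / 4 + v p) * _root_.pdy v p) p := by
  have hd := h.differentiable p
  have hdy := h.pdy.differentiable p
  rw [h.dy_cliffordGraph]
  refine (dy_torusFrame (by fun_prop) (by fun_prop) (by fun_prop) (by fun_prop)).trans ?_
  rw [pdy_neg, pdy_mul (by fun_prop) hdy, pdy_mul (by fun_prop) hdy, pdy_mul (by fun_prop)
    (by fun_prop), pdy_cos hd, pdy_sin hd, pdy_const, pdy_const]
  have h2 : √2 * √2 = 2 := Real.mul_self_sqrt (by norm_num)
  congr 1
  · ring
  · linear_combination -sin (π / 4 + v p) * h2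
  · ring

end IsTorusFunction

lemma two_mul_cos_sq_quarter (t : ℝ) : 2 * cos (π / 4 + t) ^ 2 = 1 - sin (2 * t) := by
  rw [Real.cos_sq, show 2 * (π / 4 + t) = 2 * t + π / 2 by ring, Real.cos_add_pi_div_two]; ring

lemma two_mul_sin_sq_quarter (t : ℝ) : 2 * sin (π / 4 + t) ^ 2 = 1 + sin (2 * t) := by
  linarith [two_mul_cos_sq_quarter t, Real.sin_sq_add_cos_sq (π / 4 + t)]

lemma two_mul_sin_mul_cos_quarter (t : ℝ) :
    2 * sin (π / 4 + t) * cos (π / 4 + t) = cos (2 * t) := by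
  rw [← Real.sin_two_mul, show 2 * (π / 4 + t) = 2 * t + π / 2 by ring, Real.sin_add_pi_div_two]

namespace IsTorusFunction

variable {v : ℝ × ℝ → ℝ}

lemma inner_dx_dx (h : IsTorusFunction v) (p : ℝ × ℝ) :
    inner ℝ (dx (cliffordGraph v) p) (dx (cliffordGraph v) p)
      = fundE (sin (2 * v p)) (_root_.pdx v p) := by
  simp only [h.dx_cliffordGraph]
  rw [inner_torusFrame, fundE, ← two_mul_cos_sq_quarter]
  have h2 : √2 * √2 = 2 := Real.mul_self_sqrt (by norm_num)
  linear_combination (_root_.pdx v p ^ 2) * Real.sin_sq_add_cos_sq (π / 4 + v p)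
    + cos (π / 4 + v p) ^ 2 * h2

lemma inner_dx_dy (h : IsTorusFunction v) (p : ℝ × ℝ) :
    inner ℝ (dx (cliffordGraph v) p) (dy (cliffordGraph v) p)
      = fundF (_root_.pdx v p) (_root_.pdy v p) := by
  simp only [h.dx_cliffordGraph, h.dy_cliffordGraph]
  rw [inner_torusFrame, fundF]
  linear_combination (_root_.pdx v p * _root_.pdy v p) * Real.sin_sq_add_cos_sq (π / 4 + v p)

lemma inner_dy_dy (h : IsTorusFunction v) (p : ℝ × ℝ) :
    inner ℝ (dy (cliffordGraph v) p) (dy (cliffordGraph v) p)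
      = fundG (sin (2 * v p)) (_root_.pdy v p) := by
  simp only [h.dy_cliffordGraph]
  rw [inner_torusFrame, fundG, ← two_mul_sin_sq_quarter]
  have h2 : √2 * √2 = 2 := Real.mul_self_sqrt (by norm_num)
  linear_combination (_root_.pdy v p ^ 2) * Real.sin_sq_add_cos_sq (π / 4 + v p)
    + sin (π / 4 + v p) ^ 2 * h2

lemma gramDet_cliffordGraph (h : IsTorusFunction v) (p : ℝ × ℝ) :
    gramDet (cliffordGraph v) p
      = fundDet (sin (2 * v p)) (_root_.pdx v p) (_root_.pdy v p) := by
  rw [gramDet, h.inner_dx_dx, h.inner_dx_dy, h.inner_dy_dy, fundE, fundF, fundG, fundDet]; ring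

lemma cross_cliffordGraph (h : IsTorusFunction v) (p : ℝ × ℝ) :
    cross (cliffordGraph v p) (dx (cliffordGraph v) p) (dy (cliffordGraph v) p)
      = torusFrame (-(cos (2 * v p) * sin (π / 4 + v p))) (-(√2 * sin (π / 4 + v p) * _root_.pdx v p))
        (cos (2 * v p) * cos (π / 4 + v p)) (-(√2 * cos (π / 4 + v p) * _root_.pdy v p)) p := by
  simp only [h.dx_cliffordGraph, h.dy_cliffordGraph]
  rw [cliffordGraph, cross_torusFrame, ← two_mul_sin_mul_cos_quarter]
  have h2 : √2 * √2 = 2 := Real.mul_self_sqrt (by norm_num)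
  have hs := Real.sin_sq_add_cos_sq (π / 4 + v p)
  set S := sin (π / 4 + v p)
  set C := cos (π / 4 + v p)
  congr 1
  · linear_combination -C * S ^ 2 * h2
  · linear_combination -√2 * S * _root_.pdx v p * hs
  · linear_combination C ^ 2 * S * h2
  · linear_combination -√2 * C * _root_.pdy v p * hs

lemma norm_cross_cliffordGraph (h : IsTorusFunction v) (p : ℝ × ℝ) :
    ‖cross (cliffordGraph v p) (dx (cliffordGraph v) p) (dy (cliffordGraph v) p)‖
      = √(fundDet (sin (2 * v p)) (_root_.pdx v p) (_root_.pdy v p)) := by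
  rw [← Real.sqrt_sq (norm_nonneg _), h.cross_cliffordGraph, norm_sq_torusFrame, fundDet]
  congr 1
  have h2 : √2 ^ 2 = 2 := Real.sq_sqrt (by norm_num)
  linear_combination (cos (2 * v p)) ^ 2 * Real.sin_sq_add_cos_sq (π / 4 + v p)
    + Real.sin_sq_add_cos_sq (2 * v p)
    + _root_.pdx v p ^ 2 * two_mul_sin_sq_quarter (v p)
    + _root_.pdy v p ^ 2 * two_mul_cos_sq_quarter (v p)
    + (sin (π / 4 + v p) ^ 2 * _root_.pdx v p ^ 2 + cos (π / 4 + v p) ^ 2 * _root_.pdy v p ^ 2) * h2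

/-- The integrand of the Willmore energy of a graph. -/
lemma meanCurvature_sq_mul_sqrt (h : IsTorusFunction v) (p : ℝ × ℝ)
    (hD : 0 < fundDet (sin (2 * v p)) (_root_.pdx v p) (_root_.pdy v p)) :
    meanCurvature (cliffordGraph v) p ^ 2
      = curvNum (sin (2 * v p)) (cos (2 * v p)) (_root_.pdx v p) (_root_.pdy v p)
          (_root_.pdx (_root_.pdx v) p) (_root_.pdx (_root_.pdy v) p) (_root_.pdy (_root_.pdy v) p) ^ 2
        / (4 * fundDet (sin (2 * v p)) (_root_.pdx v p) (_root_.pdy v p) ^ 3) := by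
  have hn : unitNormal (cliffordGraph v) p
      = (√(fundDet (sin (2 * v p)) (_root_.pdx v p) (_root_.pdy v p)))⁻¹ •
        torusFrame (-(cos (2 * v p) * sin (π / 4 + v p))) (-(√2 * sin (π / 4 + v p) * _root_.pdx v p))
        (cos (2 * v p) * cos (π / 4 + v p)) (-(√2 * cos (π / 4 + v p) * _root_.pdy v p)) p := by
    rw [unitNormal, h.norm_cross_cliffordGraph, h.cross_cliffordGraph]
  have hnum : meanCurvature (cliffordGraph v) p
      = (√(fundDet (sin (2 * v p)) (_root_.pdx v p) (_root_.pdy v p)))⁻¹ *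
        curvNum (sin (2 * v p)) (cos (2 * v p)) (_root_.pdx v p) (_root_.pdy v p)
          (_root_.pdx (_root_.pdx v) p) (_root_.pdx (_root_.pdy v) p) (_root_.pdy (_root_.pdy v) p)
        / (2 * fundDet (sin (2 * v p)) (_root_.pdx v p) (_root_.pdy v p)) := by
    rw [meanCurvature, h.inner_dx_dx, h.inner_dx_dy, h.inner_dy_dy, h.gramDet_cliffordGraph, hn,
      h.dx_dx_cliffordGraph, h.dx_dy_cliffordGraph, h.dy_dy_cliffordGraph]
    simp only [inner_smul_right, inner_torusFrame]
    congr 1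
    rw [curvNum]
    have h2 : √2 ^ 2 = 2 := Real.sq_sqrt (by norm_num)
    have hs := Real.sin_sq_add_cos_sq (π / 4 + v p)
    have k1 := two_mul_sin_sq_quarter (v p)
    have k2 := two_mul_cos_sq_quarter (v p)
    have k3 := two_mul_sin_mul_cos_quarter (v p)
    generalize fundG (sin (2 * v p)) (_root_.pdy v p) = G
    generalize fundE (sin (2 * v p)) (_root_.pdx v p) = E
    generalize fundF (_root_.pdx v p) (_root_.pdy v p) = F
    generalize (√(fundDet (sin (2 * v p)) (_root_.pdx v p) (_root_.pdy v p)))⁻¹ = r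
    generalize sin (π / 4 + v p) = S at *
    generalize cos (π / 4 + v p) = C at *
    generalize sin (2 * v p) = s at *
    generalize cos (2 * v p) = c at *
    generalize _root_.pdx v p = x
    generalize _root_.pdy v p = y
    generalize _root_.pdx (_root_.pdx v) p = xx
    generalize _root_.pdx (_root_.pdy v) p = xy
    generalize _root_.pdy (_root_.pdy v) p = yy
    linear_combination r * G * (c * xx * hs + c * k3 + 2 * x ^ 2 * k1 + 2 * S ^ 2 * x ^ 2 * h2)
      - 2 * r * F * (c * xy * hs + (k1 - k2) * x * y + (S ^ 2 - C ^ 2) * x * y * h2)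
      + r * E * (c * yy * hs - c * k3 - 2 * y ^ 2 * k2 - 2 * C ^ 2 * y ^ 2 * h2)
  rw [hnum, div_pow, mul_pow, inv_pow, Real.sq_sqrt hD.le]
  field_simp
  ring

lemma norm_sq_fderiv_cliffordGraph (h : IsTorusFunction v) (p w : ℝ × ℝ) :
    ‖fderiv ℝ (cliffordGraph v) p w‖ ^ 2
      = fundE (sin (2 * v p)) (_root_.pdx v p) * w.1 ^ 2
        + 2 * fundF (_root_.pdx v p) (_root_.pdy v p) * w.1 * w.2
        + fundG (sin (2 * v p)) (_root_.pdy v p) * w.2 ^ 2 := by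
  have hw : fderiv ℝ (cliffordGraph v) p w
      = w.1 • dx (cliffordGraph v) p + w.2 • dy (cliffordGraph v) p := by
    have : w = w.1 • ((1 : ℝ), (0 : ℝ)) + w.2 • ((0 : ℝ), (1 : ℝ)) := by ext <;> simp
    conv_lhs => rw [this, map_add, map_smul, map_smul]
    rfl
  rw [hw, ← real_inner_self_eq_norm_sq, inner_add_left, inner_add_right, inner_add_right]
  simp only [inner_smul_left, inner_smul_right, h.inner_dx_dx, h.inner_dx_dy, h.inner_dy_dy,
    real_inner_comm (dx (cliffordGraph v) p) (dy (cliffordGraph v) p)]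
  simp
  ring

/-- Graphs of small functions over the Clifford torus are immersed. -/
lemma isTorusImmersion_cliffordGraph (h : IsTorusFunction v)
    (hE : ∀ p, 0 < fundE (sin (2 * v p)) (_root_.pdx v p))
    (hD : ∀ p, 0 < fundDet (sin (2 * v p)) (_root_.pdx v p) (_root_.pdy v p)) :
    IsTorusImmersion (cliffordGraph v) where
  smooth := by
    have hv : ContDiff ℝ ∞ v := h.1
    rw [contDiff_euclidean]
    intro i
    fin_cases i <;> simp [cliffordGraph, torusFrame] <;> fun_prop
  periodic p := by
    have e1 (t : ℝ) : √2 * (t + side) = √2 * t + 2 * π := by rw [mul_add, sqrt_two_mul_side]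
    constructor
    · simp only [cliffordGraph, (h.2 p).1, torusFrame, Prod.fst_add, Prod.snd_add, e1,
        Real.cos_add_two_pi, Real.sin_add_two_pi, add_zero]
    · simp only [cliffordGraph, (h.2 p).2, torusFrame, Prod.fst_add, Prod.snd_add, e1,
        Real.cos_add_two_pi, Real.sin_add_two_pi, add_zero]
  mem_sphere p := by
    have h2 := norm_sq_torusFrame (cos (π / 4 + v p)) 0 (sin (π / 4 + v p)) 0 p
    have h3 : ‖cliffordGraph v p‖ ^ 2 = 1 := by
      rw [cliffordGraph, h2]; linarith [Real.sin_sq_add_cos_sq (π / 4 + v p)]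
    rw [← Real.sqrt_sq (norm_nonneg (cliffordGraph v p)), h3, Real.sqrt_one]
  immersive p := by
    rw [injective_iff_map_eq_zero]
    intro w hw
    have h1 := h.norm_sq_fderiv_cliffordGraph p w
    rw [hw, norm_zero] at h1
    have hE' := hE p
    have hD' := hD p
    set E := fundE (sin (2 * v p)) (_root_.pdx v p) with hEd
    set F := fundF (_root_.pdx v p) (_root_.pdy v p) with hFd
    set G := fundG (sin (2 * v p)) (_root_.pdy v p) with hGd
    set D := fundDet (sin (2 * v p)) (_root_.pdx v p) (_root_.pdy v p) with hDd
    have hDe : D = E * G - F ^ 2 := by rw [hEd, hFd, hGd, hDd, fundE, fundF, fundG, fundDet]; ring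
    -- completing the square: `E (E a² + 2 F a b + G b²) = (E a + F b)² + (EG - F²) b²`
    have h2 : (E * w.1 + F * w.2) ^ 2 + D * w.2 ^ 2 = 0 := by
      rw [hDe]; linear_combination -E * h1
    have h3 : w.2 = 0 := by
      by_contra hne
      have : 0 < D * w.2 ^ 2 := by positivity
      nlinarith [sq_nonneg (E * w.1 + F * w.2)]
    rw [h3] at h2
    have h4 : E * w.1 = 0 := by nlinarith
    exact Prod.ext ((mul_eq_zero.mp h4).resolve_left hE'.ne') h3

end IsTorusFunction
end


noncomputable section

/-! ### Smooth maps on the Wiener algebra -/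

/-- A version of the implicit function theorem for an equation `Φ (x, a) = 0` whose linearization
at the origin in the second variable is a nonzero multiple of the identity. -/
lemma exists_implicit_of_scalar_derivative {E A : Type*} [NormedAddCommGroup E] [NormedSpace ℝ E]
    [CompleteSpace E] [NormedAddCommGroup A] [NormedSpace ℝ A] [CompleteSpace A]
    {Φ : E × A → A} (hΦ : ContDiffAt ℝ 2 Φ 0) (h0 : Φ 0 = 0) {c : ℝ} (hc : c ≠ 0)
    (hd : HasFDerivAt (fun a => Φ (0, a)) (c • ContinuousLinearMap.id ℝ A) 0) :
    ∃ g : E → A, g 0 = 0 ∧ ContDiffAt ℝ 2 g 0 ∧ ∀ᶠ x in 𝓝 0, Φ (x, g x) = 0 := by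
  have h2 : fderiv ℝ Φ 0 ∘L .inr ℝ E A = c • ContinuousLinearMap.id ℝ A := by
    have h3 : HasFDerivAt Φ (fderiv ℝ Φ 0) ((0 : E), (0 : A)) :=
      (hΦ.differentiableAt two_ne_zero).hasFDerivAt
    have h4 : HasFDerivAt (fun a : A => ((0 : E), a)) (.inr ℝ E A) 0 :=
      (ContinuousLinearMap.inr ℝ E A).hasFDerivAt
    exact (h3.comp (0 : A) h4).unique hd
  have hinv : (fderiv ℝ Φ 0 ∘L .inr ℝ E A).IsInvertible := by
    rw [h2]
    exact ⟨ContinuousLinearEquiv.smulLeft (Units.mk0 c hc), by ext; rfl⟩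
  refine ⟨hΦ.implicitFunction two_ne_zero hinv, hΦ.implicitFunction_apply_self two_ne_zero hinv,
    hΦ.contDiffAt_implicitFunction two_ne_zero hinv, ?_⟩
  have := hΦ.eventually_apply_implicitFunction two_ne_zero hinv
  rwa [h0] at this

lemma hasFDerivAt_scalar_add_quadratic {A : Type*} [NormedCommRing A] [NormedAlgebra ℝ A]
    (T : A →L[ℝ] A) (c : ℝ) :
    HasFDerivAt (fun a : A => c • (a + a * T a)) (c • ContinuousLinearMap.id ℝ A) 0 := by
  have h := ((hasFDerivAt_id (𝕜 := ℝ) (0 : A)).add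
    ((hasFDerivAt_id (𝕜 := ℝ) (0 : A)).mul T.hasFDerivAt)).const_smul c
  refine h.congr_fderiv ?_
  ext a
  simp

/-- The difference quotient along a ray. -/
lemma tendsto_inv_smul_ray {E A : Type*} [NormedAddCommGroup E] [NormedSpace ℝ E]
    [NormedAddCommGroup A] [NormedSpace ℝ A] {g : E → A} (h0 : g 0 = 0)
    (hg : DifferentiableAt ℝ g 0) (j : E) :
    Tendsto (fun r : ℝ => r⁻¹ • g (r • j)) (𝓝[≠] 0) (𝓝 (fderiv ℝ g 0 j)) := by
  have h1 : HasDerivAt (fun r : ℝ => r • j) j 0 := by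
    simpa using (hasDerivAt_id (0 : ℝ)).smul_const j
  have hg' : HasFDerivAt g (fderiv ℝ g 0) ((0 : ℝ) • j) := by
    rw [zero_smul]; exact hg.hasFDerivAt
  have h2 := (hg'.comp_hasDerivAt (0 : ℝ) h1).tendsto_slope_zero
  simpa [h0] using h2

lemma tendsto_ray {E A : Type*} [NormedAddCommGroup E] [NormedSpace ℝ E]
    [TopologicalSpace A] {g : E → A} (hg : ContinuousAt g 0) (j : E) :
    Tendsto (fun r : ℝ => g (r • j)) (𝓝[≠] 0) (𝓝 (g 0)) := by
  have h1 : Tendsto (fun r : ℝ => r • j) (𝓝[≠] 0) (𝓝 0) := by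
    have : Continuous fun r : ℝ => r • j := by fun_prop
    simpa using (this.tendsto 0).mono_left nhdsWithin_le_nhds
  exact hg.tendsto.comp h1

namespace Wiener

/-- Evaluation at a point as a ring homomorphism. -/
def evHom (p : ℝ × ℝ) : Wiener →+* ℂ where
  toFun a := a.ev p
  map_one' := ev_one p
  map_mul' a b := ev_mul a b p
  map_zero' := ev_zero p
  map_add' a b := ev_add a b p

@[simp] lemma ev_pow (a : Wiener) (n : ℕ) (p : ℝ × ℝ) : (a ^ n).ev p = a.ev p ^ n :=
  map_pow (evHom p) a n

@[simp] lemma ev_two (p : ℝ × ℝ) : (2 : Wiener).ev p = 2 := map_ofNat (evHom p) 2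

lemma ev_exp (a : Wiener) (p : ℝ × ℝ) : (NormedSpace.exp a).ev p = Complex.exp (a.ev p) := by
  rw [Complex.exp_eq_exp_ℂ]
  exact NormedSpace.map_exp_of_mem_ball (𝕂 := ℂ) (evHom p) (evL p).continuous a
    ((NormedSpace.expSeries_radius_eq_top ℂ Wiener).symm ▸ edist_lt_top _ _)

/-- The function `sin 2a`. -/
def sinTwo (a : Wiener) : Wiener :=
  (2 * Complex.I)⁻¹ • (NormedSpace.exp ((2 * Complex.I) • a) - NormedSpace.exp (-(2 * Complex.I) • a))

/-- The function `cos 2a`. -/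
def cosTwo (a : Wiener) : Wiener :=
  (2 : ℂ)⁻¹ • (NormedSpace.exp ((2 * Complex.I) • a) + NormedSpace.exp (-(2 * Complex.I) • a))

lemma ev_sinTwo {a : Wiener} {p : ℝ × ℝ} {t : ℝ} (h : a.ev p = t) :
    a.sinTwo.ev p = (sin (2 * t) : ℝ) := by
  have e1 : (2 * (t : ℂ)) * Complex.I = 2 * Complex.I * t := by ring
  rw [sinTwo, ev_smul, ev_sub, ev_exp, ev_exp, ev_smul, ev_smul, h, Complex.ofReal_sin,
    Complex.sin]
  push_cast
  rw [e1, neg_mul, neg_mul, e1, mul_inv, Complex.inv_I]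
  ring

lemma ev_cosTwo {a : Wiener} {p : ℝ × ℝ} {t : ℝ} (h : a.ev p = t) :
    a.cosTwo.ev p = (cos (2 * t) : ℝ) := by
  have e1 : (2 * (t : ℂ)) * Complex.I = 2 * Complex.I * t := by ring
  rw [cosTwo, ev_smul, ev_add, ev_exp, ev_exp, ev_smul, ev_smul, h, Complex.ofReal_cos,
    Complex.cos]
  push_cast
  rw [e1, neg_mul, neg_mul, e1]
  ring

lemma contDiff_exp : ContDiff ℝ 2 (NormedSpace.exp : Wiener → Wiener) :=
  contDiff_iff_contDiffAt.mpr fun a => (NormedSpace.exp_analytic (𝕂 := ℝ) a).contDiffAt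

lemma contDiff_sinTwo : ContDiff ℝ 2 sinTwo :=
  ((contDiff_exp.comp (contDiff_const_smul _)).sub
    (contDiff_exp.comp (contDiff_const_smul _))).const_smul _

lemma contDiff_cosTwo : ContDiff ℝ 2 cosTwo :=
  ((contDiff_exp.comp (contDiff_const_smul _)).add
    (contDiff_exp.comp (contDiff_const_smul _))).const_smul _

@[simp] lemma sinTwo_zero : sinTwo 0 = 0 := by simp [sinTwo]

@[simp] lemma cosTwo_zero : cosTwo 0 = 1 := by
  simp only [cosTwo, smul_zero, NormedSpace.exp_zero]
  refine eq_of_ev_eq fun p => ?_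
  simp; norm_num

lemma fderiv_sinTwo_zero (a : Wiener) : fderiv ℝ sinTwo 0 a = (2 : ℝ) • a := by
  have hexp (c : ℂ) : HasFDerivAt (fun b : Wiener => NormedSpace.exp (c • b))
      (c • ContinuousLinearMap.id ℝ Wiener) 0 := by
    have h1 : HasFDerivAt (fun b : Wiener => c • b) (c • ContinuousLinearMap.id ℝ Wiener) 0 :=
      (hasFDerivAt_id (𝕜 := ℝ) (0 : Wiener)).const_smul c
    have h2 : HasFDerivAt NormedSpace.exp (1 : Wiener →L[ℝ] Wiener) (c • (0 : Wiener)) := by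
      rw [smul_zero]; exact hasFDerivAt_exp_zero
    exact (h2.comp (0 : Wiener) h1).congr_fderiv (by ext; rfl)
  have h := ((hexp (2 * Complex.I)).sub (hexp (-(2 * Complex.I)))).const_smul (2 * Complex.I)⁻¹
  have h' : HasFDerivAt sinTwo _ 0 := h
  rw [h'.fderiv]
  refine eq_of_ev_eq fun p => ?_
  have hI := Complex.I_ne_zero
  simp
  field_simp
  linear_combination (-2 * a.ev p) * Complex.I_sq

end Wiener

open Wiener

/-- The space of `2`-jets `(v, v_x, v_y, v_xx, v_xy, v_yy)` with entries in the Wiener algebra. -/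
abbrev Jet : Type := Fin 6 → Wiener

/-- The determinant of the first fundamental form as a function of the jet. -/
def jetDet (j : Jet) : Wiener := fundDet (sinTwo (j 0)) (j 1) (j 2)

/-- The numerator of the mean curvature as a function of the jet. -/
def jetCurv (j : Jet) : Wiener :=
  curvNum (sinTwo (j 0)) (cosTwo (j 0)) (j 1) (j 2) (j 3) (j 4) (j 5)

/-- The left hand side of the Beltrami equation as a function of the jet and of `∂w/∂z̄`. -/
def jetNull (x : Jet × Wiener) : Wiener :=
  fundG (sinTwo (x.1 0)) (x.1 2) * x.2.mapX ^ 2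
    - 2 * fundF (x.1 1) (x.1 2) * x.2.mapX * x.2.mapY
    + fundE (sinTwo (x.1 0)) (x.1 1) * x.2.mapY ^ 2

/-- The restriction of scalars of the Beurling transform. -/
def beurlingReal : Wiener →L[ℝ] Wiener := beurling.restrictScalars ℝ

@[simp] lemma beurlingReal_apply (a : Wiener) : beurlingReal a = beurling a := rfl

lemma contDiff_jetDet : ContDiff ℝ 2 jetDet := by
  have hs : ContDiff ℝ 2 fun j : Jet => sinTwo (j 0) :=
    contDiff_sinTwo.comp (contDiff_apply ℝ Wiener 0)
  unfold jetDet fundDet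
  fun_prop

lemma contDiff_jetCurv : ContDiff ℝ 2 jetCurv := by
  have hs : ContDiff ℝ 2 fun j : Jet => sinTwo (j 0) :=
    contDiff_sinTwo.comp (contDiff_apply ℝ Wiener 0)
  have hc : ContDiff ℝ 2 fun j : Jet => cosTwo (j 0) :=
    contDiff_cosTwo.comp (contDiff_apply ℝ Wiener 0)
  unfold jetCurv curvNum fundE fundF fundG
  fun_prop

lemma contDiff_jetNull : ContDiff ℝ 2 jetNull := by
  have hs : ContDiff ℝ 2 fun x : Jet × Wiener => sinTwo (x.1 0) :=
    contDiff_sinTwo.comp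
      ((contDiff_apply ℝ Wiener 0).comp contDiff_fst)
  have hj (i : Fin 6) : ContDiff ℝ 2 fun x : Jet × Wiener => x.1 i :=
    (contDiff_apply ℝ Wiener i).comp contDiff_fst
  have hb : ContDiff ℝ 2 fun x : Jet × Wiener => beurling x.2 :=
    beurlingReal.contDiff.comp contDiff_snd
  have hX : ContDiff ℝ 2 fun x : Jet × Wiener => x.2.mapX :=
    (contDiff_const.add hb).add contDiff_snd
  have hY : ContDiff ℝ 2 fun x : Jet × Wiener => x.2.mapY :=
    ((contDiff_const.add hb).sub contDiff_snd).const_smul Complex.I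
  unfold jetNull fundE fundF fundG
  fun_prop

lemma jetNull_eq (j : Jet) (b : Wiener) :
    jetNull (j, b) = (4 : ℝ) • (b + b * beurling b)
      + sinTwo (j 0) * (2 * (1 + beurling b) ^ 2 + 2 * b ^ 2)
      + (j 2 * b.mapX - j 1 * b.mapY) ^ 2 := by
  refine eq_of_ev_eq fun p => ?_
  simp only [jetNull, fundE, fundF, fundG, mapX, mapY, ev_add, ev_sub, ev_mul, ev_pow, ev_two,
    ev_one, ev_smul, ev_real_smul]
  push_cast
  linear_combination ((1 + (beurling b).ev p - b.ev p) ^ 2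
    * (1 - (sinTwo (j 0)).ev p)) * Complex.I_sq

/-- The inverse square root of `EG - F²`, as `1 + δ`. -/
lemma exists_invSqrt : ∃ δ : Jet → Wiener, δ 0 = 0 ∧ ContDiffAt ℝ 2 δ 0 ∧
    ∀ᶠ j in 𝓝 0, (1 + δ j) ^ 2 * jetDet j = 1 := by
  have hdet0 : jetDet 0 = 1 := by simp [jetDet, fundDet]
  have hc : ContDiff ℝ 2 fun x : Jet × Wiener => (1 + x.2) ^ 2 * jetDet x.1 - 1 := by
    have := contDiff_jetDet.comp (contDiff_fst (E := Jet) (F := Wiener))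
    have h2 : ContDiff ℝ 2 fun x : Jet × Wiener => jetDet x.1 := this
    fun_prop
  obtain ⟨g, hg0, hg, he⟩ := exists_implicit_of_scalar_derivative (c := 2)
    hc.contDiffAt (by simp [hdet0]) two_ne_zero (by
      refine (hasFDerivAt_scalar_add_quadratic ((1 / 2 : ℝ) • ContinuousLinearMap.id ℝ Wiener)
        2).congr_of_eventuallyEq (Eventually.of_forall fun a => ?_)
      refine eq_of_ev_eq fun p => ?_
      simp [hdet0]; ring)
  exact ⟨g, hg0, hg, he.mono fun j hj => sub_eq_zero.mp hj⟩

/-- Solvability of the Beltrami equation for small jets. -/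
lemma exists_beltrami : ∃ b : Jet → Wiener, b 0 = 0 ∧ ContDiffAt ℝ 2 b 0 ∧
    ∀ᶠ j in 𝓝 0, jetNull (j, b j) = 0 := by
  refine exists_implicit_of_scalar_derivative (c := 4) contDiff_jetNull.contDiffAt ?_ (by norm_num)
    ?_
  · rw [show (0 : Jet × Wiener) = (0, 0) from rfl, jetNull_eq]; simp
  · refine (hasFDerivAt_scalar_add_quadratic beurlingReal 4).congr_of_eventuallyEq
      (Eventually.of_forall fun a => ?_)
    simp [jetNull_eq]

/-! ### Second order expansions -/

lemma tendsto_sinTwo_ray (j : Jet) :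
    Tendsto (fun r : ℝ => r⁻¹ • sinTwo ((r • j) 0)) (𝓝[≠] 0) (𝓝 ((2 : ℝ) • j 0)) := by
  rw [← fderiv_sinTwo_zero]
  exact tendsto_inv_smul_ray sinTwo_zero
    (contDiff_sinTwo.differentiable two_ne_zero).differentiableAt (j 0)

lemma tendsto_id_zero : Tendsto (fun r : ℝ => (r : ℝ)) (𝓝[≠] 0) (𝓝 0) :=
  tendsto_id.mono_left nhdsWithin_le_nhds

lemma tendsto_jetDet_ray (j : Jet) :
    Tendsto (fun r : ℝ => (r⁻¹) ^ 2 • (jetDet (r • j) - 1)) (𝓝[≠] 0)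
      (𝓝 (-(4 : ℝ) • j 0 ^ 2 + j 1 ^ 2 + j 2 ^ 2)) := by
  have hs := tendsto_sinTwo_ray j
  have hs0 : Tendsto (fun r : ℝ => sinTwo ((r • j) 0)) (𝓝[≠] 0) (𝓝 0) := by
    have := tendsto_ray contDiff_sinTwo.continuous.continuousAt (j 0)
    rwa [sinTwo_zero] at this
  have h1 := ((hs.mul hs).neg.add ((tendsto_const_nhds (x := (1 : Wiener)).add hs0).mul
    (tendsto_const_nhds (x := j 1 ^ 2)))).add ((tendsto_const_nhds (x := (1 : Wiener)).sub hs0).mul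
    (tendsto_const_nhds (x := j 2 ^ 2)))
  have h2 : -((2 : ℝ) • j 0 * (2 : ℝ) • j 0) + (1 + 0) * j 1 ^ 2 + (1 - 0) * j 2 ^ 2
      = -(4 : ℝ) • j 0 ^ 2 + j 1 ^ 2 + j 2 ^ 2 := by
    refine eq_of_ev_eq fun p => ?_
    simp; ring
  rw [h2] at h1
  refine h1.congr' ?_
  filter_upwards [self_mem_nhdsWithin] with r hr
  have hr' : (r : ℂ) ≠ 0 := by exact_mod_cast hr
  refine eq_of_ev_eq fun p => ?_
  simp only [jetDet, fundDet, Pi.smul_apply, ev_add, ev_neg, ev_sub, ev_mul, ev_pow, ev_real_smul,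
    ev_one]
  push_cast
  field_simp
  ring

lemma tendsto_jetCurv_ray (j : Jet) :
    Tendsto (fun r : ℝ => r⁻¹ • jetCurv (r • j)) (𝓝[≠] 0)
      (𝓝 ((4 : ℝ) • j 0 + j 3 + j 5)) := by
  have hs := tendsto_sinTwo_ray j
  have hs0 : Tendsto (fun r : ℝ => sinTwo ((r • j) 0)) (𝓝[≠] 0) (𝓝 0) := by
    have := tendsto_ray contDiff_sinTwo.continuous.continuousAt (j 0)
    rwa [sinTwo_zero] at this
  have hc0 : Tendsto (fun r : ℝ => cosTwo ((r • j) 0)) (𝓝[≠] 0) (𝓝 1) := by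
    have := tendsto_ray contDiff_cosTwo.continuous.continuousAt (j 0)
    rwa [cosTwo_zero] at this
  have hr := tendsto_id_zero
  have key : Tendsto (fun r : ℝ =>
      ((2 : ℝ) • (r⁻¹ • sinTwo ((r • j) 0)) + r • (j 2 ^ 2 - j 1 ^ 2)) * cosTwo ((r • j) 0) ^ 2
      + fundG (sinTwo ((r • j) 0)) (r • j 2)
        * (j 3 * cosTwo ((r • j) 0) + r • (2 * (1 + sinTwo ((r • j) 0)) * j 1 ^ 2))
      - r • (2 * (j 1 * j 2) * (r • (cosTwo ((r • j) 0) * j 4)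
        + r • (2 * sinTwo ((r • j) 0) * j 1 * r • j 2)))
      + fundE (sinTwo ((r • j) 0)) (r • j 1)
        * (j 5 * cosTwo ((r • j) 0) - r • (2 * (1 - sinTwo ((r • j) 0)) * j 2 ^ 2)))
      (𝓝[≠] 0)
      (𝓝 (((2 : ℝ) • ((2 : ℝ) • j 0) + (0 : ℝ) • (j 2 ^ 2 - j 1 ^ 2)) * 1 ^ 2
      + (1 + 0 + ((0 : ℝ) • j 2) ^ 2)
        * (j 3 * 1 + (0 : ℝ) • (2 * (1 + 0) * j 1 ^ 2))
      - (0 : ℝ) • (2 * (j 1 * j 2) * ((0 : ℝ) • (1 * j 4)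
        + (0 : ℝ) • (2 * 0 * j 1 * (0 : ℝ) • j 2)))
      + (1 - 0 + ((0 : ℝ) • j 1) ^ 2)
        * (j 5 * 1 - (0 : ℝ) • (2 * (1 - 0) * j 2 ^ 2)))) := by
    unfold fundE fundG
    have c {x : Wiener} : Tendsto (fun _ : ℝ => x) (𝓝[≠] 0) (𝓝 x) := tendsto_const_nhds
    refine ((((hs.const_smul _).add (hr.smul c)).mul (hc0.pow 2)).add
      (((c.add hs0).add ((hr.smul c).pow 2)).mul ((c.mul hc0).add
        (hr.smul ((c.mul (c.add hs0)).mul c))))).sub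
      (hr.smul (c.mul ((hr.smul (hc0.mul c)).add
        (hr.smul (((c.mul hs0).mul c).mul (hr.smul c)))))) |>.add
      (((c.sub hs0).add ((hr.smul c).pow 2)).mul ((c.mul hc0).sub
        (hr.smul ((c.mul (c.sub hs0)).mul c))))
  have h2 : ((2 : ℝ) • ((2 : ℝ) • j 0) + (0 : ℝ) • (j 2 ^ 2 - j 1 ^ 2)) * 1 ^ 2
      + (1 + 0 + ((0 : ℝ) • j 2) ^ 2)
        * (j 3 * 1 + (0 : ℝ) • (2 * (1 + 0) * j 1 ^ 2))
      - (0 : ℝ) • (2 * (j 1 * j 2) * ((0 : ℝ) • (1 * j 4)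
        + (0 : ℝ) • (2 * 0 * j 1 * (0 : ℝ) • j 2)))
      + (1 - 0 + ((0 : ℝ) • j 1) ^ 2)
        * (j 5 * 1 - (0 : ℝ) • (2 * (1 - 0) * j 2 ^ 2))
      = (4 : ℝ) • j 0 + j 3 + j 5 := by
    refine eq_of_ev_eq fun p => ?_
    simp; ring
  rw [h2] at key
  -- `key` is `jetCurv (r • j) / r` with the factors `r` sorted so that each limit is evident
  refine key.congr' ?_
  filter_upwards [self_mem_nhdsWithin] with r hr
  have hr' : (r : ℂ) ≠ 0 := by exact_mod_cast hr
  refine eq_of_ev_eq fun p => ?_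
  simp only [jetCurv, curvNum, fundE, fundF, fundG, Pi.smul_apply, ev_add, ev_sub, ev_mul, ev_pow,
    ev_real_smul, ev_one, ev_two]
  push_cast
  field_simp
  ring

lemma tendsto_invSqrt_ray {δ : Jet → Wiener} (h0 : δ 0 = 0) (hδ : ContDiffAt ℝ 2 δ 0)
    (he : ∀ᶠ j in 𝓝 0, (1 + δ j) ^ 2 * jetDet j = 1) (j : Jet) :
    Tendsto (fun r : ℝ => (r⁻¹) ^ 2 • δ (r • j)) (𝓝[≠] 0)
      (𝓝 (-(1 / 2 : ℝ) • (-(4 : ℝ) • j 0 ^ 2 + j 1 ^ 2 + j 2 ^ 2))) := by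
  have hD := tendsto_jetDet_ray j
  have h1 := tendsto_inv_smul_ray h0 (hδ.differentiableAt two_ne_zero) j
  have hz : Tendsto (fun r : ℝ => δ (r • j)) (𝓝[≠] 0) (𝓝 0) := by
    have := tendsto_ray hδ.continuousAt j
    rwa [h0] at this
  have he' : ∀ᶠ r : ℝ in 𝓝[≠] 0, (1 + δ (r • j)) ^ 2 * jetDet (r • j) = 1 := by
    have : Tendsto (fun r : ℝ => r • j) (𝓝[≠] 0) (𝓝 0) := by
      simpa using tendsto_ray (continuousAt_id (X := Jet) (x := 0)) j
    exact this.eventually he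
  have c {x : Wiener} : Tendsto (fun _ : ℝ => x) (𝓝[≠] 0) (𝓝 x) := tendsto_const_nhds
  have hU := (c (x := 1)).add hz
  -- the first order term of `δ` vanishes
  have hfirst : fderiv ℝ δ 0 j = 0 := by
    have h2 := ((hz.mul h1).add ((hU.pow 2).mul (tendsto_id_zero.smul hD))).const_smul
      (-(1 / 2) : ℝ)
    simp only [zero_mul, zero_smul, mul_zero, add_zero, smul_zero] at h2
    refine tendsto_nhds_unique (h1.congr' ?_) h2
    filter_upwards [he', self_mem_nhdsWithin] with r hr hr0
    have hr' : (r : ℂ) ≠ 0 := by exact_mod_cast hr0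
    refine eq_of_ev_eq fun p => ?_
    have e := congrArg (fun a => a.ev p) hr
    simp only [ev_add, ev_mul, ev_pow, ev_one] at e
    simp only [ev_add, ev_sub, ev_mul, ev_pow, ev_real_smul, ev_one]
    push_cast
    field_simp
    linear_combination e
  rw [hfirst] at h1
  have h2 := ((h1.mul h1).add ((hU.pow 2).mul hD)).const_smul (-(1 / 2) : ℝ)
  simp only [mul_zero, zero_add, add_zero, one_pow, one_mul] at h2
  refine h2.congr' ?_
  filter_upwards [he', self_mem_nhdsWithin] with r hr hr0
  have hr' : (r : ℂ) ≠ 0 := by exact_mod_cast hr0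
  refine eq_of_ev_eq fun p => ?_
  have e := congrArg (fun a => a.ev p) hr
  simp only [ev_add, ev_mul, ev_pow, ev_one] at e
  simp only [ev_add, ev_sub, ev_mul, ev_pow, ev_real_smul, ev_one]
  push_cast
  field_simp
  linear_combination -e

/-- The integrand of the Willmore energy, where `1 + δ` is the inverse square root of `EG - F²`. -/
def willmoreDensity (δ : Jet → Wiener) (j : Jet) : Wiener :=
  (1 / 4 : ℝ) • (jetCurv j ^ 2 * (1 + δ j) ^ 5) + jetDet j * (1 + δ j)

lemma willmoreDensity_zero {δ : Jet → Wiener} (h0 : δ 0 = 0) : willmoreDensity δ 0 = 1 := by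
  simp [willmoreDensity, h0, jetCurv, curvNum, jetDet, fundDet, fundE, fundG, fundF]

lemma tendsto_willmoreDensity_ray {δ : Jet → Wiener} (h0 : δ 0 = 0) (hδ : ContDiffAt ℝ 2 δ 0)
    (he : ∀ᶠ j in 𝓝 0, (1 + δ j) ^ 2 * jetDet j = 1) (j : Jet) :
    Tendsto (fun r : ℝ => (r⁻¹) ^ 2 • (willmoreDensity δ (r • j) - 1)) (𝓝[≠] 0)
      (𝓝 ((1 / 4 : ℝ) • ((4 : ℝ) • j 0 + j 3 + j 5) ^ 2
        + (1 / 2 : ℝ) • (-(4 : ℝ) • j 0 ^ 2 + j 1 ^ 2 + j 2 ^ 2))) := by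
  have hD := tendsto_jetDet_ray j
  have hN := tendsto_jetCurv_ray j
  have hδ2 := tendsto_invSqrt_ray h0 hδ he j
  have hz : Tendsto (fun r : ℝ => δ (r • j)) (𝓝[≠] 0) (𝓝 0) := by
    have := tendsto_ray hδ.continuousAt j
    rwa [h0] at this
  have c {x : Wiener} : Tendsto (fun _ : ℝ => x) (𝓝[≠] 0) (𝓝 x) := tendsto_const_nhds
  have hU := (c (x := 1)).add hz
  have h := ((((hN.pow 2).mul (hU.pow 5)).const_smul (1 / 4 : ℝ)).add (hD.mul hU)).add hδ2
  have e : (1 / 4 : ℝ) • (((4 : ℝ) • j 0 + j 3 + j 5) ^ 2 * (1 + 0) ^ 5)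
      + (-(4 : ℝ) • j 0 ^ 2 + j 1 ^ 2 + j 2 ^ 2) * (1 + 0)
      + -(1 / 2 : ℝ) • (-(4 : ℝ) • j 0 ^ 2 + j 1 ^ 2 + j 2 ^ 2)
      = (1 / 4 : ℝ) • ((4 : ℝ) • j 0 + j 3 + j 5) ^ 2
        + (1 / 2 : ℝ) • (-(4 : ℝ) • j 0 ^ 2 + j 1 ^ 2 + j 2 ^ 2) := by
    refine eq_of_ev_eq fun p => ?_
    simp; ring
  rw [e] at h
  refine h.congr' ?_
  filter_upwards [self_mem_nhdsWithin] with r hr0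
  have hr' : (r : ℂ) ≠ 0 := by exact_mod_cast hr0
  refine eq_of_ev_eq fun p => ?_
  simp only [willmoreDensity, ev_add, ev_sub, ev_mul, ev_pow, ev_real_smul, ev_one]
  push_cast
  field_simp
  ring

/-- The second order expansion of the solution of the Beltrami equation. -/
lemma tendsto_beltrami_ray {b : Jet → Wiener} (h0 : b 0 = 0) (hb : ContDiffAt ℝ 2 b 0)
    (he : ∀ᶠ j in 𝓝 0, jetNull (j, b j) = 0) (j : Jet) :
    Tendsto (fun r : ℝ => (r⁻¹) ^ 2 • ((4 : ℝ) • b (r • j) + (2 : ℝ) • sinTwo ((r • j) 0)))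
      (𝓝[≠] 0) (𝓝 ((4 : ℝ) • (j 0 * beurling (j 0)) + (j 1 + Complex.I • j 2) ^ 2)) := by
  have h1 := tendsto_inv_smul_ray h0 (hb.differentiableAt two_ne_zero) j
  set b1 := fderiv ℝ b 0 j with hb1
  have hz : Tendsto (fun r : ℝ => b (r • j)) (𝓝[≠] 0) (𝓝 0) := by
    have := tendsto_ray hb.continuousAt j
    rwa [h0] at this
  have hSz : Tendsto (fun r : ℝ => beurling (b (r • j))) (𝓝[≠] 0) (𝓝 0) := by
    have := (beurling.continuous.tendsto 0).comp hz
    rwa [map_zero] at this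
  have hS1 : Tendsto (fun r : ℝ => r⁻¹ • beurling (b (r • j))) (𝓝[≠] 0) (𝓝 (beurling b1)) := by
    refine ((beurling.continuous.tendsto b1).comp h1).congr fun r => ?_
    exact map_smul beurlingReal r⁻¹ (b (r • j))
  have hs := tendsto_sinTwo_ray j
  have he' : ∀ᶠ r : ℝ in 𝓝[≠] 0, jetNull (r • j, b (r • j)) = 0 := by
    have : Tendsto (fun r : ℝ => r • j) (𝓝[≠] 0) (𝓝 0) := by
      simpa using tendsto_ray (continuousAt_id (X := Jet) (x := 0)) j
    exact this.eventually he
  have c {x : Wiener} : Tendsto (fun _ : ℝ => x) (𝓝[≠] 0) (𝓝 x) := tendsto_const_nhds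
  have hU := (c (x := 1)).add hSz
  have hX : Tendsto (fun r : ℝ => (b (r • j)).mapX) (𝓝[≠] 0) (𝓝 (1 + 0 + 0)) := hU.add hz
  have hY : Tendsto (fun r : ℝ => (b (r • j)).mapY) (𝓝[≠] 0) (𝓝 (Complex.I • (1 + 0 - 0))) :=
    (hU.sub hz).const_smul Complex.I
  have hL := (((c (x := j 2)).mul hX).sub ((c (x := j 1)).mul hY)).pow 2
  -- the first order term of the solution is `-v`
  have hfirst : b1 = -j 0 := by
    have h2 := (((h1.mul hSz).const_smul (4 : ℝ)).add
      (hs.mul (((c (x := 2)).mul (hU.pow 2)).add ((c (x := 2)).mul (hz.pow 2))))).add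
      (tendsto_id_zero.smul hL)
    have h3 := tendsto_nhds_unique ((h1.const_smul (-4 : ℝ)).congr' ?_) h2
    · refine eq_of_ev_eq fun p => ?_
      have e := congrArg (fun a => a.ev p) h3
      simp at e
      simp
      linear_combination -(1 / 4 : ℂ) * e
    · filter_upwards [he', self_mem_nhdsWithin] with r hr hr0
      have hr' : (r : ℂ) ≠ 0 := by exact_mod_cast hr0
      refine eq_of_ev_eq fun p => ?_
      rw [jetNull_eq] at hr
      have e := congrArg (fun a => a.ev p) hr
      simp only [ev_add, ev_sub, ev_mul, ev_pow, ev_one, ev_real_smul, ev_two, ev_zero,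
        Pi.smul_apply] at e
      simp only [ev_add, ev_sub, ev_mul, ev_pow, ev_real_smul, ev_one, ev_two, Pi.smul_apply]
      push_cast at e ⊢
      field_simp
      linear_combination -e
  -- the equation expresses `4 b + 2 sin 2v` through products of first order terms
  have h2 := (((h1.mul hS1).const_smul (4 : ℝ)).add (hs.mul ((c (x := 2)).mul
      ((hS1.mul ((c (x := 2)).add hSz)).add (h1.mul hz))))).add hL |>.neg
  have e : -((4 : ℝ) • (b1 * beurling b1)
      + (2 : ℝ) • j 0 * (2 * (beurling b1 * (2 + 0) + b1 * 0))
      + (j 2 * (1 + 0 + 0) - j 1 * Complex.I • (1 + 0 - 0)) ^ 2)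
      = (4 : ℝ) • (j 0 * beurling (j 0)) + (j 1 + Complex.I • j 2) ^ 2 := by
    rw [hfirst, map_neg]
    refine eq_of_ev_eq fun p => ?_
    simp
    linear_combination (-(j 1).ev p ^ 2 - (j 2).ev p ^ 2) * Complex.I_sq
  rw [e] at h2
  refine h2.congr' ?_
  filter_upwards [he', self_mem_nhdsWithin] with r hr hr0
  have hr' : (r : ℂ) ≠ 0 := by exact_mod_cast hr0
  refine eq_of_ev_eq fun p => ?_
  rw [jetNull_eq] at hr
  have e := congrArg (fun a => a.ev p) hr
  simp only [ev_add, ev_sub, ev_mul, ev_pow, ev_one, ev_real_smul, ev_two, ev_zero,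
    Pi.smul_apply] at e
  simp only [ev_add, ev_sub, ev_neg, ev_mul, ev_pow, ev_real_smul, ev_two,
    Pi.smul_apply]
  push_cast at e ⊢
  field_simp
  linear_combination -e
end


noncomputable section

open Wiener

/-! ### The energies as smooth functions of the jet -/

namespace IsTorusFunction

variable {Φ Ψ : ℝ × ℝ → ℝ}

/-- The `2`-jet of a smooth function on the torus. -/
def jet (h : IsTorusFunction Φ) : Jet :=
  ![h.toWiener, h.pdx.toWiener, h.pdy.toWiener, h.pdx.pdx.toWiener, h.pdy.pdx.toWiener,
    h.pdy.pdy.toWiener]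

/-- The Fourier multipliers of the partial derivatives of order at most two. -/
def jetSymbol (k : ℤ × ℤ) : Fin 6 → ℂ :=
  ![1, Complex.I * √2 * k.1, Complex.I * √2 * k.2,
    (Complex.I * √2 * k.1) * (Complex.I * √2 * k.1),
    (Complex.I * √2 * k.1) * (Complex.I * √2 * k.2),
    (Complex.I * √2 * k.2) * (Complex.I * √2 * k.2)]

lemma coeff_jet (h : IsTorusFunction Φ) (i : Fin 6) (k : ℤ × ℤ) :
    (h.jet i).coeff k = jetSymbol k i * torusCoeff Φ k := by
  fin_cases i
  · exact (one_mul _).symm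
  · exact h.torusCoeff_pdx k
  · exact h.torusCoeff_pdy k
  · exact (h.pdx.torusCoeff_pdx k).trans (by rw [h.torusCoeff_pdx k, ← mul_assoc]; rfl)
  · exact (h.pdy.torusCoeff_pdx k).trans (by rw [h.torusCoeff_pdy k, ← mul_assoc]; rfl)
  · exact (h.pdy.torusCoeff_pdy k).trans (by rw [h.torusCoeff_pdy k, ← mul_assoc]; rfl)

lemma torusCoeff_add (h : IsTorusFunction Φ) (h' : IsTorusFunction Ψ) (k : ℤ × ℤ) :
    torusCoeff (Φ + Ψ) k = torusCoeff Φ k + torusCoeff Ψ k :=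
  congrArg (fun a => a.coeff k) (h.toWiener_add h')

lemma torusCoeff_smul (h : IsTorusFunction Φ) (c : ℝ) (k : ℤ × ℤ) :
    torusCoeff (c • Φ) k = c * torusCoeff Φ k :=
  congrArg (fun a => a.coeff k) (h.toWiener_smul c)

lemma jet_add (h : IsTorusFunction Φ) (h' : IsTorusFunction Ψ) :
    (h.add h').jet = h.jet + h'.jet := by
  funext i
  ext k
  rw [coeff_jet, h.torusCoeff_add h', Pi.add_apply, coeff_add, coeff_jet, coeff_jet, mul_add]

lemma jet_smul (h : IsTorusFunction Φ) (c : ℝ) : (h.smul c).jet = c • h.jet := by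
  funext i
  ext k
  rw [coeff_jet, h.torusCoeff_smul c, Pi.smul_apply, coeff_real_smul, coeff_jet, mul_left_comm]

end IsTorusFunction

/-- The Willmore energy as a function of the jet. -/
def jetWillmore (δ : Jet → Wiener) (j : Jet) : ℝ :=
  2 * π ^ 2 * ((willmoreDensity δ j).coeff 0).re

/-- The coordinate `Π¹` in Teichmüller space as a function of the jet. -/
def jetTeichmueller (b : Jet → Wiener) (j : Jet) : ℝ :=
  2 * ((b j).coeff 0).im / Complex.normSq (1 + (b j).coeff 0)

lemma contDiffAt_coeff_zero {g : Jet → Wiener} (hg : ContDiffAt ℝ 2 g 0) :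
    ContDiffAt ℝ 2 (fun j => (g j).coeff 0) 0 :=
  ((coeffL 0).restrictScalars ℝ).contDiff.contDiffAt.comp 0 hg

lemma contDiffAt_jetWillmore {δ : Jet → Wiener} (hδ : ContDiffAt ℝ 2 δ 0) :
    ContDiffAt ℝ 2 (jetWillmore δ) 0 := by
  have h1 : ContDiffAt ℝ 2 (willmoreDensity δ) 0 := by
    have hc := contDiff_jetCurv.contDiffAt (x := (0 : Jet))
    have hd := contDiff_jetDet.contDiffAt (x := (0 : Jet))
    unfold willmoreDensity
    fun_prop
  have h2 := Complex.reCLM.contDiff.contDiffAt.comp (0 : Jet) (contDiffAt_coeff_zero h1)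
  exact contDiffAt_const.mul h2

lemma contDiffAt_jetTeichmueller {b : Jet → Wiener} (h0 : b 0 = 0) (hb : ContDiffAt ℝ 2 b 0) :
    ContDiffAt ℝ 2 (jetTeichmueller b) 0 := by
  have h1 := contDiffAt_coeff_zero hb
  have him := Complex.imCLM.contDiff.contDiffAt.comp (0 : Jet) h1
  have hre := Complex.reCLM.contDiff.contDiffAt.comp (0 : Jet) h1
  have hn : ContDiffAt ℝ 2 (fun j => Complex.normSq (1 + (b j).coeff 0)) 0 := by
    have e : (fun j => Complex.normSq (1 + (b j).coeff 0)) = fun j =>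
        (1 + ((b j).coeff 0).re) * (1 + ((b j).coeff 0).re)
          + ((b j).coeff 0).im * ((b j).coeff 0).im := by
      ext j; simp [Complex.normSq_apply]
    rw [e]
    exact ((contDiffAt_const.add hre).mul (contDiffAt_const.add hre)).add (him.mul him)
  exact (contDiffAt_const.mul him).div hn (by simp [h0])

/-- The square root chosen by continuity is the positive one. -/
lemma eq_inv_sqrt_of_sq_mul_eq_one {X : ℂ} {D : ℝ} (hD : 0 < D) (h : X ^ 2 * D = 1)
    (hX : ‖X - 1‖ < 1) : X = ((√D)⁻¹ : ℝ) := by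
  have hs : 0 < √D := Real.sqrt_pos.mpr hD
  have hsq : (D : ℂ) = (√D : ℂ) ^ 2 := by exact_mod_cast (Real.sq_sqrt hD.le).symm
  have hf : (X * √D - 1) * (X * √D + 1) = 0 := by rw [hsq] at h; linear_combination h
  rcases mul_eq_zero.mp hf with h1 | h1
  · rw [Complex.ofReal_inv]; exact eq_inv_of_mul_eq_one_left (by linear_combination h1)
  · exfalso
    have h2 : X * √D = -1 := by linear_combination h1
    have h3 := congrArg Complex.re h2
    simp at h3
    have h4 : |(X - 1).re| < 1 := (Complex.abs_re_le_norm _).trans_lt hX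
    rw [abs_lt] at h4
    simp at h4
    nlinarith [h4.1]

namespace IsTorusFunction

variable {v : ℝ × ℝ → ℝ}

lemma ev_jetDet (h : IsTorusFunction v) (p : ℝ × ℝ) :
    (jetDet h.jet).ev p
      = (fundDet (sin (2 * v p)) (_root_.pdx v p) (_root_.pdy v p) : ℝ) := by
  have e := ev_sinTwo (h.ev_toWiener p)
  simp [jetDet, fundDet, jet, e]

lemma ev_jetCurv (h : IsTorusFunction v) (p : ℝ × ℝ) :
    (jetCurv h.jet).ev p = (curvNum (sin (2 * v p)) (cos (2 * v p)) (_root_.pdx v p)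
      (_root_.pdy v p) (_root_.pdx (_root_.pdx v) p) (_root_.pdx (_root_.pdy v) p)
      (_root_.pdy (_root_.pdy v) p) : ℝ) := by
  have e := ev_sinTwo (h.ev_toWiener p)
  have e' := ev_cosTwo (h.ev_toWiener p)
  simp [jetCurv, curvNum, fundE, fundF, fundG, jet, e, e']

lemma ev_jetNull (h : IsTorusFunction v) (b : Wiener) (p : ℝ × ℝ) :
    (jetNull (h.jet, b)).ev p
      = (fundG (sin (2 * v p)) (_root_.pdy v p) : ℝ) * b.mapX.ev p ^ 2
        - 2 * (fundF (_root_.pdx v p) (_root_.pdy v p) : ℝ) * b.mapX.ev p * b.mapY.ev p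
        + (fundE (sin (2 * v p)) (_root_.pdx v p) : ℝ) * b.mapY.ev p ^ 2 := by
  have e := ev_sinTwo (h.ev_toWiener p)
  simp [jetNull, fundE, fundF, fundG, jet, e]

lemma abs_sin_le (h : IsTorusFunction v) (p : ℝ × ℝ) :
    |sin (2 * v p)| ≤ ‖sinTwo (h.jet 0)‖ := by
  have h1 := norm_ev_le (sinTwo h.toWiener) p
  rw [ev_sinTwo (h.ev_toWiener p), Complex.norm_real, Real.norm_eq_abs] at h1
  exact h1

lemma willmore_cliffordGraph (h : IsTorusFunction v) {δ : Jet → Wiener}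
    (hD : ∀ p, 0 < fundDet (sin (2 * v p)) (_root_.pdx v p) (_root_.pdy v p))
    (hδ : ‖δ h.jet‖ < 1) (he : (1 + δ h.jet) ^ 2 * jetDet h.jet = 1) :
    willmore (cliffordGraph v) = jetWillmore δ h.jet := by
  have hpt (p : ℝ × ℝ) : (meanCurvature (cliffordGraph v) p ^ 2 + 1)
      * √(gramDet (cliffordGraph v) p) = ((willmoreDensity δ h.jet).ev p).re := by
    have hX : (1 + δ h.jet).ev p
        = ((√(fundDet (sin (2 * v p)) (_root_.pdx v p) (_root_.pdy v p)))⁻¹ : ℝ) := by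
      refine eq_inv_sqrt_of_sq_mul_eq_one (hD p) ?_ ?_
      · rw [← h.ev_jetDet, ← ev_pow, ← ev_mul, he, ev_one]
      · simpa using (norm_ev_le (δ h.jet) p).trans_lt hδ
    rw [h.meanCurvature_sq_mul_sqrt p (hD p), h.gramDet_cliffordGraph, willmoreDensity, ev_add,
      ev_real_smul, ev_mul, ev_mul, ev_pow, ev_pow, hX, h.ev_jetDet, h.ev_jetCurv]
    have hD' := hD p
    generalize fundDet (sin (2 * v p)) (_root_.pdx v p) (_root_.pdy v p) = D at *
    generalize curvNum (sin (2 * v p)) (cos (2 * v p)) (_root_.pdx v p)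
      (_root_.pdy v p) (_root_.pdx (_root_.pdx v) p) (_root_.pdx (_root_.pdy v) p)
      (_root_.pdy (_root_.pdy v) p) = N
    norm_cast
    have hs : 0 < √D := Real.sqrt_pos.mpr hD'
    have hsq : D = √D ^ 2 := (Real.sq_sqrt hD'.le).symm
    generalize √D = r at *
    subst hsq
    field_simp
  rw [willmore, jetWillmore]
  simp_rw [hpt]
  have h1 := integral_ev (willmoreDensity δ h.jet)
  have h2 : ∫ p in cell, ((willmoreDensity δ h.jet).ev p).re
      = (∫ p in cell, (willmoreDensity δ h.jet).ev p).re :=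
    integral_re (𝕜 := ℂ) (integrableOn_cell (continuous_ev _))
  rw [cell] at h1 h2
  rw [h2, h1, ← Complex.re_ofReal_mul]
  push_cast
  rfl

end IsTorusFunction

/-- Near the Clifford torus graphs are immersed, and their energies are the smooth functions of the
jet constructed in the Wiener algebra. -/
lemma eventually_jet {δ b : Jet → Wiener} (hδ0 : δ 0 = 0) (hδ : ContDiffAt ℝ 2 δ 0)
    (hδe : ∀ᶠ j in 𝓝 0, (1 + δ j) ^ 2 * jetDet j = 1) (hb0 : b 0 = 0) (hb : ContDiffAt ℝ 2 b 0)
    (hbe : ∀ᶠ j in 𝓝 0, jetNull (j, b j) = 0) :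
    ∀ᶠ j in 𝓝 (0 : Jet), ∀ (v : ℝ × ℝ → ℝ) (h : IsTorusFunction v), h.jet = j →
      IsTorusImmersion (cliffordGraph v) ∧ willmore (cliffordGraph v) = jetWillmore δ j ∧
      ∃ τ, IsTeichmuellerClass (cliffordGraph v) τ ∧ τ.re = jetTeichmueller b j := by
  have h1 : ∀ᶠ j in 𝓝 (0 : Jet), ‖sinTwo (j 0)‖ < 1 := by
    have hc : Continuous fun j : Jet => ‖sinTwo (j 0)‖ :=
      (contDiff_sinTwo.continuous.comp (continuous_apply 0)).norm
    have := hc.tendsto 0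
    simp only [Pi.zero_apply, sinTwo_zero, norm_zero] at this
    exact this.eventually (gt_mem_nhds one_pos)
  have h2 : ∀ᶠ j in 𝓝 (0 : Jet), ‖δ j‖ < 1 := by
    have := hδ.continuousAt.norm
    rw [ContinuousAt, hδ0, norm_zero] at this
    exact this.eventually (gt_mem_nhds one_pos)
  have h3 : ∀ᶠ j in 𝓝 (0 : Jet), ‖b j‖ < 1 / 8 := by
    have := hb.continuousAt.norm
    rw [ContinuousAt, hb0, norm_zero] at this
    exact this.eventually (gt_mem_nhds (by norm_num))
  filter_upwards [h1, h2, h3, hδe, hbe] with j j1 j2 j3 j4 j5 v h hj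
  subst hj
  have hs (p : ℝ × ℝ) : |sin (2 * v p)| < 1 := (h.abs_sin_le p).trans_lt j1
  have hE (p : ℝ × ℝ) : 0 < fundE (sin (2 * v p)) (pdx v p) := by
    have := abs_lt.mp (hs p)
    rw [fundE]; nlinarith [sq_nonneg (pdx v p)]
  have hD (p : ℝ × ℝ) : 0 < fundDet (sin (2 * v p)) (pdx v p) (pdy v p) := by
    have h3 := abs_lt.mp (hs p)
    have h4 : 0 ≤ (1 + sin (2 * v p)) * pdx v p ^ 2 :=
      mul_nonneg (by linarith) (sq_nonneg _)
    have h5 : 0 ≤ (1 - sin (2 * v p)) * pdy v p ^ 2 :=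
      mul_nonneg (by linarith) (sq_nonneg _)
    have h6 : sin (2 * v p) ^ 2 < 1 := (sq_lt_one_iff_abs_lt_one _).mpr (hs p)
    rw [fundDet]; linarith
  refine ⟨h.isTorusImmersion_cliffordGraph hE hD, h.willmore_cliffordGraph hD j2 j4, ?_⟩
  refine exists_isTeichmuellerClass h.norm_sq_fderiv_cliffordGraph hE j3.le fun p => ?_
  rw [← h.ev_jetNull, j5, ev_zero]

/-! ### Second variations -/

lemma hasDerivAt_smul_vec (v : ℝ × ℝ) (r : ℝ) : HasDerivAt (fun r : ℝ => r • v) v r := by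
  simpa using (hasDerivAt_id r).smul_const v

/-- The derivative of a directional derivative along a curve. -/
lemma hasDerivAt_fderiv_comp {e : ℝ × ℝ → ℝ} {B : ℝ × ℝ →L[ℝ] ℝ × ℝ →L[ℝ] ℝ} {c : ℝ → ℝ × ℝ}
    {v w : ℝ × ℝ} (hc : HasDerivAt c v 0) (h : HasFDerivAt (fderiv ℝ e) B (c 0)) :
    HasDerivAt (fun r : ℝ => fderiv ℝ e (c r) w) (B v w) 0 :=
  (ContinuousLinearMap.apply ℝ ℝ w).hasFDerivAt.comp_hasDerivAt (0 : ℝ)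
    (h.comp_hasDerivAt (0 : ℝ) hc)

/-- If `e` has no linear term along a line through the origin, its second derivative in that
direction is twice the quadratic term. -/
lemma fderiv_fderiv_eq_two_mul {e : ℝ × ℝ → ℝ} {v : ℝ × ℝ} {Q : ℝ}
    (hev : ∀ᶠ q in 𝓝 (0 : ℝ × ℝ), DifferentiableAt ℝ e q)
    (hD : DifferentiableAt ℝ (fderiv ℝ e) 0)
    (hQ : Tendsto (fun r : ℝ => (r⁻¹) ^ 2 * (e (r • v) - e 0)) (𝓝[≠] 0) (𝓝 Q)) :
    fderiv ℝ (fderiv ℝ e) 0 v v = 2 * Q := by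
  have hcont : Tendsto (fun r : ℝ => r • v) (𝓝 0) (𝓝 0) := by
    have := (hasDerivAt_smul_vec v 0).continuousAt.tendsto
    rwa [zero_smul] at this
  have hg (r : ℝ) (hr : DifferentiableAt ℝ e (r • v)) :
      HasDerivAt (fun r : ℝ => e (r • v)) (fderiv ℝ e (r • v) v) r :=
    hr.hasFDerivAt.comp_hasDerivAt r (hasDerivAt_smul_vec v r)
  have hg' : HasDerivAt (fun r : ℝ => fderiv ℝ e (r • v) v) (fderiv ℝ (fderiv ℝ e) 0 v v) 0 :=
    hasDerivAt_fderiv_comp (hasDerivAt_smul_vec v 0) (by rw [zero_smul]; exact hD.hasFDerivAt)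
  generalize fderiv ℝ (fderiv ℝ e) 0 v v = B at *
  -- the linear term vanishes since the quotient by `r²` converges
  have hfirst : fderiv ℝ e 0 v = 0 := by
    have h0 := hg 0 (by rw [zero_smul]; exact hev.self_of_nhds)
    have h1 := h0.tendsto_slope_zero
    simp only [zero_add, zero_smul] at h1
    have h2 := tendsto_id_zero.mul hQ
    rw [zero_mul] at h2
    refine tendsto_nhds_unique h1 (h2.congr' ?_)
    filter_upwards [self_mem_nhdsWithin] with r hr
    have : r ≠ 0 := hr
    rw [smul_eq_mul]
    field_simp
  have hsl := hg'.tendsto_slope_zero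
  simp only [zero_add, zero_smul, hfirst, sub_zero] at hsl
  -- l'Hôpital's rule computes the limit of the quotient by `r²` in terms of the derivative
  have hl := HasDerivAt.lhopital_zero_nhdsNE (f := fun r : ℝ => e (r • v) - e 0)
    (f' := fun r : ℝ => fderiv ℝ e (r • v) v) (g := fun r : ℝ => r ^ 2)
    (g' := fun r : ℝ => 2 * r) (a := 0) (l := 𝓝 (B / 2)) (by
      filter_upwards [(hcont.eventually hev).filter_mono nhdsWithin_le_nhds] with r hr
      exact (hg r hr).sub_const _) (Eventually.of_forall fun r => by
      simpa using hasDerivAt_pow 2 r) (by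
      filter_upwards [self_mem_nhdsWithin] with r hr
      exact mul_ne_zero two_ne_zero hr) (by
      have h0 := (hev.self_of_nhds.continuousAt.tendsto.comp hcont).sub_const (e 0)
      rw [sub_self] at h0
      exact h0.mono_left nhdsWithin_le_nhds) (by
      have h0 : Tendsto (fun r : ℝ => r ^ 2) (𝓝 0) (𝓝 0) := by
        simpa using (continuous_pow 2).tendsto (0 : ℝ)
      exact h0.mono_left nhdsWithin_le_nhds) (by
      refine (hsl.div_const 2).congr fun r => ?_
      rw [smul_eq_mul, div_eq_mul_inv, div_eq_mul_inv, mul_inv]; ring)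
  have := tendsto_nhds_unique hl (hQ.congr fun r => by rw [div_eq_mul_inv, inv_pow]; ring)
  linarith

/-- The mixed second derivative of a `C²` function whose restrictions to lines through the origin
have no linear term is the polarization of its quadratic term. -/
lemma deriv_deriv_eq_polar {e : ℝ × ℝ → ℝ} (he : ContDiffAt ℝ 2 e 0) {Q : ℝ × ℝ → ℝ}
    (hQ : ∀ v, Tendsto (fun r : ℝ => (r⁻¹) ^ 2 * (e (r • v) - e 0)) (𝓝[≠] 0) (𝓝 (Q v))) :
    deriv (fun s : ℝ => deriv (fun t : ℝ => e (s, t)) 0) 0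
      = Q (1, 1) - Q (1, 0) - Q (0, 1) := by
  have hev : ∀ᶠ q in 𝓝 (0 : ℝ × ℝ), DifferentiableAt ℝ e q := by
    filter_upwards [he.eventually (by simp)] with q hq
    exact hq.differentiableAt two_ne_zero
  have hD : DifferentiableAt ℝ (fderiv ℝ e) 0 :=
    (he.fderiv_right (m := 1) (by norm_num)).differentiableAt one_ne_zero
  have hsymm := he.isSymmSndFDerivAt (by simp)
  have hquad (v : ℝ × ℝ) := fderiv_fderiv_eq_two_mul hev hD (hQ v)
  have hinner : (fun s : ℝ => deriv (fun t : ℝ => e (s, t)) 0)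
      =ᶠ[𝓝 0] fun s => fderiv ℝ e (s, 0) (0, 1) := by
    have hc : Tendsto (fun s : ℝ => (s, (0 : ℝ))) (𝓝 0) (𝓝 0) := by
      have : Continuous fun s : ℝ => (s, (0 : ℝ)) := by fun_prop
      exact this.tendsto 0
    filter_upwards [hc.eventually hev] with s hs
    have h1 : HasDerivAt (fun t : ℝ => (s, t)) ((0 : ℝ), (1 : ℝ)) 0 :=
      (hasDerivAt_const (0 : ℝ) s).prodMk (hasDerivAt_id (0 : ℝ))
    exact (hs.hasFDerivAt.comp_hasDerivAt (0 : ℝ) h1).deriv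
  have houter : HasDerivAt (fun s : ℝ => fderiv ℝ e (s, 0) (0, 1))
      (fderiv ℝ (fderiv ℝ e) 0 (1, 0) (0, 1)) 0 :=
    hasDerivAt_fderiv_comp (c := fun s : ℝ => (s, (0 : ℝ)))
      ((hasDerivAt_id (0 : ℝ)).prodMk (hasDerivAt_const (0 : ℝ) (0 : ℝ))) hD.hasFDerivAt
  rw [hinner.deriv_eq, houter.deriv]
  have h1 := hquad ((1, 0) + (0, 1))
  have h3 := hsymm (0, 1) (1, 0)
  have h4 := hquad (1, 0)
  have h5 := hquad (0, 1)
  generalize fderiv ℝ (fderiv ℝ e) 0 = B at *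
  simp only [map_add, _root_.add_apply] at h1
  have h2 : ((1 : ℝ), (0 : ℝ)) + ((0 : ℝ), (1 : ℝ)) = (1, 1) := by simp
  rw [h2] at h1
  linarith

lemma im_coeff_zero_of_real {a : Wiener} (h : ∀ p, ∃ t : ℝ, a.ev p = t) : (a.coeff 0).im = 0 := by
  choose g hg using h
  have h1 := integral_ev a
  simp_rw [hg] at h1
  rw [integral_complex_ofReal] at h1
  have h2 : (2 * π ^ 2 : ℂ) * a.coeff 0 = ((2 * π ^ 2 : ℝ) : ℂ) * a.coeff 0 := by push_cast; rfl
  rw [h2] at h1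
  have h3 := congrArg Complex.im h1
  rw [Complex.ofReal_im, Complex.im_ofReal_mul] at h3
  have : (2 * π ^ 2 : ℝ) ≠ 0 := by positivity
  exact (mul_eq_zero.mp h3.symm).resolve_left this

/-- The quadratic term of the Willmore energy. -/
def quadWillmore (j : Jet) : ℝ :=
  2 * π ^ 2 * (((1 / 4 : ℝ) • ((4 : ℝ) • j 0 + j 3 + j 5) ^ 2
    + (1 / 2 : ℝ) • (-(4 : ℝ) • j 0 ^ 2 + j 1 ^ 2 + j 2 ^ 2)).coeff 0).re

/-- The quadratic term of the coordinate `Π¹` in Teichmüller space. -/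
def quadTeichmueller (j : Jet) : ℝ :=
  1 / 2 * (((4 : ℝ) • (j 0 * beurling (j 0)) + (j 1 + Complex.I • j 2) ^ 2).coeff 0).im

lemma tendsto_coeff_zero {g : ℝ → Wiener} {l : Filter ℝ} {a : Wiener} (h : Tendsto g l (𝓝 a)) :
    Tendsto (fun r => (g r).coeff 0) l (𝓝 (a.coeff 0)) :=
  ((coeffL 0).continuous.tendsto a).comp h

lemma tendsto_jetWillmore {δ : Jet → Wiener} (h0 : δ 0 = 0) (hδ : ContDiffAt ℝ 2 δ 0)
    (he : ∀ᶠ j in 𝓝 0, (1 + δ j) ^ 2 * jetDet j = 1) (j : Jet) :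
    Tendsto (fun r : ℝ => (r⁻¹) ^ 2 * (jetWillmore δ (r • j) - jetWillmore δ 0)) (𝓝[≠] 0)
      (𝓝 (quadWillmore j)) := by
  have h1 := ((Complex.continuous_re.tendsto _).comp
    (tendsto_coeff_zero (tendsto_willmoreDensity_ray h0 hδ he j))).const_mul (2 * π ^ 2)
  refine h1.congr fun r => ?_
  rw [jetWillmore, jetWillmore, willmoreDensity_zero h0, Function.comp_apply, coeff_real_smul,
    Complex.re_ofReal_mul, coeff_sub, Complex.sub_re]
  ring

lemma tendsto_jetTeichmueller {b : Jet → Wiener} (h0 : b 0 = 0) (hb : ContDiffAt ℝ 2 b 0)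
    (he : ∀ᶠ j in 𝓝 0, jetNull (j, b j) = 0) (j : Jet) (hj : ∀ p, ∃ t : ℝ, (j 0).ev p = t) :
    Tendsto (fun r : ℝ => (r⁻¹) ^ 2 * (jetTeichmueller b (r • j) - jetTeichmueller b 0)) (𝓝[≠] 0)
      (𝓝 (quadTeichmueller j)) := by
  have h1 := (Complex.continuous_im.tendsto _).comp
    (tendsto_coeff_zero (tendsto_beltrami_ray h0 hb he j))
  have h2 : Tendsto (fun r : ℝ => Complex.normSq (1 + (b (r • j)).coeff 0)) (𝓝[≠] 0) (𝓝 1) := by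
    have h3 := tendsto_coeff_zero (tendsto_ray hb.continuousAt j)
    rw [h0] at h3
    have h4 := (Complex.continuous_normSq.tendsto _).comp (h3.const_add 1)
    simpa [Function.comp_def] using h4
  have h3 := (h1.const_mul (1 / 2)).div h2 one_ne_zero
  rw [div_one] at h3
  refine h3.congr fun r => ?_
  have hs : ((sinTwo ((r • j) 0)).coeff 0).im = 0 := by
    refine im_coeff_zero_of_real fun p => ?_
    obtain ⟨t, ht⟩ := hj p
    exact ⟨_, ev_sinTwo (t := r * t) (by simp [ht])⟩
  rw [Pi.div_apply, Function.comp_apply, jetTeichmueller, jetTeichmueller, h0, coeff_real_smul,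
    Complex.im_ofReal_mul, coeff_add, coeff_real_smul, coeff_real_smul, Complex.add_im,
    Complex.im_ofReal_mul, Complex.im_ofReal_mul, hs]
  simp
  ring

/-- All that is needed about graphs over the Clifford torus in two-parameter families. -/
lemma family_cliffordTorus {Φ Ψ : ℝ × ℝ → ℝ} (hΦ : IsTorusFunction Φ) (hΨ : IsTorusFunction Ψ) :
    (∀ᶠ q : ℝ × ℝ in 𝓝 0,
      IsTorusImmersion (normalVariation cliffordTorus (q.1 • Φ + q.2 • Ψ)) ∧
      ∃! τ, IsTeichmuellerClass (normalVariation cliffordTorus (q.1 • Φ + q.2 • Ψ)) τ) ∧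
    ContDiffAt ℝ 2 (fun q : ℝ × ℝ =>
      willmore (normalVariation cliffordTorus (q.1 • Φ + q.2 • Ψ))) 0 ∧
    ContDiffAt ℝ 2 (fun q : ℝ × ℝ =>
      teichmuellerOne (normalVariation cliffordTorus (q.1 • Φ + q.2 • Ψ))) 0 ∧
    (∀ v : ℝ × ℝ, Tendsto (fun r : ℝ => (r⁻¹) ^ 2
      * (willmore (normalVariation cliffordTorus ((r • v).1 • Φ + (r • v).2 • Ψ))
        - willmore (normalVariation cliffordTorus ((0 : ℝ × ℝ).1 • Φ + (0 : ℝ × ℝ).2 • Ψ))))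
      (𝓝[≠] 0) (𝓝 (quadWillmore (v.1 • hΦ.jet + v.2 • hΨ.jet)))) ∧
    (∀ v : ℝ × ℝ, Tendsto (fun r : ℝ => (r⁻¹) ^ 2
      * (teichmuellerOne (normalVariation cliffordTorus ((r • v).1 • Φ + (r • v).2 • Ψ))
        - teichmuellerOne
          (normalVariation cliffordTorus ((0 : ℝ × ℝ).1 • Φ + (0 : ℝ × ℝ).2 • Ψ))))
      (𝓝[≠] 0) (𝓝 (quadTeichmueller (v.1 • hΦ.jet + v.2 • hΨ.jet)))) := by
  obtain ⟨δ, hδ0, hδ, hδe⟩ := exists_invSqrt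
  obtain ⟨b, hb0, hb, hbe⟩ := exists_beltrami
  let J : ℝ × ℝ → Jet := fun q => q.1 • hΦ.jet + q.2 • hΨ.jet
  have hJ : ContDiff ℝ 2 J := by fun_prop
  have hJ0 : J 0 = 0 := by simp [J]
  have hJr (r : ℝ) (v : ℝ × ℝ) : J (r • v) = r • J v := by simp [J, mul_smul]
  have htor (q : ℝ × ℝ) : IsTorusFunction (q.1 • Φ + q.2 • Ψ) := (hΦ.smul _).add (hΨ.smul _)
  have hjet (q : ℝ × ℝ) : (htor q).jet = J q :=
    ((hΦ.smul q.1).jet_add (hΨ.smul q.2)).trans (by rw [hΦ.jet_smul, hΨ.jet_smul])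
  have hev : ∀ᶠ q : ℝ × ℝ in 𝓝 0,
      IsTorusImmersion (normalVariation cliffordTorus (q.1 • Φ + q.2 • Ψ)) ∧
      willmore (normalVariation cliffordTorus (q.1 • Φ + q.2 • Ψ)) = jetWillmore δ (J q) ∧
      ∃ τ, IsTeichmuellerClass (normalVariation cliffordTorus (q.1 • Φ + q.2 • Ψ)) τ ∧
        τ.re = jetTeichmueller b (J q) := by
    have hc := hJ.continuous.tendsto 0
    rw [hJ0] at hc
    filter_upwards [hc.eventually (eventually_jet hδ0 hδ hδe hb0 hb hbe)] with q hq
    rw [normalVariation_cliffordTorus]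
    exact hq _ (htor q) (hjet q)
  have hW : (fun q : ℝ × ℝ => willmore (normalVariation cliffordTorus (q.1 • Φ + q.2 • Ψ)))
      =ᶠ[𝓝 0] fun q => jetWillmore δ (J q) := hev.mono fun q hq => hq.2.1
  have hT : (fun q : ℝ × ℝ => teichmuellerOne (normalVariation cliffordTorus (q.1 • Φ + q.2 • Ψ)))
      =ᶠ[𝓝 0] fun q => jetTeichmueller b (J q) := by
    filter_upwards [hev] with q hq
    obtain ⟨τ, hτ, hre⟩ := hq.2.2
    have h := isTeichmuellerClass_unique hτ
      (Classical.epsilon_spec (p := IsTeichmuellerClass _) ⟨τ, hτ⟩)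
    rw [teichmuellerOne, ← hre]
    exact congrArg UpperHalfPlane.re h
  have hray (v : ℝ × ℝ) : Tendsto (fun r : ℝ => r • v) (𝓝[≠] 0) (𝓝 0) := by
    simpa using tendsto_ray (continuousAt_id (X := ℝ × ℝ) (x := 0)) v
  refine ⟨?_, ?_, ?_, ?_, ?_⟩
  · filter_upwards [hev] with q hq
    obtain ⟨τ, hτ, -⟩ := hq.2.2
    exact ⟨hq.1, τ, hτ, fun τ' hτ' => isTeichmuellerClass_unique hτ hτ'⟩
  · refine ContDiffAt.congr_of_eventuallyEq ?_ hW
    have := contDiffAt_jetWillmore hδ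
    rw [← hJ0] at this
    exact this.comp 0 hJ.contDiffAt
  · refine ContDiffAt.congr_of_eventuallyEq ?_ hT
    have := contDiffAt_jetTeichmueller hb0 hb
    rw [← hJ0] at this
    exact this.comp 0 hJ.contDiffAt
  · intro v
    refine (tendsto_jetWillmore hδ0 hδ hδe (J v)).congr' ?_
    filter_upwards [(hray v).eventually hW] with r hr
    have h0 : willmore (normalVariation cliffordTorus ((0 : ℝ × ℝ).1 • Φ + (0 : ℝ × ℝ).2 • Ψ))
        = jetWillmore δ (J 0) := hW.self_of_nhds
    rw [hr, h0, hJr, hJ0]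
  · intro v
    refine (tendsto_jetTeichmueller hb0 hb hbe (J v) fun p =>
      ⟨(v.1 • Φ + v.2 • Ψ) p, ?_⟩).congr' ?_
    · rw [← hjet]; exact (htor v).ev_toWiener p
    · filter_upwards [(hray v).eventually hT] with r hr
      have h0 : teichmuellerOne
          (normalVariation cliffordTorus ((0 : ℝ × ℝ).1 • Φ + (0 : ℝ × ℝ).2 • Ψ))
          = jetTeichmueller b (J 0) := hT.self_of_nhds
      rw [hr, h0, hJr, hJ0]

/-- The quadratic form of the second variation of `W_α`. -/
def quadPenalized (α : ℝ) (j : Jet) : ℝ := quadWillmore j - α * quadTeichmueller j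

lemma secondVariation_eq_polar (α : ℝ) {Φ Ψ : ℝ × ℝ → ℝ} (hΦ : IsTorusFunction Φ)
    (hΨ : IsTorusFunction Ψ) :
    secondVariation (penalizedWillmore α) cliffordTorus Φ Ψ
      = quadPenalized α (hΦ.add hΨ).jet - quadPenalized α hΦ.jet - quadPenalized α hΨ.jet := by
  obtain ⟨-, hW, hT, hW2, hT2⟩ := family_cliffordTorus hΦ hΨ
  have h := deriv_deriv_eq_polar
    (e := fun q : ℝ × ℝ => penalizedWillmore α (normalVariation cliffordTorus (q.1 • Φ + q.2 • Ψ)))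
    (Q := fun v => quadPenalized α (v.1 • hΦ.jet + v.2 • hΨ.jet))
    (hW.sub (contDiffAt_const.mul hT)) (fun v => by
      refine ((hW2 v).sub ((hT2 v).const_mul α)).congr fun r => ?_
      simp only [penalizedWillmore]; ring)
  rw [secondVariation, h, hΦ.jet_add hΨ]
  simp
end


noncomputable section

open Wiener

/-! ### The second variation in Fourier modes -/

lemma Wiener.hasSum_coeff_zero_mul (a b : Wiener) :
    HasSum (fun k => a.coeff k * b.coeff (-k)) ((a * b).coeff 0) := by
  have h := (summable_cauchy_fiber a b 0).of_norm.hasSum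
  simpa only [coeff_mul, zero_sub] using h

/-- The eigenvalue of `½ δ²W_α` on the modes of index `±k`, for the `L²` product of mean values. For `k = 0` the last fraction is
`0 / 0 = 0`, which is its correct value. -/
def eigenvalue (α : ℝ) (k : ℤ × ℤ) : ℝ :=
  2 * π ^ 2 * (((k.1 : ℝ) ^ 2 + (k.2 : ℝ) ^ 2 - 1) * ((k.1 : ℝ) ^ 2 + (k.2 : ℝ) ^ 2 - 2))
    - 2 * α * (k.1 * k.2 * ((k.1 : ℝ) ^ 2 + (k.2 : ℝ) ^ 2 - 2) / ((k.1 : ℝ) ^ 2 + (k.2 : ℝ) ^ 2))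

lemma beurlingSymbol_neg (k : ℤ × ℤ) : beurlingSymbol (-k) = beurlingSymbol k := by
  have h : kappa (-k) = -kappa k := by simp [kappa]; ring
  rw [beurlingSymbol, beurlingSymbol, h, map_neg, neg_div_neg_eq]

lemma im_beurlingSymbol (k : ℤ × ℤ) :
    (beurlingSymbol k).im = -(2 * k.1 * k.2) / ((k.1 : ℝ) ^ 2 + (k.2 : ℝ) ^ 2) := by
  rw [beurlingSymbol, Complex.div_im, normSq_kappa]
  simp [kappa]
  ring

lemma mul_self_I_sqrt_two (a b : ℂ) :
    (Complex.I * √2 * a) * (Complex.I * √2 * b) = -2 * (a * b) := by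
  have hs : (√2 : ℂ) * √2 = 2 := by exact_mod_cast Real.mul_self_sqrt (show (0 : ℝ) ≤ 2 by norm_num)
  linear_combination (Complex.I * Complex.I * a * b) * hs + (2 * a * b) * Complex.I_mul_I

namespace IsTorusFunction

variable {Φ Ψ : ℝ × ℝ → ℝ}

lemma torusCoeff_mul_neg (h : IsTorusFunction Φ) (k : ℤ × ℤ) :
    torusCoeff Φ k * torusCoeff Φ (-k) = Complex.normSq (torusCoeff Φ k) := by
  have := h.coeff_neg_toWiener k
  rw [coeff_toWiener, coeff_toWiener] at this
  rw [this, Complex.mul_conj]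

lemma coeff_jet_mul_neg (h : IsTorusFunction Φ) (i j : Fin 6) (k : ℤ × ℤ) :
    (h.jet i).coeff k * (h.jet j).coeff (-k)
      = jetSymbol k i * jetSymbol (-k) j * Complex.normSq (torusCoeff Φ k) := by
  rw [coeff_jet, coeff_jet, ← h.torusCoeff_mul_neg]; ring

lemma coeff_laplacian_jet (h : IsTorusFunction Φ) (k : ℤ × ℤ) :
    ((4 : ℝ) • h.jet 0 + h.jet 3 + h.jet 5).coeff k
      = (4 - 2 * ((k.1 : ℂ) ^ 2 + (k.2 : ℂ) ^ 2)) * torusCoeff Φ k := by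
  simp only [coeff_add, coeff_real_smul, coeff_jet]
  change ((4 : ℝ) : ℂ) * (1 * _) + Complex.I * √2 * k.1 * (Complex.I * √2 * k.1) * _
    + Complex.I * √2 * k.2 * (Complex.I * √2 * k.2) * _ = _
  rw [mul_self_I_sqrt_two, mul_self_I_sqrt_two]
  push_cast
  ring

lemma hasSum_quadWillmore (h : IsTorusFunction Φ) :
    HasSum (fun k : ℤ × ℤ => 2 * π ^ 2 * (((k.1 : ℝ) ^ 2 + (k.2 : ℝ) ^ 2 - 1)
      * ((k.1 : ℝ) ^ 2 + (k.2 : ℝ) ^ 2 - 2)) * Complex.normSq (torusCoeff Φ k))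
      (quadWillmore h.jet) := by
  have hA := hasSum_coeff_zero_mul ((4 : ℝ) • h.jet 0 + h.jet 3 + h.jet 5)
    ((4 : ℝ) • h.jet 0 + h.jet 3 + h.jet 5)
  have h0 := hasSum_coeff_zero_mul (h.jet 0) (h.jet 0)
  have h1 := hasSum_coeff_zero_mul (h.jet 1) (h.jet 1)
  have h2 := hasSum_coeff_zero_mul (h.jet 2) (h.jet 2)
  have hs := (Complex.hasSum_re ((hA.mul_left (1 / 4 : ℂ)).add
    ((((h0.mul_left (-4 : ℂ)).add h1).add h2).mul_left (1 / 2 : ℂ)))).mul_left (2 * π ^ 2)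
  have hv : quadWillmore h.jet = 2 * π ^ 2 * (1 / 4 * (((4 : ℝ) • h.jet 0 + h.jet 3 + h.jet 5)
      * ((4 : ℝ) • h.jet 0 + h.jet 3 + h.jet 5)).coeff 0 + 1 / 2 * (-4 * (h.jet 0 * h.jet 0).coeff 0
        + (h.jet 1 * h.jet 1).coeff 0 + (h.jet 2 * h.jet 2).coeff 0)).re := by
    simp only [quadWillmore, sq, coeff_add, coeff_real_smul]
    push_cast
    rfl
  rw [hv]
  refine (congrArg (HasSum · _) (funext fun k => ?_)).mpr hs
  rw [coeff_laplacian_jet, coeff_laplacian_jet, coeff_jet_mul_neg, coeff_jet_mul_neg,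
    coeff_jet_mul_neg]
  change _ = 2 * π ^ 2 * (1 / 4 * _ + 1 / 2 * (-4 * (1 * 1 * _)
    + (Complex.I * √2 * k.1) * (Complex.I * √2 * (-k).1) * _
    + (Complex.I * √2 * k.2) * (Complex.I * √2 * (-k).2) * _) : ℂ).re
  rw [mul_self_I_sqrt_two, mul_self_I_sqrt_two, mul_assoc (2 * π ^ 2),
    ← Complex.ofReal_re ((_ : ℝ) * Complex.normSq _)]
  congr 2
  have e := h.torusCoeff_mul_neg k
  push_cast [Prod.fst_neg, Prod.snd_neg]
  linear_combination (-(1 / 4) * (4 - 2 * ((k.1 : ℂ) ^ 2 + (k.2 : ℂ) ^ 2)) ^ 2) * e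

lemma hasSum_quadTeichmueller (h : IsTorusFunction Φ) :
    HasSum (fun k : ℤ × ℤ => 2 * (k.1 * k.2 * ((k.1 : ℝ) ^ 2 + (k.2 : ℝ) ^ 2 - 2)
      / ((k.1 : ℝ) ^ 2 + (k.2 : ℝ) ^ 2)) * Complex.normSq (torusCoeff Φ k))
      (quadTeichmueller h.jet) := by
  have h0 := hasSum_coeff_zero_mul (h.jet 0) (beurling (h.jet 0))
  have h1 := hasSum_coeff_zero_mul (h.jet 1 + Complex.I • h.jet 2) (h.jet 1 + Complex.I • h.jet 2)
  have hs := (Complex.hasSum_im ((h0.mul_left (4 : ℂ)).add h1)).mul_left (1 / 2)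
  have hv : quadTeichmueller h.jet = 1 / 2 * (4 * (h.jet 0 * beurling (h.jet 0)).coeff 0
      + ((h.jet 1 + Complex.I • h.jet 2) * (h.jet 1 + Complex.I • h.jet 2)).coeff 0).im := by
    simp only [quadTeichmueller, sq, coeff_add, coeff_real_smul]
    push_cast
    rfl
  rw [hv]
  refine (congrArg (HasSum · _) (funext fun k => ?_)).mpr hs
  have hL (k : ℤ × ℤ) : (h.jet 1 + Complex.I • h.jet 2).coeff k
      = Complex.I * √2 * kappa k * torusCoeff Φ k := by
    simp only [coeff_add, coeff_smul, coeff_jet]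
    change Complex.I * √2 * k.1 * _ + Complex.I * (Complex.I * √2 * k.2 * _) = _
    rw [kappa]
    ring
  have hk : kappa (-k) = -kappa k := by simp [kappa]; ring
  have e := h.torusCoeff_mul_neg k
  have e1 : 4 * ((h.jet 0).coeff k * (beurling (h.jet 0)).coeff (-k))
      + (h.jet 1 + Complex.I • h.jet 2).coeff k * (h.jet 1 + Complex.I • h.jet 2).coeff (-k)
      = (4 * beurlingSymbol k + 2 * kappa k ^ 2) * Complex.normSq (torusCoeff Φ k) := by
    have h4 := mul_self_I_sqrt_two (kappa k) (kappa k)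
    rw [coeff_beurling, beurlingSymbol_neg, hL, hL, hk, coeff_jet, coeff_jet, ← e]
    change 4 * (1 * _ * (_ * (1 * _))) + _ = _
    linear_combination (-(torusCoeff Φ k * torusCoeff Φ (-k))) * h4
  rw [e1, Complex.im_mul_ofReal, ← mul_assoc]
  congr 1
  have h5 : (kappa k ^ 2).im = 2 * (k.1 * k.2) := by
    rw [sq, Complex.mul_im]; simp [kappa]; ring
  have h6 : (4 * beurlingSymbol k + 2 * kappa k ^ 2).im
      = 4 * (beurlingSymbol k).im + 2 * (kappa k ^ 2).im := by simp
  rw [h6, h5, im_beurlingSymbol]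
  by_cases hk0 : k = 0
  · simp [hk0]
  · have := Complex.normSq_pos.mpr (kappa_ne_zero hk0)
    rw [normSq_kappa] at this
    field_simp
    ring

lemma hasSum_quadPenalized (h : IsTorusFunction Φ) (α : ℝ) :
    HasSum (fun k => eigenvalue α k * Complex.normSq (torusCoeff Φ k))
      (quadPenalized α h.jet) := by
  refine (congrArg (HasSum · _) (funext fun k => ?_)).mpr
    (h.hasSum_quadWillmore.sub (h.hasSum_quadTeichmueller.mul_left α))
  rw [eigenvalue]; ring

/-- The second variation is diagonal in Fourier modes. -/
lemma hasSum_secondVariation (hΦ : IsTorusFunction Φ) (hΨ : IsTorusFunction Ψ) (α : ℝ) :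
    HasSum (fun k => 2 * eigenvalue α k
      * (torusCoeff Φ k * starRingEnd ℂ (torusCoeff Ψ k)).re)
      (secondVariation (penalizedWillmore α) cliffordTorus Φ Ψ) := by
  rw [secondVariation_eq_polar α hΦ hΨ]
  refine (congrArg (HasSum · _) (funext fun k => ?_)).mpr ((((hΦ.add hΨ).hasSum_quadPenalized α).sub
    (hΦ.hasSum_quadPenalized α)).sub (hΨ.hasSum_quadPenalized α))
  rw [hΦ.torusCoeff_add hΨ, Complex.normSq_add]
  ring

end IsTorusFunction

/-- The real mode `2 Re (z e_k)`, whose coefficients are `z` at `k` and `z̄` at `-k`. -/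
def wave (k : ℤ × ℤ) (z : ℂ) (p : ℝ × ℝ) : ℝ := 2 * (z * chr k p).re

lemma isTorusFunction_wave (k : ℤ × ℤ) (z : ℂ) : IsTorusFunction (wave k z) := by
  refine ⟨?_, fun p => ?_⟩
  · have h := contDiff_chr k
    have := Complex.reCLM.contDiff.comp ((contDiff_const (c := z)).mul h)
    exact contDiff_const.mul this
  · simp only [wave, (chr_periodic k p).1, (chr_periodic k p).2, and_self]

lemma torusCoeff_wave (k : ℤ × ℤ) (z : ℂ) (j : ℤ × ℤ) :
    torusCoeff (wave k z) j = (if j = k then z else 0) + if j = -k then starRingEnd ℂ z else 0 := by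
  have h : (isTorusFunction_wave k z).toWiener = single k z + single (-k) (starRingEnd ℂ z) := by
    refine eq_of_ev_eq fun p => ?_
    rw [IsTorusFunction.ev_toWiener, ev_add, ev_single, ev_single, chr_neg, ← map_mul,
      Complex.add_conj, wave]
  rw [← IsTorusFunction.coeff_toWiener (isTorusFunction_wave k z), h, coeff_add, coeff_single,
    coeff_single]

lemma eigenvalue_neg (α : ℝ) (k : ℤ × ℤ) : eigenvalue α (-k) = eigenvalue α k := by
  simp [eigenvalue]

/-- Testing the second variation against the mode of index `k`. -/
lemma IsTorusFunction.secondVariation_wave {Φ : ℝ × ℝ → ℝ} (h : IsTorusFunction Φ) (α : ℝ)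
    (k : ℤ × ℤ) (z : ℂ) :
    secondVariation (penalizedWillmore α) cliffordTorus Φ (wave k z)
      = 4 * eigenvalue α k * (torusCoeff Φ k * starRingEnd ℂ z).re := by
  have h1 := h.hasSum_secondVariation (isTorusFunction_wave k z) α
  have h2 := (hasSum_ite_eq k (2 * eigenvalue α k * (torusCoeff Φ k * starRingEnd ℂ z).re)).add
    (hasSum_ite_eq (-k) (2 * eigenvalue α k * (torusCoeff Φ k * starRingEnd ℂ z).re))
  refine (h1.unique ((congrArg (HasSum · _) (funext fun j => ?_)).mpr h2)).trans (by ring)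
  have hc := h.coeff_neg_toWiener k
  rw [coeff_toWiener, coeff_toWiener] at hc
  have e (w : ℂ) : (starRingEnd ℂ w * z).re = (w * starRingEnd ℂ z).re := by
    simp [Complex.mul_re]
  rw [torusCoeff_wave, map_add, mul_add, Complex.add_re, mul_add]
  congr 1
  · split_ifs with hj
    · rw [hj]
    · simp
  · split_ifs with hj
    · rw [hj, eigenvalue_neg, hc, Complex.conj_conj, e]
    · simp

end


noncomputable section

/-! ### Normal components of infinitesimal Möbius transformations -/

lemma mem_so'_iff {B : Matrix (Fin 4 ⊕ Fin 1) (Fin 4 ⊕ Fin 1) ℝ} :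
    B ∈ LieAlgebra.Orthogonal.so' (Fin 4) (Fin 1) ℝ ↔
      (∀ i j, B (.inl j) (.inl i) = -B (.inl i) (.inl j)) ∧
      (∀ i, B (.inr 0) (.inl i) = B (.inl i) (.inr 0)) ∧ B (.inr 0) (.inr 0) = 0 := by
  have h : B ∈ LieAlgebra.Orthogonal.so' (Fin 4) (Fin 1) ℝ ↔
      B.transpose * LieAlgebra.Orthogonal.indefiniteDiagonal (Fin 4) (Fin 1) ℝ
        = LieAlgebra.Orthogonal.indefiniteDiagonal (Fin 4) (Fin 1) ℝ * -B :=
    mem_skewAdjointMatricesSubmodule _ _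
  rw [h, ← Matrix.ext_iff]
  simp only [LieAlgebra.Orthogonal.indefiniteDiagonal, Matrix.mul_diagonal, Matrix.diagonal_mul,
    Matrix.transpose_apply, Matrix.neg_apply, Sum.forall, Sum.elim_inl, Sum.elim_inr,
    Fin.forall_fin_one]
  constructor
  · rintro ⟨h1, h2⟩
    refine ⟨fun i j => ?_, fun i => ?_, ?_⟩
    · linarith [h1 i |>.1 j]
    · linarith [h1 i |>.2]
    · linarith [h2.2]
  · rintro ⟨h1, h2, h3⟩
    refine ⟨fun i => ⟨fun j => ?_, ?_⟩, fun i => ?_, ?_⟩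
    · linarith [h1 i j]
    · linarith [h2 i]
    · linarith [h2 i]
    · linarith

open scoped Matrix.Norms.Operator in
lemma hasDerivAt_exp_smul_apply {n : Type*} [Fintype n] [DecidableEq n] (B : Matrix n n ℝ)
    (i j : n) : HasDerivAt (fun t : ℝ => NormedSpace.exp (t • B) i j) (B i j) 0 := by
  have h := hasDerivAt_exp_smul_const (𝕂 := ℝ) B 0
  rw [zero_smul, NormedSpace.exp_zero, one_mul] at h
  exact ((Matrix.entryLinearMap ℝ ℝ i j).toContinuousLinearMap.hasFDerivAt.comp_hasDerivAt (0 : ℝ) h)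

/-- The velocity field `q ↦ A q + b - ⟨b, q⟩ q` of an infinitesimal Möbius transformation. -/
lemma deriv_moebius {B : Matrix (Fin 4 ⊕ Fin 1) (Fin 4 ⊕ Fin 1) ℝ}
    (hB : B ∈ LieAlgebra.Orthogonal.so' (Fin 4) (Fin 1) ℝ) (q : E4) :
    deriv (fun t : ℝ => moebius (NormedSpace.exp (t • B)) q) 0
      = WithLp.toLp 2 (fun i => ∑ j, B (.inl i) (.inl j) * q j + B (.inl i) (.inr 0))
        - (∑ j, B (.inl j) (.inr 0) * q j) • q := by
  obtain ⟨-, h2, h3⟩ := mem_so'_iff.mp hB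
  have hrow (i : Fin 4 ⊕ Fin 1) : HasDerivAt
      (fun t : ℝ => (NormedSpace.exp (t • B)).mulVec (Sum.elim q.ofLp 1) i)
      (∑ j, B i (.inl j) * q j + B i (.inr 0)) 0 := by
    have h := HasDerivAt.fun_sum (u := Finset.univ) fun j (_ : j ∈ Finset.univ) =>
      (hasDerivAt_exp_smul_apply B i j).mul_const ((Sum.elim q.ofLp 1 : Fin 4 ⊕ Fin 1 → ℝ) j)
    simpa [Matrix.mulVec, dotProduct, Fintype.sum_sum_type] using h
  have h0 (i : Fin 4 ⊕ Fin 1) : (NormedSpace.exp ((0 : ℝ) • B)).mulVec (Sum.elim q.ofLp 1) i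
      = (Sum.elim q.ofLp 1 : Fin 4 ⊕ Fin 1 → ℝ) i := by
    rw [zero_smul, NormedSpace.exp_zero, Matrix.one_mulVec]
  refine HasDerivAt.deriv ?_
  have hc (i : Fin 4) := (hrow (.inl i)).div (hrow (.inr 0)) (by rw [h0]; simp)
  simp only [h0] at hc
  have hpi := hasDerivAt_pi.mpr hc
  have hl := (PiLp.continuousLinearEquiv 2 ℝ (fun _ : Fin 4 => ℝ)).symm.hasFDerivAt.comp_hasDerivAt
    (0 : ℝ) hpi
  refine hl.congr_deriv ?_
  ext i
  simp [h2, h3]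
  ring

/-- Normal components of infinitesimal Möbius transformations along the Clifford torus: the terms
with coefficients `b` come from Lorentz boosts, those with coefficients `a` from rotations. -/
lemma isMoebiusVariation_cliffordTorus_iff {M : ℝ × ℝ → ℝ} :
    IsMoebiusVariation cliffordTorus M ↔ ∃ a b : Fin 4 → ℝ, ∀ p : ℝ × ℝ,
      M p = b 0 * cos (√2 * p.1) + b 1 * sin (√2 * p.1) + b 2 * cos (√2 * p.2)
        + b 3 * sin (√2 * p.2) + a 0 * (cos (√2 * p.1) * cos (√2 * p.2))
        + a 1 * (cos (√2 * p.1) * sin (√2 * p.2)) + a 2 * (sin (√2 * p.1) * cos (√2 * p.2))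
        + a 3 * (sin (√2 * p.1) * sin (√2 * p.2)) := by
  have hs : (√2)⁻¹ * (√2)⁻¹ = 1 / 2 := by
    rw [← mul_inv, Real.mul_self_sqrt (by norm_num)]; norm_num
  have hs0 : √2 * (√2)⁻¹ = 1 := mul_inv_cancel₀ (by positivity)
  have key (B : Matrix (Fin 4 ⊕ Fin 1) (Fin 4 ⊕ Fin 1) ℝ)
      (hB : B ∈ LieAlgebra.Orthogonal.so' (Fin 4) (Fin 1) ℝ) (p : ℝ × ℝ) :
      inner ℝ (deriv (fun t : ℝ => moebius (NormedSpace.exp (t • B)) (cliffordTorus p)) 0)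
        (unitNormal cliffordTorus p)
      = -(√2)⁻¹ * B (.inl 0) (.inr 0) * cos (√2 * p.1) - (√2)⁻¹ * B (.inl 1) (.inr 0) * sin (√2 * p.1)
        + (√2)⁻¹ * B (.inl 2) (.inr 0) * cos (√2 * p.2)
        + (√2)⁻¹ * B (.inl 3) (.inr 0) * sin (√2 * p.2)
        - B (.inl 0) (.inl 2) * (cos (√2 * p.1) * cos (√2 * p.2))
        - B (.inl 0) (.inl 3) * (cos (√2 * p.1) * sin (√2 * p.2))
        - B (.inl 1) (.inl 2) * (sin (√2 * p.1) * cos (√2 * p.2))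
        - B (.inl 1) (.inl 3) * (sin (√2 * p.1) * sin (√2 * p.2)) := by
    have hort : inner ℝ (cliffordTorus p) (unitNormal cliffordTorus p) = 0 := by
      rw [unitNormal_cliffordTorus, cliffordTorus_eq, inner_torusFrame]; ring
    obtain ⟨h1, -, -⟩ := mem_so'_iff.mp hB
    have d (i : Fin 4) : B (.inl i) (.inl i) = 0 := by linarith [h1 i i]
    rw [deriv_moebius hB, inner_sub_left, real_inner_smul_left, hort, mul_zero, sub_zero,
      unitNormal_cliffordTorus, cliffordTorus_eq]
    simp [torusFrame, PiLp.inner_apply, Fin.sum_univ_four, d, h1 0 1, h1 0 2, h1 0 3, h1 1 2,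
      h1 1 3, h1 2 3]
    generalize (√2)⁻¹ = r at hs
    linear_combination (-2 * (B (.inl 0) (.inl 2) * (cos (√2 * p.1) * cos (√2 * p.2))
      + B (.inl 0) (.inl 3) * (cos (√2 * p.1) * sin (√2 * p.2))
      + B (.inl 1) (.inl 2) * (sin (√2 * p.1) * cos (√2 * p.2))
      + B (.inl 1) (.inl 3) * (sin (√2 * p.1) * sin (√2 * p.2)))) * hs
  constructor
  · rintro ⟨B, hB, h⟩
    refine ⟨![-B (.inl 0) (.inl 2), -B (.inl 0) (.inl 3), -B (.inl 1) (.inl 2),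
      -B (.inl 1) (.inl 3)], ![-(√2)⁻¹ * B (.inl 0) (.inr 0), -(√2)⁻¹ * B (.inl 1) (.inr 0),
      (√2)⁻¹ * B (.inl 2) (.inr 0), (√2)⁻¹ * B (.inl 3) (.inr 0)], fun p => ?_⟩
    rw [h, key B hB]
    simp
    ring
  · rintro ⟨a, b, h⟩
    let B : Matrix (Fin 4 ⊕ Fin 1) (Fin 4 ⊕ Fin 1) ℝ := Matrix.fromBlocks
      !![0, 0, -a 0, -a 1; 0, 0, -a 2, -a 3; a 0, a 2, 0, 0; a 1, a 3, 0, 0]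
      (Matrix.of fun i _ => √2 * ![-b 0, -b 1, b 2, b 3] i)
      (Matrix.of fun _ i => √2 * ![-b 0, -b 1, b 2, b 3] i) 0
    have hB : B ∈ LieAlgebra.Orthogonal.so' (Fin 4) (Fin 1) ℝ := by
      refine mem_so'_iff.mpr ⟨fun i j => ?_, fun i => rfl, rfl⟩
      simp only [B, Matrix.fromBlocks_apply₁₁]
      fin_cases i <;> fin_cases j <;> simp
    refine ⟨B, hB, fun p => ?_⟩
    rw [h, key B hB]
    simp [B]
end


noncomputable section

open Wiener

/-! ### The critical modes -/

/-- Representatives modulo `±1` of the indices of the modes annihilated at `α = 10 π²`. -/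
def modeIndex : Fin 6 → ℤ × ℤ := ![(1, 0), (0, 1), (1, 1), (1, -1), (1, 2), (2, 1)]

lemma modeIndex_injective : Function.Injective modeIndex := by decide

lemma modeIndex_ne_neg (i j : Fin 6) : modeIndex i ≠ -modeIndex j := by
  revert i j; decide

/-- The numerator of the eigenvalue at `α = 10 π²`. Outside a disc it is positive by
`2 k₁ k₂ ≤ k₁² + k₂²`, and finitely many indices remain. -/
lemma numerator_nonneg (a b : ℤ) :
    0 ≤ (a ^ 2 + b ^ 2 - 2) * ((a ^ 2 + b ^ 2) * (a ^ 2 + b ^ 2 - 1) - 10 * (a * b)) ∧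
    ((a ^ 2 + b ^ 2 - 2) * ((a ^ 2 + b ^ 2) * (a ^ 2 + b ^ 2 - 1) - 10 * (a * b)) = 0 →
      (a, b) = 0 ∨ ∃ i, (a, b) = modeIndex i ∨ (a, b) = -modeIndex i) := by
  by_cases hN : a ^ 2 + b ^ 2 ≤ 6
  · have ha1 : a ≤ 2 := by nlinarith [sq_nonneg b]
    have ha2 : -2 ≤ a := by nlinarith [sq_nonneg b]
    have hb1 : b ≤ 2 := by nlinarith [sq_nonneg a]
    have hb2 : -2 ≤ b := by nlinarith [sq_nonneg a]
    clear hN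
    revert a b
    have h : ∀ a ∈ Finset.Icc (-2 : ℤ) 2, ∀ b ∈ Finset.Icc (-2 : ℤ) 2,
        0 ≤ (a ^ 2 + b ^ 2 - 2) * ((a ^ 2 + b ^ 2) * (a ^ 2 + b ^ 2 - 1) - 10 * (a * b)) ∧
        ((a ^ 2 + b ^ 2 - 2) * ((a ^ 2 + b ^ 2) * (a ^ 2 + b ^ 2 - 1) - 10 * (a * b)) = 0 →
          (a, b) = 0 ∨ ∃ i, (a, b) = modeIndex i ∨ (a, b) = -modeIndex i) := by decide
    intro a b ha1 ha2 hb1 hb2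
    exact h a (Finset.mem_Icc.mpr ⟨ha2, ha1⟩) b (Finset.mem_Icc.mpr ⟨hb2, hb1⟩)
  · have h1 : 0 < a ^ 2 + b ^ 2 - 2 := by linarith
    have h2 : 0 < (a ^ 2 + b ^ 2) * (a ^ 2 + b ^ 2 - 1) - 10 * (a * b) := by
      nlinarith [sq_nonneg (a - b)]
    exact ⟨(mul_pos h1 h2).le, fun h => absurd h (mul_pos h1 h2).ne'⟩

lemma eigenvalue_mul (k : ℤ × ℤ) (hk : k ≠ 0) :
    eigenvalue (10 * π ^ 2) k * ((k.1 : ℝ) ^ 2 + (k.2 : ℝ) ^ 2) = 2 * π ^ 2 *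
      (((k.1 ^ 2 + k.2 ^ 2 - 2) * ((k.1 ^ 2 + k.2 ^ 2) * (k.1 ^ 2 + k.2 ^ 2 - 1)
        - 10 * (k.1 * k.2)) : ℤ) : ℝ) := by
  have := Complex.normSq_pos.mpr (kappa_ne_zero hk)
  rw [normSq_kappa] at this
  rw [eigenvalue]
  push_cast
  field_simp

lemma eigenvalue_zero (α : ℝ) : eigenvalue α 0 = 4 * π ^ 2 := by
  simp [eigenvalue]; ring

lemma eigenvalue_nonneg (k : ℤ × ℤ) : 0 ≤ eigenvalue (10 * π ^ 2) k := by
  by_cases hk : k = 0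
  · rw [hk, eigenvalue_zero]; positivity
  have hpos := Complex.normSq_pos.mpr (kappa_ne_zero hk)
  rw [normSq_kappa] at hpos
  refine nonneg_of_mul_nonneg_left ?_ hpos
  rw [eigenvalue_mul k hk]
  have : (0 : ℝ) ≤ (((k.1 ^ 2 + k.2 ^ 2 - 2) * ((k.1 ^ 2 + k.2 ^ 2) * (k.1 ^ 2 + k.2 ^ 2 - 1)
        - 10 * (k.1 * k.2)) : ℤ) : ℝ) := by exact_mod_cast (numerator_nonneg k.1 k.2).1
  positivity

lemma eigenvalue_modeIndex (i : Fin 6) : eigenvalue (10 * π ^ 2) (modeIndex i) = 0 := by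
  fin_cases i <;> simp [eigenvalue, modeIndex] <;> ring

lemma eigenvalue_eq_zero_iff (k : ℤ × ℤ) :
    eigenvalue (10 * π ^ 2) k = 0 ↔ ∃ i, k = modeIndex i ∨ k = -modeIndex i := by
  constructor
  · intro h
    have hk : k ≠ 0 := by
      rintro rfl
      rw [eigenvalue_zero] at h
      have : 4 * π ^ 2 ≠ 0 := by positivity
      exact this h
    have h1 := eigenvalue_mul k hk
    rw [h, zero_mul, eq_comm, mul_eq_zero, Int.cast_eq_zero] at h1
    exact ((numerator_nonneg k.1 k.2).2 (h1.resolve_left (by positivity))).resolve_left hk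
  · rintro ⟨i, rfl | rfl⟩
    · exact eigenvalue_modeIndex i
    · rw [eigenvalue_neg, eigenvalue_modeIndex]

lemma isTorusFunction_sum_wave {ι : Type*} (s : Finset ι) (k : ι → ℤ × ℤ) (z : ι → ℂ) :
    IsTorusFunction (∑ i ∈ s, wave (k i) (z i)) :=
  Finset.sum_induction _ IsTorusFunction (fun _ _ h h' => h.add h')
    ⟨contDiff_const, fun _ => ⟨rfl, rfl⟩⟩ fun i _ => isTorusFunction_wave (k i) (z i)

lemma torusCoeff_sum_wave {ι : Type*} (s : Finset ι) (k : ι → ℤ × ℤ) (z : ι → ℂ) (j : ℤ × ℤ) :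
    torusCoeff (∑ i ∈ s, wave (k i) (z i)) j = ∑ i ∈ s, torusCoeff (wave (k i) (z i)) j := by
  have h : (isTorusFunction_sum_wave s k z).toWiener
      = ∑ i ∈ s, (isTorusFunction_wave (k i) (z i)).toWiener := by
    refine eq_of_ev_eq fun p => ?_
    have h2 : (∑ i ∈ s, (isTorusFunction_wave (k i) (z i)).toWiener).ev p
        = ∑ i ∈ s, ((isTorusFunction_wave (k i) (z i)).toWiener).ev p := map_sum (evL p) _ _
    rw [h2, IsTorusFunction.ev_toWiener]
    simp
  have h2 := congrArg (coeffL j) h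
  rw [map_sum] at h2
  exact h2

lemma torusCoeff_sum_modeIndex (z : Fin 6 → ℂ) (i : Fin 6) :
    torusCoeff (∑ i, wave (modeIndex i) (z i)) (modeIndex i) = z i := by
  rw [torusCoeff_sum_wave]
  simp [torusCoeff_wave, modeIndex_ne_neg, modeIndex_injective.eq_iff]

/-- The torus functions supported on the critical modes. -/
lemma IsTorusFunction.forall_eigenvalue_iff {Φ : ℝ × ℝ → ℝ} (h : IsTorusFunction Φ) :
    (∀ k, eigenvalue (10 * π ^ 2) k = 0 ∨ torusCoeff Φ k = 0) ↔
      ∃ z : Fin 6 → ℂ, Φ = ∑ i, wave (modeIndex i) (z i) := by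
  constructor
  · intro hk
    refine ⟨fun i => torusCoeff Φ (modeIndex i), ?_⟩
    set z : Fin 6 → ℂ := fun i => torusCoeff Φ (modeIndex i)
    have hs := isTorusFunction_sum_wave Finset.univ modeIndex z
    have hneg {Ψ : ℝ × ℝ → ℝ} (hΨ : IsTorusFunction Ψ) (i : Fin 6) :
        torusCoeff Ψ (-modeIndex i) = starRingEnd ℂ (torusCoeff Ψ (modeIndex i)) :=
      hΨ.coeff_neg_toWiener _
    have hw : h.toWiener = hs.toWiener := by
      ext j
      rw [coeff_toWiener, coeff_toWiener]
      by_cases hj : ∃ i, j = modeIndex i ∨ j = -modeIndex i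
      · obtain ⟨i, rfl | rfl⟩ := hj
        · rw [torusCoeff_sum_modeIndex]
        · rw [hneg h, hneg hs, torusCoeff_sum_modeIndex]
      · rw [(hk j).resolve_left fun h0 => hj ((eigenvalue_eq_zero_iff j).mp h0),
          torusCoeff_sum_wave]
        push Not at hj
        simp [torusCoeff_wave, fun i => (hj i).1, fun i => (hj i).2]
    funext p
    have hp := congrArg (fun a => a.ev p) hw
    simp only [ev_toWiener] at hp
    exact_mod_cast hp
  · rintro ⟨z, rfl⟩ k
    by_cases hj : ∃ i, k = modeIndex i ∨ k = -modeIndex i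
    · exact Or.inl ((eigenvalue_eq_zero_iff k).mpr hj)
    · right
      rw [torusCoeff_sum_wave]
      push Not at hj
      simp [torusCoeff_wave, fun i => (hj i).1, fun i => (hj i).2]

lemma IsTorusFunction.kernel_iff {Φ : ℝ × ℝ → ℝ} (h : IsTorusFunction Φ) (α : ℝ) :
    (∀ Ψ : ℝ × ℝ → ℝ, IsTorusFunction Ψ →
      secondVariation (penalizedWillmore α) cliffordTorus Φ Ψ = 0) ↔
    ∀ k, eigenvalue α k = 0 ∨ torusCoeff Φ k = 0 := by
  constructor
  · intro h0 k
    have h1 := h0 _ (isTorusFunction_wave k (torusCoeff Φ k))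
    rw [h.secondVariation_wave, Complex.mul_conj, Complex.ofReal_re] at h1
    simpa using h1
  · intro h0 Ψ hΨ
    refine (h.hasSum_secondVariation hΨ α).unique ?_
    refine Eq.mpr (congrArg (HasSum · _) (funext fun k => ?_)) hasSum_zero
    rcases h0 k with h1 | h1 <;> simp [h1]

/-! ### Identification of the kernel -/

lemma wave_eq (k : ℤ × ℤ) (z : ℂ) (p : ℝ × ℝ) :
    wave k z p = 2 * (z.re * cos (√2 * (k.1 * p.1 + k.2 * p.2))
      - z.im * sin (√2 * (k.1 * p.1 + k.2 * p.2))) := by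
  rw [wave, Complex.mul_re, chr, Complex.exp_ofReal_mul_I_re, Complex.exp_ofReal_mul_I_im]

lemma isMoebiusVariation_iff_wave {M : ℝ × ℝ → ℝ} :
    IsMoebiusVariation cliffordTorus M ↔
      ∃ z : Fin 6 → ℂ, z 4 = 0 ∧ z 5 = 0 ∧ M = ∑ i, wave (modeIndex i) (z i) := by
  have hexp (z : Fin 6 → ℂ) (h4 : z 4 = 0) (h5 : z 5 = 0) (p : ℝ × ℝ) :
      (∑ i, wave (modeIndex i) (z i)) p
      = 2 * (z 0).re * cos (√2 * p.1) - 2 * (z 0).im * sin (√2 * p.1)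
        + 2 * (z 1).re * cos (√2 * p.2) - 2 * (z 1).im * sin (√2 * p.2)
        + 2 * ((z 2).re + (z 3).re) * (cos (√2 * p.1) * cos (√2 * p.2))
        + 2 * ((z 3).im - (z 2).im) * (cos (√2 * p.1) * sin (√2 * p.2))
        - 2 * ((z 2).im + (z 3).im) * (sin (√2 * p.1) * cos (√2 * p.2))
        + 2 * ((z 3).re - (z 2).re) * (sin (√2 * p.1) * sin (√2 * p.2)) := by
    simp only [Finset.sum_apply, Fin.sum_univ_six, h4, h5, wave_eq]
    simp [modeIndex, mul_add, cos_add, sin_add]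
    ring
  rw [isMoebiusVariation_cliffordTorus_iff]
  constructor
  · rintro ⟨a, b, h⟩
    refine ⟨![⟨b 0 / 2, -b 1 / 2⟩, ⟨b 2 / 2, -b 3 / 2⟩, ⟨(a 0 - a 3) / 4, -(a 1 + a 2) / 4⟩,
      ⟨(a 0 + a 3) / 4, (a 1 - a 2) / 4⟩, 0, 0], rfl, rfl, funext fun p => ?_⟩
    rw [hexp _ rfl rfl, h]
    simp
    ring
  · rintro ⟨z, h4, h5, rfl⟩
    refine ⟨![2 * ((z 2).re + (z 3).re), 2 * ((z 3).im - (z 2).im), -2 * ((z 2).im + (z 3).im),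
      2 * ((z 3).re - (z 2).re)], ![2 * (z 0).re, -2 * (z 0).im, 2 * (z 1).re, -2 * (z 1).im],
      fun p => ?_⟩
    rw [hexp z h4 h5]
    simp
    ring

lemma sum_kernelMode (c : Fin 4 → ℝ) :
    ∑ i, c i • kernelMode i = ∑ i, wave (modeIndex i)
      ((![0, 0, 0, 0, ⟨c 1 / 2, -c 0 / 2⟩, ⟨c 3 / 2, -c 2 / 2⟩] : Fin 6 → ℂ) i) := by
  funext p
  simp only [Finset.sum_apply, Fin.sum_univ_six, Fin.sum_univ_four, wave_eq]
  simp [modeIndex, kernelMode]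
  ring

lemma wave_add (k : ℤ × ℤ) (z w : ℂ) : wave k (z + w) = wave k z + wave k w := by
  funext p
  simp [wave, add_mul, mul_add]

theorem mainTheorem5 :
    -- near the Clifford torus everything is well defined, and the second variations exist
    (∀ Φ Ψ : ℝ × ℝ → ℝ, IsTorusFunction Φ → IsTorusFunction Ψ →
      (∀ᶠ q : ℝ × ℝ in 𝓝 0,
        IsTorusImmersion (normalVariation cliffordTorus (q.1 • Φ + q.2 • Ψ)) ∧
        ∃! τ, IsTeichmuellerClass (normalVariation cliffordTorus (q.1 • Φ + q.2 • Ψ)) τ) ∧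
      ContDiffAt ℝ 2 (fun q : ℝ × ℝ =>
        willmore (normalVariation cliffordTorus (q.1 • Φ + q.2 • Ψ))) 0 ∧
      ContDiffAt ℝ 2 (fun q : ℝ × ℝ =>
        teichmuellerOne (normalVariation cliffordTorus (q.1 • Φ + q.2 • Ψ))) 0) ∧
    -- the largest `α > 0` with nonnegative second variation
    IsGreatest {α : ℝ | 0 < α ∧ ∀ Φ : ℝ × ℝ → ℝ, IsTorusFunction Φ →
      0 ≤ secondVariation (penalizedWillmore α) cliffordTorus Φ Φ} (10 * π ^ 2) ∧
    -- the kernel at this value is the sum of the Möbius variations and of the four modes,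
    (∀ Φ : ℝ × ℝ → ℝ, IsTorusFunction Φ →
      ((∀ Ψ : ℝ × ℝ → ℝ, IsTorusFunction Ψ →
          secondVariation (penalizedWillmore (10 * π ^ 2)) cliffordTorus Φ Ψ = 0) ↔
        ∃ (M : ℝ × ℝ → ℝ) (c : Fin 4 → ℝ),
          IsMoebiusVariation cliffordTorus M ∧ Φ = M + ∑ i, c i • kernelMode i)) ∧
    -- and this sum is direct, with linearly independent modes
    (∀ c : Fin 4 → ℝ, IsMoebiusVariation cliffordTorus (∑ i, c i • kernelMode i) → c = 0) := by
  refine ⟨fun Φ Ψ hΦ hΨ => ?_, ⟨⟨by positivity, fun Φ hΦ => ?_⟩, ?_⟩, fun Φ hΦ => ?_, ?_⟩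
  · obtain ⟨h1, h2, h3, -, -⟩ := family_cliffordTorus hΦ hΨ
    exact ⟨h1, h2, h3⟩
  · refine (hΦ.hasSum_secondVariation hΦ _).nonneg fun k => ?_
    rw [Complex.mul_conj, Complex.ofReal_re]
    have h1 := eigenvalue_nonneg k
    have h2 := Complex.normSq_nonneg (torusCoeff Φ k)
    positivity
  · -- the mode `cos √2(x + 2y)` bounds `α`
    rintro α ⟨-, h⟩
    have h1 := h _ (isTorusFunction_wave (1, 2) 1)
    rw [(isTorusFunction_wave (1, 2) 1).secondVariation_wave, torusCoeff_wave] at h1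
    norm_num [eigenvalue] at h1
    linarith
  · rw [hΦ.kernel_iff, hΦ.forall_eigenvalue_iff]
    constructor
    · rintro ⟨z, rfl⟩
      refine ⟨_, ![-2 * (z 4).im, 2 * (z 4).re, -2 * (z 5).im, 2 * (z 5).re],
        isMoebiusVariation_iff_wave.mpr ⟨![z 0, z 1, z 2, z 3, 0, 0], rfl, rfl, rfl⟩, ?_⟩
      rw [sum_kernelMode, ← Finset.sum_add_distrib]
      refine Finset.sum_congr rfl fun i _ => ?_
      rw [← wave_add]
      congr 1
      fin_cases i <;> simp
    · rintro ⟨M, c, hM, rfl⟩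
      obtain ⟨z, -, -, rfl⟩ := isMoebiusVariation_iff_wave.mp hM
      rw [sum_kernelMode, ← Finset.sum_add_distrib]
      exact ⟨_, Finset.sum_congr rfl fun i _ => (wave_add _ _ _).symm⟩
  · intro c hc
    obtain ⟨z, h4, h5, h⟩ := isMoebiusVariation_iff_wave.mp hc
    rw [sum_kernelMode] at h
    have e4 := congrArg (fun f => torusCoeff f (modeIndex 4)) h
    have e5 := congrArg (fun f => torusCoeff f (modeIndex 5)) h
    simp only [torusCoeff_sum_modeIndex, h4, h5] at e4 e5
    simp [Complex.ext_iff] at e4 e5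
    funext i
    fin_cases i <;> simp [e4, e5]
end
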